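/- Setting. Let $d=6$. Let $p$ be a probability distribution on $\{0,1,2,\dots\}$ with $\sum_k k\,p(k)=1$, $\sum_k k(k-1)p(k)=\sigma^2\in(0,\infty)$ and $\sum_k k^3p(k)\le C_3<\infty$, and let $\widetilde p(k)=(k+1)p(k+1)$, $k\ge 0$. Let $\mathbf p^1(x,y)=\mathbf p^1(o,y-x)$ be a random walk kernel on $\mathbb Z^6$ such that $\mathbf p^1(o,x)=\mathbf p^1(o,-x)$ for all $x$, such that $\{x:\mathbf p^1(o,x)>0\}$ generates $\mathbb Z^6$ as a group, and such that $\sum_x e^{b|x|}\mathbf p^1(o,x)<\infty$ for some $b>0$. Let $\mathbf p^k$ be its $k$-step kernel, let $Q_{ij}=\sum_x x_ix_j\mathbf p^1(o,x)$, and put $D=\det(Q)^{1/12}$ and $\|x\|=\big(\tfrac16\sum_{i,j}x_i(Q^{-1})_{ij}x_j\big)^{1/2}$. For integers $N\ge 1$ and $m\ge 2N$, let $\mathcal T_{N,m}$ be the random tree consisting of a backbone $V_0,\dots,V_N$ with root $\rho=V_0$, to each vertex $V_i$ of which one attaches, independently, a branching tree whose root has offspring law $\widetilde p$ and all of whose other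 vertices have offspring law $p$, conditioned to die out by time $m-i$ (to have no vertex in generation $m-i$). Write $h(U)$ for the distance of a vertex $U$ from the root, and $U\prec W$ if $W$ is a proper descendant of $U$. Given the tree, a random walk map with root at $x$ is $\Phi(U)=(u,h(U))$, where the root has location $x$ and the spatial displacements along the edges (from parent to child) are independent with law $\mathbf p^1(o,\cdot)$. For $U\prec W$ with locations $u,w$, the pair $U,W$ is typically spaced if $\|w-u\|\le\sqrt{h(W)-h(U)}$. Fix an integer $N=\delta n\ge1$ and $x\in\mathbb Z^6$. Let $\mathcal T_1,\mathcal T_2$ be independent copies of $\mathcal T_{N,2N}$ with roots $\rho_1,\rho_2$ and last backbone vertices $\mathcal V_1,\mathcal V_2$, and let $\Phi_1,\Phi_2$ be independent random walk maps on them with $\Phi_1(\rho_1)=(o,0)$ and $\Phi_2(\rho_2)=(x,0)$. For $U_j\in\mathcal T_j$ let $Z_j$ be the highest (that is, most recent) common ancestor of $U_j$ and $\mathcal V_j$, and $Z_j^+$ the child of $Z_j$ leading to $U_j$. Let $\mathcal I$ be the random set of pairs $(U_1,U_2)\in\mathcal T_1\times\mathcal T_2$ that intersect well, which means that: 1. $U_1\succ\rho_1$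 and $U_2\succ\rho_2$; 2. $\tfrac56N\le h(U_1)=h(U_2)\le N$; 3. $\tfrac12N\le h(Z_1),h(Z_2)\le\tfrac46N$; 4. for $j=1,2$, the pairs $\rho_j,Z_j$ and $Z_j^+,U_j$ are typically spaced; 5. $\Phi_1(U_1)=\Phi_2(U_2)$. Let $\mathcal I'\subset\mathcal I$ be the subset of those $(U_1,U_2)\in\mathcal I$ for which, in addition, $h(U_1)=h(U_2)\le\tfrac{11}{12}N$ and, for $j=1,2$, $\|z_j^+-u_j\|\le\tfrac12\sqrt{h(U_j)-h(Z_j^+)}$, where $z_j^+,u_j$ are the spatial locations of $Z_j^+,U_j$. Theorem. There are universal constants $c'>0$ and $C'<\infty$, and for all $\sigma$, $C_3$ and $\mathbf p^1$ as above there is $n_9'=n_9'(\sigma^2,C_3,\mathbf p^1)<\infty$, such that for every $p$ as above with these $\sigma^2,C_3$, every $N=\delta n\ge n_9'$ and every $x\in\mathbb Z^6$ with $\|x\|\le\sqrt{N}$, $$\mathbf E|\mathcal I|\ \ge\ \mathbf E|\mathcal I'|,\qquad \mathbf E|\mathcal I|^2\ \le\ \frac{C'\sigma^8}{D^{12}}\,\log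 N,$$ and, provided that $\mathbf p^{2k}(o,x)>0$ for some $k\ge0$ (which holds for every $x$ when the walk has period $1$), $$\mathbf E|\mathcal I'|\ \ge\ \frac{c'\sigma^4}{D^6}.$$ -/

import Mathlib

open MeasureTheory ProbabilityTheory
open scoped ENNReal

noncomputable section

namespace BRW

/-! ### The random walk -/

/-- The standing assumptions on the one-step law `q x = p¹(o, x)` of the random walk on `ℤᵈ`:
an exponential moment, support generating `ℤᵈ` as a group, and symmetry. -/
structure IsStepLaw {d : ℕ} (q : PMF (Fin d → ℤ)) : Prop where
  exp_moment : ∃ b : ℝ, 0 < b ∧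
    Summable fun x : Fin d → ℤ =>
      Real.exp (b * ‖(WithLp.toLp 2 (fun i => (x i : ℝ)) : EuclideanSpace ℝ (Fin d))‖)
        * (q x).toReal
  generates : AddSubgroup.closure q.support = ⊤
  symm : ∀ x, q (-x) = q x

/-- The `n`-step transition probabilities `pⁿ(o, ·)`. -/
def nStep {d : ℕ} (q : PMF (Fin d → ℤ)) : ℕ → PMF (Fin d → ℤ)
  | 0 => PMF.pure 0
  | n + 1 => (nStep q n).bind fun y => q.map fun s => y + s

/-- The covariance matrix `Q i j = ∑ₓ xᵢ xⱼ p¹(o, x)`. -/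
def covMatrix {d : ℕ} (q : PMF (Fin d → ℤ)) : Matrix (Fin d) (Fin d) ℝ :=
  fun i j => ∑' x : Fin d → ℤ, (x i : ℝ) * (x j : ℝ) * (q x).toReal

/-- The norm `‖x‖ = √((1/d) ∑ᵢⱼ xᵢ (Q⁻¹)ᵢⱼ xⱼ)` adapted to the walk. -/
def walkNorm {d : ℕ} (q : PMF (Fin d → ℤ)) (x : Fin d → ℤ) : ℝ :=
  Real.sqrt ((1 / (d : ℝ)) * ∑ i, ∑ j, (x i : ℝ) * (covMatrix q)⁻¹ i j * (x j : ℝ))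

/-- `D = det(Q)^{1/(2d)}`. -/
def scaleD {d : ℕ} (q : PMF (Fin d → ℤ)) : ℝ :=
  (covMatrix q).det ^ (1 / (2 * (d : ℝ)))

/-! ### The progeny distribution -/

/-- The progeny distribution `p` has mean `1`, second factorial moment `σ²`, and third moment
at most `C₃`. -/
structure IsProgenyLaw (p : PMF ℕ) (σ C₃ : ℝ) : Prop where
  mean : HasSum (fun k : ℕ => (k : ℝ) * (p k).toReal) 1
  second : HasSum (fun k : ℕ => (k : ℝ) * ((k : ℝ) - 1) * (p k).toReal) (σ ^ 2)
  third_summable : Summable fun k : ℕ => (k : ℝ) ^ 3 * (p k).toReal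
  third_le : ∑' k : ℕ, (k : ℝ) ^ 3 * (p k).toReal ≤ C₃

/-- The size-biased law `p̃(k) = (k + 1) p(k + 1)` of a law `p` of mean `1`. -/
def sizeBiased (p : PMF ℕ) (hp : HasSum (fun k : ℕ => (k : ℝ) * (p k).toReal) 1) : PMF ℕ :=
  ⟨fun k => ((k + 1 : ℕ) : ℝ≥0∞) * p (k + 1), by
    have h1 : HasSum (fun k : ℕ => ((k + 1 : ℕ) : ℝ) * (p (k + 1)).toReal) 1 := by
      have := (hasSum_nat_add_iff' (f := fun k : ℕ => (k : ℝ) * (p k).toReal) 1).2 hp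
      simpa using this
    have h2 : ∀ k : ℕ, ((k + 1 : ℕ) : ℝ≥0∞) * p (k + 1)
        = ENNReal.ofReal (((k + 1 : ℕ) : ℝ) * (p (k + 1)).toReal) := by
      intro k
      rw [ENNReal.ofReal_mul (by positivity), ENNReal.ofReal_natCast,
        ENNReal.ofReal_toReal (p.apply_ne_top _)]
    have h3 : ∑' k : ℕ, ((k + 1 : ℕ) : ℝ≥0∞) * p (k + 1) = 1 := by
      rw [tsum_congr h2, ← ENNReal.ofReal_tsum_of_nonneg (fun k => by positivity) h1.summable,
        h1.tsum_eq, ENNReal.ofReal_one]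
    exact h3 ▸ ENNReal.summable.hasSum⟩

/-! ### Galton-Watson trees

A vertex of a rooted ordered tree is coded by its line of descent, most recent birth first:
the root is `[]`, and the children of `w` are `0 :: w, 1 :: w, …`; the ancestors of `w`
(including `w`) are its suffixes, and its generation is its length.  A field
`ξ : List ℕ → ℕ` of offspring numbers determines a tree. -/

/-- `w` belongs to the tree with offspring numbers `ξ`. -/
def InTree (ξ : List ℕ → ℕ) : List ℕ → Prop
  | [] => True
  | c :: w => c < ξ w ∧ InTree ξ w

/-- The tree has died out by time `t`: there is no vertex in generation `t` (or later). -/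
def diesOutBy (t : ℕ) : Set (List ℕ → ℕ) :=
  {ξ | ∀ w, InTree ξ w → w.length < t}

/-- The law of the offspring numbers of a tree hanging off the backbone: independent, with law
`p̃` at the root and `p` at all other vertices. -/
def hangingTreeLaw (p : PMF ℕ) (hp : HasSum (fun k : ℕ => (k : ℝ) * (p k).toReal) 1) :
    Measure (List ℕ → ℕ) :=
  Measure.infinitePi fun w : List ℕ =>
    if w = [] then (sizeBiased p hp).toMeasure else p.toMeasure

/-! ### The tree `𝒯_{n,m}` with its backbone, and the random walk map

A vertex is a pair `(i, w)`: the vertex `w` of the tree attached to the backbone vertex `V_i`,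
where `V_i = (i, [])`. -/

/-- Vertex labels of trees with a backbone `V_0, …, V_n`. -/
abbrev Vertex (n : ℕ) := Fin (n + 1) × List ℕ

/-- The height of a vertex, that is, its distance from the root `V_0`. -/
def height {n : ℕ} (U : Vertex n) : ℕ := (U.1 : ℕ) + U.2.length

/-- `U` is an ancestor of `W`, or equal to it. -/
def AncestorEq {n : ℕ} (U W : Vertex n) : Prop :=
  (U.2 = [] ∧ U.1 ≤ W.1) ∨ (U.1 = W.1 ∧ U.2 <:+ W.2)

/-- `U ≺ W`: `W` is a (proper) descendant of `U`. -/
def Ancestor {n : ℕ} (U W : Vertex n) : Prop := AncestorEq U W ∧ U ≠ W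

/-- The root `V_0`. -/
def root (n : ℕ) : Vertex n := (0, [])

/-- The last backbone vertex `V_n`. -/
def lastBackbone (n : ℕ) : Vertex n := (Fin.last n, [])

/-- `Z` is the highest common ancestor of `U` and `V`: the one of largest height. -/
def IsHighestCommonAncestor {n : ℕ} (Z U V : Vertex n) : Prop :=
  AncestorEq Z U ∧ AncestorEq Z V ∧
    ∀ W, AncestorEq W U → AncestorEq W V → height W ≤ height Z

/-- `Z'` is the child of `Z` leading to `U`. -/
def IsChildToward {n : ℕ} (Z' Z U : Vertex n) : Prop :=
  Ancestor Z Z' ∧ height Z' = height Z + 1 ∧ AncestorEq Z' U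

/-- A realization of a branching random walk with backbone `V_0, …, V_n`: the offspring numbers
of the trees attached to the backbone, and for each vertex other than the root the
spatial displacement along the edge from its parent. -/
abbrev Sample (d n : ℕ) := (Fin (n + 1) → List ℕ → ℕ) × (Vertex n → Fin d → ℤ)

/-- The vertices of the tree. -/
def vertices {d n : ℕ} (ω : Sample d n) : Set (Vertex n) :=
  {U | InTree (ω.1 U.1) U.2}

/-- The total displacement along the path from the root `[]` to `w` inside the tree attached
to the backbone vertex with index `i`. -/
def hangingDisplacement {d n : ℕ} (ω : Sample d n) (i : Fin (n + 1)) : List ℕ → Fin d → ℤ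
  | [] => 0
  | c :: w => hangingDisplacement ω i w + ω.2 (i, c :: w)

/-- The spatial location of a vertex when the root is placed at `x`. -/
def location {d n : ℕ} (x : Fin d → ℤ) (ω : Sample d n) (U : Vertex n) : Fin d → ℤ :=
  x + ∑ j ∈ Finset.Ioc 0 U.1, ω.2 (j, []) + hangingDisplacement ω U.1 U.2

/-- The random walk map `Φ`, with `Φ(ρ) = (x, 0)`. -/
def walkMap {d n : ℕ} (x : Fin d → ℤ) (ω : Sample d n) (U : Vertex n) : (Fin d → ℤ) × ℕ :=
  (location x ω U, height U)

/-- The law of `𝒯_{n,m}` together with its random walk map: the trees attached to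
`V_0, …, V_n` are independent, the `i`-th one conditioned to die out by time `m - i`, and
independently the displacements along the edges are i.i.d. with law `q`. -/
def brwLaw {d : ℕ} (q : PMF (Fin d → ℤ)) (p : PMF ℕ)
    (hp : HasSum (fun k : ℕ => (k : ℝ) * (p k).toReal) 1) (n m : ℕ) : Measure (Sample d n) :=
  (Measure.pi fun i : Fin (n + 1) => cond (hangingTreeLaw p hp) (diesOutBy (m - (i : ℕ)))).prod
    (Measure.infinitePi fun _ : Vertex n => q.toMeasure)

/-! ### Pairs that intersect well -/

/-- `U` and `W` are typically spaced: `‖w - u‖ ≤ √(h(W) - h(U))`. -/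
def TypicallySpaced {d n : ℕ} (q : PMF (Fin d → ℤ)) (x : Fin d → ℤ) (ω : Sample d n)
    (U W : Vertex n) : Prop :=
  walkNorm q (location x ω W - location x ω U) ≤ Real.sqrt ((height W : ℝ) - (height U : ℝ))

/-- The conditions for `U₁` and `U₂` to intersect well that concern only one of the two trees,
when the root is placed at `x`; here `N` is the common scale, and
`Z`, `Z'` are the highest common ancestor of `U` and `V_N` and its child leading to `U`. -/
structure BranchesWell {d N : ℕ} (q : PMF (Fin d → ℤ)) (x : Fin d → ℤ) (ω : Sample d N)
    (U Z Z' : Vertex N) : Prop where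
  mem : U ∈ vertices ω
  descendant : Ancestor (root N) U
  isHCA : IsHighestCommonAncestor Z U (lastBackbone N)
  isChild : IsChildToward Z' Z U
  height_ge : 5 / 6 * (N : ℝ) ≤ (height U : ℝ)
  height_le : height U ≤ N
  branch_ge : 1 / 2 * (N : ℝ) ≤ (height Z : ℝ)
  branch_le : (height Z : ℝ) ≤ 4 / 6 * (N : ℝ)
  spaced_root : TypicallySpaced q x ω (root N) Z
  spaced_child : TypicallySpaced q x ω Z' U

/-- The random set `𝓘` of pairs `(U₁, U₂)` that intersect well, for two branching random walks
`ω.1`, `ω.2` started from `(o, 0)` and `(x, 0)`.  Equality of the images under the random walk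
maps includes equality of the heights. -/
def intersections {d N : ℕ} (q : PMF (Fin d → ℤ)) (x : Fin d → ℤ)
    (ω : Sample d N × Sample d N) : Set (Vertex N × Vertex N) :=
  {U | (∃ Z₁ Z₁', BranchesWell q 0 ω.1 U.1 Z₁ Z₁') ∧
       (∃ Z₂ Z₂', BranchesWell q x ω.2 U.2 Z₂ Z₂') ∧
       walkMap 0 ω.1 U.1 = walkMap x ω.2 U.2}

/-- The additional requirements on `U₁` (or `U₂`) in the definition of `𝓘'`. -/
def RestrictedBranch {d N : ℕ} (q : PMF (Fin d → ℤ)) (x : Fin d → ℤ) (ω : Sample d N)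
    (U : Vertex N) : Prop :=
  (height U : ℝ) ≤ 11 / 12 * (N : ℝ) ∧
  ∀ Z Z', IsHighestCommonAncestor Z U (lastBackbone N) → IsChildToward Z' Z U →
    walkNorm q (location x ω Z' - location x ω U)
      ≤ 1 / 2 * Real.sqrt ((height U : ℝ) - (height Z' : ℝ))

/-- The random subset `𝓘'` of `𝓘`. -/
def restrictedIntersections {d N : ℕ} (q : PMF (Fin d → ℤ)) (x : Fin d → ℤ)
    (ω : Sample d N × Sample d N) : Set (Vertex N × Vertex N) :=
  {U | U ∈ intersections q x ω ∧ RestrictedBranch q 0 ω.1 U.1 ∧ RestrictedBranch q x ω.2 U.2}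

/-- The number of elements of a set, as an extended nonnegative real. -/
def count {α : Type*} (s : Set α) : ℝ≥0∞ := (s.encard : ℝ≥0∞)

/-- The law of two independent copies of `𝒯_{N,2N}` with independent random walk maps. -/
def pairLaw {d : ℕ} (q : PMF (Fin d → ℤ)) (p : PMF ℕ)
    (hp : HasSum (fun k : ℕ => (k : ℝ) * (p k).toReal) 1) (N : ℕ) :
    Measure (Sample d N × Sample d N) :=
  (brwLaw q p hp N (2 * N)).prod (brwLaw q p hp N (2 * N))

end BRW

end

/-! The theorem is a first and a second moment computation for pairs of vertices, and the exponents
balance because the dimension is 6. Write S = √det Q = D⁶. By the local limit theorem pⁿ(o,y) is at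
most of order n⁻³/S, and at least of this order when ‖y‖ ≤ √n and y has the right parity
(`exists_nStep_le`, `exists_le_nStep`).

First moment. There are of order N³ choices of the two branch heights i₁, i₂ and of the common
height h. For each choice a hanging tree has, in expectation, order σ² vertices in the required
generation, and this remains so on the event that it dies out in time
(`exists_genSum_diesOutBy_ge`). For a given pair of vertices, all displacements except the one along
the first backbone are typical with probability bounded below. The condition that the paths meet
then prescribes the remaining displacement, which has probability at least of order 1/(N³S)
(`exists_le_tsum_displacementProb`). The product is σ⁴/S. The assumption that x is reachable in an
even number of steps serves only to give the prescribed displacement the right parity.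

Second moment. Consider two intersecting pairs at heights h, h', whose paths separate at height a in
the first tree and at height b in the second. Given the difference z of the two separation points,
the two meetings have probabilities p^k(o,z) and p^l(o,z), where k + l = 2(h+h'-a-b), and z itself
has a law dominated by the maximum of p^(a+b). Summing over z bounds the joint probability by max
p^(a+b) times p^(2(h+h'-a-b))(o,o) (`tsum_forkProb_mul_le`). All branching from the backbone occurs
above N/2, so a+b ≥ N and the first factor is O(N⁻³/S). In one tree the expected number of pairs of
vertices with data h, h', a is O(Nσ⁴), with an extra O(Nσ²) when a = min(h,h'), which covers the
case that one vertex is an ancestor of the other (`pairWeight_le`). For a given r = h+h'-a-b there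
are O(N r²) choices of the heights, up to the extra term, and the total is of order N²σ⁸ · N · N⁻³/S
· Σ_{r ≤ 3N} r² · r⁻³/S, that is, σ⁸ log N / S². The extra term and C₃ affect only lower orders and
disappear for large N. Typical spacing is simply dropped in this bound.

Conditioning. The extinction events have probability at least 1/2 for large N, so conditioning at
most doubles probabilities. For lower bounds one needs the expected generation size on the event of
survival; it is controlled by branching off a surviving line from the path to the vertex, together
with a Kolmogorov type bound 3/(σ²i) for the survival probability, uniform in the progeny law
(`exists_survivalProb_le`).

Local limit theorem. The walk may have period 2, so Fourier inversion is applied to an average of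
p^(n+j) over a binomial number j of further steps. This multiplies φⁿ by ((1+φ)/2)^(d+1) and
suppresses the frequencies where the characteristic function φ is close to -1. The upper bound
follows because pⁿ is one term of the average. The lower bound follows because, at points of the
right parity, every p^(n+j) is either zero or close to pⁿ (`exists_nStep_sub_error`). -/

noncomputable section

namespace BRW

/-! ### Transition probabilities -/

section Walk

variable {d : ℕ} (q : PMF (Fin d → ℤ))

lemma nStep_succ_apply (n : ℕ) (y : Fin d → ℤ) :
    nStep q (n + 1) y = ∑' z, nStep q n z * q (y - z) := by
  simp only [nStep, PMF.bind_apply, PMF.map_apply]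
  refine tsum_congr fun z => ?_
  congr 1
  rw [tsum_eq_single (y - z)]
  · simp
  · intro s hs
    rw [if_neg]
    rintro rfl
    simp at hs

lemma nStep_zero_apply (y : Fin d → ℤ) : nStep q 0 y = if y = 0 then 1 else 0 := by
  simp [nStep, PMF.pure_apply]

lemma nStep_one_apply (y : Fin d → ℤ) : nStep q 1 y = q y := by
  rw [nStep_succ_apply, tsum_eq_single 0]
  · simp [nStep_zero_apply]
  · intro z hz
    simp [nStep_zero_apply, hz]

lemma nStep_add (m n : ℕ) (y : Fin d → ℤ) :
    ∑' z, nStep q m z * nStep q n (y - z) = nStep q (m + n) y := by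
  induction n generalizing y with
  | zero =>
    rw [tsum_eq_single y]
    · simp [nStep_zero_apply]
    · intro z hz
      rw [nStep_zero_apply, if_neg (by rwa [sub_eq_zero, eq_comm]), mul_zero]
  | succ n ih =>
    have h1 : ∀ z, nStep q m z * nStep q (n + 1) (y - z)
        = ∑' u, nStep q m z * nStep q n (u - z) * q (y - u) := by
      intro z
      rw [nStep_succ_apply, ← ENNReal.tsum_mul_left, ← (Equiv.subRight z).tsum_eq]
      refine tsum_congr fun u => ?_
      simp only [Equiv.subRight_apply]
      rw [mul_assoc]
      congr 3
      abel
    rw [tsum_congr h1, ENNReal.tsum_comm, ← add_assoc, nStep_succ_apply]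
    refine tsum_congr fun u => ?_
    rw [ENNReal.tsum_mul_right, ih]

variable {q}

lemma nStep_neg (hq : ∀ x, q (-x) = q x) (n : ℕ) (y : Fin d → ℤ) :
    nStep q n (-y) = nStep q n y := by
  induction n generalizing y with
  | zero => simp [nStep_zero_apply]
  | succ n ih =>
    rw [nStep_succ_apply, nStep_succ_apply, ← (Equiv.neg _).tsum_eq]
    refine tsum_congr fun z => ?_
    simp only [Equiv.neg_apply]
    rw [ih, ← hq]
    congr 2
    abel

lemma nStep_pos_add {m n : ℕ} {y z : Fin d → ℤ} (hy : 0 < nStep q m y) (hz : 0 < nStep q n z) :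
    0 < nStep q (m + n) (y + z) := by
  rw [← nStep_add]
  refine lt_of_lt_of_le (ENNReal.mul_pos hy.ne' (b := nStep q n (y + z - y)) ?_)
    (ENNReal.le_tsum y)
  simpa using hz.ne'

end Walk

/-! ### Coordinates of a product space -/

section Coordinates

variable {ι : Type*} {X : ι → Type*} [∀ i, MeasurableSpace (X i)]

/-- The σ-algebra generated by the coordinates with index in `S`. -/
@[reducible] def coordSigma (S : Set ι) : MeasurableSpace (∀ i, X i) :=
  ⨆ i ∈ S, MeasurableSpace.comap (fun ω => ω i) inferInstance

lemma coordSigma_mono {S T : Set ι} (h : S ⊆ T) :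
    coordSigma (X := X) S ≤ coordSigma T :=
  biSup_mono h

lemma coordSigma_le (S : Set ι) : coordSigma (X := X) S ≤ MeasurableSpace.pi :=
  iSup₂_le fun i _ => (measurable_pi_apply i).comap_le

lemma measurable_coord {S : Set ι} {i : ι} (hi : i ∈ S) :
    Measurable[coordSigma (X := X) S] fun ω : ∀ i, X i => ω i := by
  rw [measurable_iff_comap_le]
  exact le_iSup₂_of_le i hi le_rfl

/-- Disjoint blocks of independent coordinates are independent. Factorizations over disjoint paths,
over disjoint subtrees and over trees at different backbone vertices all use this form. -/
lemma infinitePi_inter {μ : ∀ i, Measure (X i)} [∀ i, IsProbabilityMeasure (μ i)]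
    {S T : Set ι} (hST : Disjoint S T) {A B : Set (∀ i, X i)}
    (hA : MeasurableSet[coordSigma S] A) (hB : MeasurableSet[coordSigma T] B) :
    Measure.infinitePi μ (A ∩ B) = Measure.infinitePi μ A * Measure.infinitePi μ B := by
  have h := iIndepFun_infinitePi (P := μ) (X := fun _ ω => ω) (fun _ => measurable_id)
  rw [iIndepFun_iff_iIndep] at h
  have h2 := indep_iSup_of_disjoint (fun i => (measurable_pi_apply i).comap_le) h hST
  rw [Indep_iff] at h2
  exact h2 A B hA hB

lemma infinitePi_eval_preimage {μ : ∀ i, Measure (X i)} [∀ i, IsProbabilityMeasure (μ i)]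
    (i : ι) {s : Set (X i)} (hs : MeasurableSet s) :
    Measure.infinitePi μ {ω | ω i ∈ s} = μ i s :=
  (measurePreserving_eval_infinitePi μ i).measure_preimage hs.nullMeasurableSet

end Coordinates

/-! ### Sums of displacements -/

section Displacements

variable {d : ℕ} {ι : Type*} [DecidableEq ι] (q : PMF (Fin d → ℤ))

lemma measurable_sum_coord (E : Finset ι) {S : Set ι} (hE : (E : Set ι) ⊆ S) :
    Measurable[coordSigma S] fun ω : ι → Fin d → ℤ => ∑ e ∈ E, ω e := by
  classical
  induction E using Finset.induction_on with
  | empty => simp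
  | insert a E ha ih =>
    simp only [Finset.sum_insert ha]
    simp only [Finset.coe_insert, Set.insert_subset_iff] at hE
    exact (measurable_coord (X := fun _ : ι => Fin d → ℤ) hE.1).add (ih hE.2)

lemma measurableSet_sum_eq (E : Finset ι) (y : Fin d → ℤ) :
    MeasurableSet[coordSigma (E : Set ι)] {ω : ι → Fin d → ℤ | ∑ e ∈ E, ω e = y} :=
  measurable_sum_coord E subset_rfl (measurableSet_singleton y)

/-- The law of the sum of the displacements along `n` edges is the `n`-step law. -/
lemma infinitePi_sum_eq (E : Finset ι) (y : Fin d → ℤ) :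
    Measure.infinitePi (fun _ : ι => q.toMeasure) {ω | ∑ e ∈ E, ω e = y}
      = nStep q E.card y := by
  classical
  induction E using Finset.induction_on generalizing y with
  | empty =>
    by_cases h : y = 0
    · simp [nStep_zero_apply, h]
    · simp [nStep_zero_apply, h, Ne.symm h]
  | insert a E ha ih =>
    have h1 : {ω : ι → Fin d → ℤ | ∑ e ∈ insert a E, ω e = y}
        = ⋃ z, ({ω | ∑ e ∈ E, ω e = z} ∩ {ω | ω a ∈ ({y - z} : Set (Fin d → ℤ))}) := by
      ext ω
      simp only [Finset.sum_insert ha, Set.mem_ofPred_eq, Set.mem_iUnion, Set.mem_inter_iff,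
        Set.mem_singleton_iff]
      constructor
      · intro h
        exact ⟨_, rfl, by rw [← h]; abel⟩
      · rintro ⟨z, rfl, h⟩
        rw [h]; abel
    have hm : ∀ z, MeasurableSet[coordSigma (E : Set ι)]
        {ω : ι → Fin d → ℤ | ∑ e ∈ E, ω e = z} := measurableSet_sum_eq E
    have hm' : ∀ z : Fin d → ℤ, MeasurableSet[coordSigma ({a} : Set ι)]
        {ω : ι → Fin d → ℤ | ω a ∈ ({y - z} : Set (Fin d → ℤ))} := fun z =>
      measurable_coord (X := fun _ : ι => Fin d → ℤ) (Set.mem_singleton a)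
        (measurableSet_singleton (y - z))
    rw [h1, measure_iUnion, Finset.card_insert_of_notMem ha, nStep_succ_apply]
    · refine tsum_congr fun z => ?_
      rw [infinitePi_inter (S := (E : Set ι)) (T := {a}) (by simp [ha]) (hm z) (hm' z),
        ih, infinitePi_eval_preimage a (measurableSet_singleton _),
        PMF.toMeasure_apply_singleton _ _ (measurableSet_singleton _)]
    · intro z w hzw
      refine Set.disjoint_left.2 fun ω hz hw => hzw ?_
      exact hz.1.symm.trans hw.1
    · exact fun z => (coordSigma_le _ _ (hm z)).inter (coordSigma_le _ _ (hm' z))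

/-- Three blocks suffice below: the common part and the two remainders of two paths, or the
backbone, the next edge and the rest of one path. -/
lemma infinitePi_sum_eq_three {E₀ E₁ E₂ : Finset ι} (h01 : Disjoint E₀ E₁) (h02 : Disjoint E₀ E₂)
    (h12 : Disjoint E₁ E₂) (a b c : Fin d → ℤ) :
    Measure.infinitePi (fun _ : ι => q.toMeasure)
        {ω | ∑ e ∈ E₀, ω e = a ∧ ∑ e ∈ E₁, ω e = b ∧ ∑ e ∈ E₂, ω e = c}
      = nStep q E₀.card a * (nStep q E₁.card b * nStep q E₂.card c) := by
  have hs : {ω : ι → Fin d → ℤ | ∑ e ∈ E₀, ω e = a ∧ ∑ e ∈ E₁, ω e = b ∧ ∑ e ∈ E₂, ω e = c}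
      = {ω | ∑ e ∈ E₀, ω e = a} ∩ ({ω | ∑ e ∈ E₁, ω e = b} ∩ {ω | ∑ e ∈ E₂, ω e = c}) := rfl
  have h1 := measurableSet_sum_eq (d := d) E₁ b
  have h2 := measurableSet_sum_eq (d := d) E₂ c
  rw [hs, infinitePi_inter (S := (E₀ : Set ι)) (T := (E₁ : Set ι) ∪ (E₂ : Set ι)),
    infinitePi_inter (S := (E₁ : Set ι)) (T := (E₂ : Set ι)), infinitePi_sum_eq,
    infinitePi_sum_eq, infinitePi_sum_eq]
  · exact_mod_cast h12
  · exact h1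
  · exact h2
  · rw [Set.disjoint_union_right]
    exact ⟨by exact_mod_cast h01, by exact_mod_cast h02⟩
  · exact measurableSet_sum_eq E₀ a
  · exact MeasurableSet.inter (coordSigma_mono Set.subset_union_left _ h1)
      (coordSigma_mono Set.subset_union_right _ h2)

end Displacements

/-! ### Characteristic function of the walk -/

section CharFun

variable {d : ℕ}

/-- The scalar product of a frequency `t` and a lattice point `x`. -/
def dot (t : Fin d → ℝ) (x : Fin d → ℤ) : ℝ := ∑ i, t i * (x i : ℝ)

lemma dot_add (t : Fin d → ℝ) (x y : Fin d → ℤ) : dot t (x + y) = dot t x + dot t y := by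
  simp [dot, mul_add, Finset.sum_add_distrib]

lemma dot_neg (t : Fin d → ℝ) (x : Fin d → ℤ) : dot t (-x) = -dot t x := by
  simp [dot]

lemma dot_smul (c : ℝ) (t : Fin d → ℝ) (x : Fin d → ℤ) : dot (c • t) x = c * dot t x := by
  simp [dot, Finset.mul_sum, mul_assoc]

@[fun_prop]
lemma continuous_dot (x : Fin d → ℤ) : Continuous fun t : Fin d → ℝ => dot t x := by
  unfold dot
  fun_prop

lemma measurable_of_lattice {β : Type*} [MeasurableSpace β] (f : (Fin d → ℤ) → β) :
    Measurable f := measurable_of_countable f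

lemma measurable_dot : Measurable fun z : (Fin d → ℝ) × (Fin d → ℤ) => dot z.1 z.2 := by
  unfold dot
  fun_prop

variable (q : PMF (Fin d → ℤ))

/-- The characteristic function of a symmetric law. -/
def phi (t : Fin d → ℝ) : ℝ := ∫ x, Real.cos (dot t x) ∂q.toMeasure

lemma integrable_cos (t : Fin d → ℝ) :
    Integrable (fun x => Real.cos (dot t x)) q.toMeasure :=
  Integrable.of_bound (measurable_of_lattice _).aestronglyMeasurable 1
    (Filter.Eventually.of_forall fun x => by simpa using Real.abs_cos_le_one _)

lemma integrable_cexp (t : Fin d → ℝ) (q : PMF (Fin d → ℤ)) :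
    Integrable (fun x => Complex.exp ((dot t x : ℝ) * Complex.I)) q.toMeasure :=
  Integrable.of_bound (measurable_of_lattice _).aestronglyMeasurable 1
    (Filter.Eventually.of_forall fun x => by simp)

lemma abs_phi_le_one (t : Fin d → ℝ) : |phi q t| ≤ 1 := by
  have := norm_integral_le_of_norm_le_const (μ := q.toMeasure) (C := 1)
    (f := fun x => Real.cos (dot t x))
    (Filter.Eventually.of_forall fun x => by simpa using Real.abs_cos_le_one _)
  simpa [phi] using this

@[fun_prop]
lemma continuous_phi : Continuous (phi q) := by
  refine continuous_of_dominated (bound := fun _ => 1)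
    (fun t => (measurable_of_lattice _).aestronglyMeasurable)
    (fun t => Filter.Eventually.of_forall fun x => by simpa using Real.abs_cos_le_one _)
    (integrable_const _) (Filter.Eventually.of_forall fun x => by fun_prop)

lemma toMeasure_neg (hq : ∀ x, q (-x) = q x) :
    q.toMeasure.map (fun x => -x) = q.toMeasure := by
  refine Measure.ext_of_singleton fun x => ?_
  rw [Measure.map_apply (measurable_of_lattice _) (measurableSet_singleton _)]
  have : (fun x : Fin d → ℤ => -x) ⁻¹' {x} = {-x} := by
    ext y
    simp
  rw [this, PMF.toMeasure_apply_singleton _ _ (measurableSet_singleton _),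
    PMF.toMeasure_apply_singleton _ _ (measurableSet_singleton _), hq]

/-- Symmetry of the law kills the sine part, so the real cosine transform carries all the
information. -/
lemma integral_cexp_eq_phi (hq : ∀ x, q (-x) = q x) (t : Fin d → ℝ) :
    ∫ x, Complex.exp ((dot t x : ℝ) * Complex.I) ∂q.toMeasure = phi q t := by
  have hs : ∫ x, Real.sin (dot t x) ∂q.toMeasure = 0 := by
    have h := integral_map (μ := q.toMeasure) (φ := fun x : Fin d → ℤ => -x)
      (f := fun x => Real.sin (dot t x)) (measurable_of_lattice _).aemeasurable
      (measurable_of_lattice _).aestronglyMeasurable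
    rw [toMeasure_neg q hq] at h
    simp only [dot_neg, Real.sin_neg, integral_neg] at h
    linarith
  apply Complex.ext
  · rw [← RCLike.re_eq_complex_re, ← integral_re (integrable_cexp t q)]
    simp [phi, Complex.exp_ofReal_mul_I_re]
  · rw [← RCLike.im_eq_complex_im, ← integral_im (integrable_cexp t q)]
    simpa [Complex.exp_ofReal_mul_I_im] using hs

lemma nStep_succ_toMeasure (n : ℕ) :
    (nStep q (n + 1)).toMeasure
      = ((nStep q n).toMeasure.prod q.toMeasure).map fun z => z.1 + z.2 := by
  refine Measure.ext_of_singleton fun y => ?_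
  have hm : Measurable fun z : (Fin d → ℤ) × (Fin d → ℤ) => z.1 + z.2 := measurable_of_countable _
  rw [Measure.map_apply hm (measurableSet_singleton _),
    Measure.prod_apply (hm (measurableSet_singleton _)), lintegral_countable',
    PMF.toMeasure_apply_singleton _ _ (measurableSet_singleton _), nStep_succ_apply]
  refine tsum_congr fun z => ?_
  have : Prod.mk z ⁻¹' ((fun z : (Fin d → ℤ) × (Fin d → ℤ) => z.1 + z.2) ⁻¹' {y}) = {y - z} := by
    ext w
    simp [eq_sub_iff_add_eq, add_comm]
  rw [this, PMF.toMeasure_apply_singleton _ _ (measurableSet_singleton _),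
    PMF.toMeasure_apply_singleton _ _ (measurableSet_singleton _), mul_comm]

lemma integral_cexp_nStep (hq : ∀ x, q (-x) = q x) (n : ℕ) (t : Fin d → ℝ) :
    ∫ x, Complex.exp ((dot t x : ℝ) * Complex.I) ∂(nStep q n).toMeasure = (phi q t : ℂ) ^ n := by
  induction n with
  | zero =>
    rw [pow_zero, nStep, PMF.toMeasure_pure, integral_dirac]
    simp [dot]
  | succ n ih =>
    rw [nStep_succ_toMeasure, integral_map (measurable_of_countable _).aemeasurable
      (measurable_of_lattice _).aestronglyMeasurable]
    simp only [dot_add, Complex.ofReal_add, add_mul, Complex.exp_add]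
    rw [integral_prod_mul (fun x => Complex.exp ((dot t x : ℝ) * Complex.I))
      (fun x => Complex.exp ((dot t x : ℝ) * Complex.I)), ih, integral_cexp_eq_phi q hq, pow_succ]

lemma phi_nStep (hq : ∀ x, q (-x) = q x) (n : ℕ) (t : Fin d → ℝ) :
    phi (nStep q n) t = phi q t ^ n := by
  have h := integral_cexp_eq_phi (nStep q n) (nStep_neg hq n) t
  rw [integral_cexp_nStep q hq] at h
  exact_mod_cast h.symm

/-- The fundamental domain `(-π, π]ᵈ` of frequencies. -/
def freqBox (d : ℕ) : Set (Fin d → ℝ) := Set.univ.pi fun _ => Set.Ioc (-Real.pi) Real.pi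

lemma measurableSet_freqBox : MeasurableSet (freqBox d) :=
  MeasurableSet.univ_pi fun _ => measurableSet_Ioc

lemma volume_freqBox : volume (freqBox d) = ENNReal.ofReal ((2 * Real.pi) ^ d) := by
  rw [freqBox, volume_pi_pi]
  simp [ENNReal.ofReal_pow Real.two_pi_pos.le, ← two_mul]

instance : IsFiniteMeasure (volume.restrict (freqBox d)) :=
  ⟨by rw [Measure.restrict_apply_univ, volume_freqBox]; exact ENNReal.ofReal_lt_top⟩

lemma integral_cexp_int (m : ℤ) :
    ∫ t in Set.Ioc (-Real.pi) Real.pi, Complex.exp ((t * m : ℝ) * Complex.I)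
      = if m = 0 then ((2 * Real.pi : ℝ) : ℂ) else 0 := by
  rw [← intervalIntegral.integral_of_le (by linarith [Real.pi_pos])]
  split_ifs with h
  · simp [h]; ring
  · have hc : (m : ℂ) * Complex.I ≠ 0 := by simp [h]
    have : ∀ t : ℝ, ((t * m : ℝ) : ℂ) * Complex.I = (m * Complex.I) * t := by
      intro t; push_cast; ring
    simp only [this]
    rw [integral_exp_mul_complex hc]
    have h2 : Complex.exp (m * Complex.I * ((Real.pi : ℝ) : ℂ))
        = Complex.exp (m * Complex.I * ((-Real.pi : ℝ) : ℂ)) := by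
      rw [Complex.exp_eq_exp_iff_exists_int]
      exact ⟨m, by push_cast; ring⟩
    rw [h2, sub_self, zero_div]

lemma integral_freqBox_cexp (v : Fin d → ℤ) :
    ∫ t in freqBox d, Complex.exp ((dot t v : ℝ) * Complex.I)
      = if v = 0 then (((2 * Real.pi) ^ d : ℝ) : ℂ) else 0 := by
  have h1 : ∀ t : Fin d → ℝ, Complex.exp ((dot t v : ℝ) * Complex.I)
      = ∏ i, Complex.exp ((t i * v i : ℝ) * Complex.I) := by
    intro t
    rw [← Complex.exp_sum]
    simp [dot, Finset.sum_mul]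
  simp only [h1]
  rw [freqBox, volume_pi, Measure.restrict_pi_pi,
    integral_fintype_prod_eq_prod (fun i (t : ℝ) => Complex.exp ((t * v i : ℝ) * Complex.I))]
  simp only [integral_cexp_int]
  split_ifs with h
  · simp [h]
  · obtain ⟨i, hi⟩ : ∃ i, v i ≠ 0 := by
      by_contra! h'
      exact h (funext h')
    exact Finset.prod_eq_zero (Finset.mem_univ i) (by simp [hi])

/-- Fourier inversion for the `n`-step transition probabilities. -/
lemma integral_phi_pow_mul_cos (hq : ∀ x, q (-x) = q x) (n : ℕ) (y : Fin d → ℤ) :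
    ∫ t in freqBox d, phi q t ^ n * Real.cos (dot t y)
      = (2 * Real.pi) ^ d * (nStep q n y).toReal := by
  have hc : ∫ t in freqBox d, (phi q t : ℂ) ^ n * Complex.exp ((-dot t y : ℝ) * Complex.I)
      = (((2 * Real.pi) ^ d * (nStep q n y).toReal : ℝ) : ℂ) := by
    have h1 : ∀ t : Fin d → ℝ, (phi q t : ℂ) ^ n * Complex.exp ((-dot t y : ℝ) * Complex.I)
        = ∫ x, Complex.exp ((dot t (x - y) : ℝ) * Complex.I) ∂(nStep q n).toMeasure := by
      intro t
      rw [← integral_cexp_nStep q hq, ← integral_mul_const]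
      refine integral_congr_ae (Filter.Eventually.of_forall fun x => ?_)
      simp only [sub_eq_add_neg, dot_add, dot_neg, Complex.ofReal_add, add_mul, Complex.exp_add]
    simp only [h1]
    rw [integral_integral_swap]
    · simp only [integral_freqBox_cexp, sub_eq_zero]
      have : (fun x : Fin d → ℤ => if x = y then (((2 * Real.pi) ^ d : ℝ) : ℂ) else 0)
          = Set.indicator {y} fun _ => (((2 * Real.pi) ^ d : ℝ) : ℂ) := by
        ext x
        simp [Set.indicator_apply]
      rw [this, integral_indicator_const _ (measurableSet_singleton y), measureReal_def,
        PMF.toMeasure_apply_singleton _ _ (measurableSet_singleton _)]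
      simp [mul_comm]
    · refine Integrable.of_bound (C := 1) (Measurable.aestronglyMeasurable ?_)
        (Filter.Eventually.of_forall fun z => ?_)
      · have := (measurable_dot (d := d)).comp
          (measurable_fst.prodMk ((measurable_of_lattice (fun x : Fin d → ℤ => x - y)).comp
            (measurable_snd (α := Fin d → ℝ))))
        simp only [Function.uncurry_def]
        simp only [Function.comp_def] at this
        fun_prop
      · simp only [Function.uncurry_def, Complex.norm_exp_ofReal_mul_I, le_refl]
  have hi : Integrable (fun t => (phi q t : ℂ) ^ n * Complex.exp ((-dot t y : ℝ) * Complex.I))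
      (volume.restrict (freqBox d)) := by
    refine Integrable.of_bound (C := 1) (Continuous.aestronglyMeasurable (by fun_prop))
      (Filter.Eventually.of_forall fun t => ?_)
    rw [norm_mul, Complex.norm_exp_ofReal_mul_I, mul_one, norm_pow, Complex.norm_real]
    exact pow_le_one₀ (norm_nonneg _) (abs_phi_le_one q t)
  have := congrArg Complex.re hc
  rw [← RCLike.re_eq_complex_re, ← integral_re hi, RCLike.re_eq_complex_re,
    Complex.ofReal_re] at this
  rw [← this]
  refine integral_congr_ae (Filter.Eventually.of_forall fun t => ?_)
  simp only [← Complex.ofReal_pow, Complex.re_ofReal_mul,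
    Complex.exp_ofReal_mul_I_re, Real.cos_neg]

end CharFun

/-! ### The characteristic function near the origin -/

section PhiBounds

variable {d : ℕ} {q : PMF (Fin d → ℤ)}

/-- Since 1 - cos θ = 2 sin²(θ/2), this is |sin(α+β)| ≤ |sin α| + |sin β| squared. It propagates a
bound from the support of the law to the group that the support generates. -/
lemma one_sub_cos_add_le (a b : ℝ) :
    1 - Real.cos (a + b) ≤ 2 * (1 - Real.cos a) + 2 * (1 - Real.cos b) := by
  rw [Real.cos_add]
  nlinarith [Real.sin_sq_add_cos_sq a, Real.sin_sq_add_cos_sq b, sq_nonneg (Real.sin a - Real.sin b),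
    Real.cos_le_one a, Real.cos_le_one b,
    mul_nonneg (sub_nonneg.2 (Real.cos_le_one a)) (sub_nonneg.2 (Real.cos_le_one b)),
    sq_nonneg (Real.cos a - Real.cos b)]

/-- 1 - φ(t) is the mean of the nonnegative function 1 - cos(t·x); keep a single atom. -/
lemma mul_one_sub_cos_le (t : Fin d → ℝ) (x : Fin d → ℤ) :
    (q x).toReal * (1 - Real.cos (dot t x)) ≤ 1 - phi q t := by
  have h1 : 1 - phi q t = ∫ x, (1 - Real.cos (dot t x)) ∂q.toMeasure := by
    rw [integral_sub (integrable_const _) (integrable_cos q t)]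
    simp [phi]
  have hi : Integrable (fun x => 1 - Real.cos (dot t x)) q.toMeasure :=
    (integrable_const _).sub (integrable_cos q t)
  have h0 : ∀ x : Fin d → ℤ, 0 ≤ 1 - Real.cos (dot t x) := fun x =>
    sub_nonneg.2 (Real.cos_le_one _)
  rw [h1]
  calc (q x).toReal * (1 - Real.cos (dot t x))
      = ∫ x in {x}, (1 - Real.cos (dot t x)) ∂q.toMeasure := by
        rw [integral_singleton, measureReal_def,
          PMF.toMeasure_apply_singleton _ _ (measurableSet_singleton _), smul_eq_mul]
    _ ≤ _ := setIntegral_le_integral hi (Filter.Eventually.of_forall h0)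

lemma exists_one_sub_cos_le (hq : IsStepLaw q) (v : Fin d → ℤ) :
    ∃ K : ℝ, 0 ≤ K ∧ ∀ t, 1 - Real.cos (dot t v) ≤ K * (1 - phi q t) := by
  have hv : v ∈ AddSubgroup.closure q.support := by rw [hq.generates]; trivial
  induction hv using AddSubgroup.closure_induction with
  | mem x hx =>
    have hx' : 0 < (q x).toReal := ENNReal.toReal_pos hx (q.apply_ne_top x)
    refine ⟨(q x).toReal⁻¹, by positivity, fun t => ?_⟩
    rw [← div_eq_inv_mul, le_div_iff₀ hx', mul_comm]
    exact mul_one_sub_cos_le t x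
  | zero => exact ⟨0, le_rfl, fun t => by simp [dot]⟩
  | add x y _ _ hx hy =>
    obtain ⟨K, hK, h⟩ := hx
    obtain ⟨L, hL, h'⟩ := hy
    refine ⟨2 * K + 2 * L, by positivity, fun t => ?_⟩
    rw [dot_add]
    linarith [one_sub_cos_add_le (dot t x) (dot t y), h t, h' t]
  | neg x _ hx =>
    obtain ⟨K, hK, h⟩ := hx
    exact ⟨K, hK, fun t => by rw [dot_neg, Real.cos_neg]; exact h t⟩

/-- A quadratic bound for the characteristic function on the whole fundamental domain. -/
lemma exists_le_one_sub_phi (hq : IsStepLaw q) :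
    ∃ c : ℝ, 0 < c ∧ ∀ t ∈ freqBox d, c * ∑ i, t i ^ 2 ≤ 1 - phi q t := by
  -- For unit vectors the left side is 1 - cos tᵢ, which is at least 2tᵢ²/π² on [-π, π].
  choose K hK h using fun i : Fin d => exists_one_sub_cos_le hq (Pi.single i 1)
  have hsum : 0 < ∑ i, K i + 1 := by
    have := Finset.sum_nonneg fun i (_ : i ∈ Finset.univ) => hK i
    linarith
  have hpi := Real.pi_pos
  refine ⟨(2 / Real.pi ^ 2) / (∑ i, K i + 1), by positivity, fun t ht => ?_⟩
  have hphi : 0 ≤ 1 - phi q t := sub_nonneg.2 (le_of_abs_le (abs_phi_le_one q t))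
  have h1 : ∀ i, 2 / Real.pi ^ 2 * t i ^ 2 ≤ K i * (1 - phi q t) := by
    intro i
    have hd : dot t (Pi.single i 1) = t i := by
      simp [dot, Pi.single_apply]
    have h2 := h i t
    rw [hd] at h2
    have h3 := Set.mem_univ_pi.1 ht i
    have h4 := Real.cos_le_one_sub_mul_cos_sq (x := t i) (abs_le.2 ⟨h3.1.le, h3.2⟩)
    linarith
  rw [div_mul_eq_mul_div, div_le_iff₀ hsum, Finset.mul_sum]
  calc ∑ i, 2 / Real.pi ^ 2 * t i ^ 2 ≤ ∑ i, K i * (1 - phi q t) := Finset.sum_le_sum fun i _ => h1 i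
    _ = (1 - phi q t) * ∑ i, K i := by rw [← Finset.sum_mul, mul_comm]
    _ ≤ (1 - phi q t) * (∑ i, K i + 1) := by nlinarith

lemma integrable_of_summable {f : (Fin d → ℤ) → ℝ} (hf : ∀ x, 0 ≤ f x)
    (h : Summable fun x => f x * (q x).toReal) : Integrable f q.toMeasure := by
  refine ⟨(measurable_of_lattice _).aestronglyMeasurable, ?_⟩
  rw [hasFiniteIntegral_iff_ofReal (Filter.Eventually.of_forall hf), lintegral_countable']
  have : ∀ x, ENNReal.ofReal (f x) * q.toMeasure {x} = ENNReal.ofReal (f x * (q x).toReal) := by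
    intro x
    rw [PMF.toMeasure_apply_singleton _ _ (measurableSet_singleton _),
      ENNReal.ofReal_mul (hf x), ENNReal.ofReal_toReal (q.apply_ne_top x)]
  rw [tsum_congr this]
  exact h.tsum_ofReal_lt_top

/-- The exponential moment is used only to obtain finite second moments. -/
lemma integrable_sq_coord (hq : IsStepLaw q) (i : Fin d) :
    Integrable (fun x => (x i : ℝ) ^ 2) q.toMeasure := by
  obtain ⟨b, hb, hs⟩ := hq.exp_moment
  have h1 := integrable_of_summable (fun x => (Real.exp_pos _).le) hs
  refine (h1.const_mul (2 / b ^ 2)).mono' (measurable_of_lattice _).aestronglyMeasurable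
    (Filter.Eventually.of_forall fun x => ?_)
  set r := ‖(WithLp.toLp 2 (fun i => (x i : ℝ)) : EuclideanSpace ℝ (Fin d))‖ with hr
  have h2 : |(x i : ℝ)| ≤ r := by
    have := PiLp.norm_apply_le (WithLp.toLp 2 (fun i => (x i : ℝ)) : EuclideanSpace ℝ (Fin d)) i
    simpa using this
  have h3 : (x i : ℝ) ^ 2 ≤ r ^ 2 := sq_le_sq.2 (h2.trans (le_abs_self r))
  have h4 := Real.quadratic_le_exp_of_nonneg (x := b * r) (by positivity)
  rw [Real.norm_of_nonneg (sq_nonneg _)]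
  calc (x i : ℝ) ^ 2 ≤ r ^ 2 := h3
    _ = 2 / b ^ 2 * ((b * r) ^ 2 / 2) := by field_simp
    _ ≤ 2 / b ^ 2 * Real.exp (b * r) := by
      gcongr
      have : 0 ≤ b * r := by positivity
      linarith

lemma integrable_mul_coord (hq : IsStepLaw q) (i j : Fin d) :
    Integrable (fun x => (x i : ℝ) * (x j : ℝ)) q.toMeasure := by
  refine ((integrable_sq_coord hq i).add (integrable_sq_coord hq j)).mono'
    (measurable_of_lattice _).aestronglyMeasurable (Filter.Eventually.of_forall fun x => ?_)
  rw [Real.norm_eq_abs, abs_le]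
  simp only [Pi.add_apply]
  constructor <;> nlinarith [sq_nonneg ((x i : ℝ) - x j), sq_nonneg ((x i : ℝ) + x j)]

lemma covMatrix_apply (hq : IsStepLaw q) (i j : Fin d) :
    covMatrix q i j = ∫ x, (x i : ℝ) * (x j : ℝ) ∂q.toMeasure := by
  rw [PMF.integral_eq_tsum _ _ (integrable_mul_coord hq i j)]
  simp [covMatrix, mul_comm]

lemma dot_sq (s : Fin d → ℝ) (x : Fin d → ℤ) :
    dot s x ^ 2 = ∑ i, ∑ j, s i * s j * ((x i : ℝ) * (x j : ℝ)) := by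
  rw [dot, sq, Finset.sum_mul_sum]
  exact Finset.sum_congr rfl fun i _ => Finset.sum_congr rfl fun j _ => by ring

lemma integrable_dot_sq (hq : IsStepLaw q) (s : Fin d → ℝ) :
    Integrable (fun x => dot s x ^ 2) q.toMeasure := by
  simp only [dot_sq]
  exact integrable_finsetSum _ fun i _ => integrable_finsetSum _ fun j _ =>
    (integrable_mul_coord hq i j).const_mul _

/-- The quadratic form of the covariance matrix. -/
def covForm (q : PMF (Fin d → ℤ)) (s : Fin d → ℝ) : ℝ := ∫ x, dot s x ^ 2 ∂q.toMeasure

lemma covForm_smul (a : ℝ) (s : Fin d → ℝ) : covForm q (a • s) = a ^ 2 * covForm q s := by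
  simp only [covForm, dot_smul, mul_pow, integral_const_mul]

lemma covForm_eq (hq : IsStepLaw q) (s : Fin d → ℝ) :
    s ⬝ᵥ (covMatrix q).mulVec s = covForm q s := by
  unfold covForm
  simp only [dot_sq]
  rw [integral_finsetSum _ fun i _ => integrable_finsetSum _ fun j _ =>
    (integrable_mul_coord hq i j).const_mul _]
  simp only [dotProduct, Matrix.mulVec, Finset.mul_sum]
  refine Finset.sum_congr rfl fun i _ => ?_
  rw [integral_finsetSum _ fun j _ => (integrable_mul_coord hq i j).const_mul _]
  refine Finset.sum_congr rfl fun j _ => ?_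
  rw [covMatrix_apply hq, integral_const_mul]
  ring

lemma one_sub_phi_le (hq : IsStepLaw q) (t : Fin d → ℝ) : 1 - phi q t ≤ covForm q t / 2 := by
  have h1 : 1 - phi q t = ∫ x, (1 - Real.cos (dot t x)) ∂q.toMeasure := by
    rw [integral_sub (integrable_const _) (integrable_cos q t)]
    simp [phi]
  rw [h1, covForm, ← integral_div]
  refine integral_mono ((integrable_const _).sub (integrable_cos q t))
    ((integrable_dot_sq hq t).div_const 2) fun x => ?_
  have := Real.one_sub_sq_div_two_le_cos (x := dot t x)
  simp only
  linarith

/-- `n (1 - φ(s/√n))` converges to half the quadratic form of the covariance matrix. -/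
lemma tendsto_mul_one_sub_phi (hq : IsStepLaw q) (s : Fin d → ℝ) :
    Filter.Tendsto (fun n : ℕ => (n : ℝ) * (1 - phi q ((Real.sqrt n)⁻¹ • s))) Filter.atTop
      (nhds (covForm q s / 2)) := by
  have h1 : ∀ n : ℕ, (n : ℝ) * (1 - phi q ((Real.sqrt n)⁻¹ • s))
      = ∫ x, (n : ℝ) * (1 - Real.cos (dot ((Real.sqrt n)⁻¹ • s) x)) ∂q.toMeasure := by
    intro n
    rw [integral_const_mul, integral_sub (integrable_const _) (integrable_cos q _)]
    simp [phi]
  simp only [h1]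
  rw [covForm, ← integral_div]
  -- With u = s·x, the quantity n(1 - cos(u/√n)) lies between u²/2 - O(1/n) and u²/2, so that u²/2
  -- is both the dominating function and the limit.
  refine tendsto_integral_of_dominated_convergence (fun x => dot s x ^ 2 / 2)
    (fun n => (measurable_of_lattice _).aestronglyMeasurable)
    ((integrable_dot_sq hq s).div_const 2)
    (fun n => Filter.Eventually.of_forall fun x => ?_) (Filter.Eventually.of_forall fun x => ?_)
  · rw [Real.norm_of_nonneg (mul_nonneg n.cast_nonneg (sub_nonneg.2 (Real.cos_le_one _)))]
    rcases Nat.eq_zero_or_pos n with rfl | hn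
    · simp; positivity
    have := Real.one_sub_sq_div_two_le_cos (x := dot ((Real.sqrt n)⁻¹ • s) x)
    have hn' : (0 : ℝ) < n := by exact_mod_cast hn
    calc (n : ℝ) * (1 - Real.cos (dot ((Real.sqrt n)⁻¹ • s) x))
        ≤ n * (dot ((Real.sqrt n)⁻¹ • s) x ^ 2 / 2) := by gcongr; linarith
      _ = dot s x ^ 2 / 2 := by
        rw [dot_smul, mul_pow, inv_pow, Real.sq_sqrt n.cast_nonneg]
        field_simp
  · set u := dot s x
    have hcos : ∀ v : ℝ, 1 - v ^ 2 / 2 ≤ Real.cos v := fun v => Real.one_sub_sq_div_two_le_cos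
    have hup : ∀ v : ℝ, |v| ≤ 1 → 1 - Real.cos v ≥ v ^ 2 / 2 - |v| ^ 4 * (5 / 96) := by
      intro v hv
      have := (abs_le.1 (Real.cos_bound hv)).2
      linarith
    refine tendsto_of_tendsto_of_tendsto_of_le_of_le'
      (g := fun n : ℕ => u ^ 2 / 2 - u ^ 4 * (5 / 96) * ((n : ℝ))⁻¹) (h := fun _ => u ^ 2 / 2) ?_
      tendsto_const_nhds ?_ ?_
    · have : Filter.Tendsto (fun n : ℕ => u ^ 2 / 2 - u ^ 4 * (5 / 96) * ((n : ℝ))⁻¹) Filter.atTop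
          (nhds (u ^ 2 / 2 - u ^ 4 * (5 / 96) * 0)) :=
        tendsto_const_nhds.sub (tendsto_const_nhds.mul tendsto_inv_atTop_nhds_zero_nat)
      simpa using this
    · filter_upwards [Filter.eventually_ge_atTop (⌈u ^ 2⌉₊ + 1)] with n hn
      have hn1 : u ^ 2 ≤ n := (Nat.le_ceil _).trans (by exact_mod_cast (Nat.le_succ _).trans hn)
      have hn0 : (0 : ℝ) < n := by exact_mod_cast lt_of_lt_of_le (Nat.succ_pos _) hn
      rw [dot_smul]
      have hsq : ((Real.sqrt n)⁻¹ * u) ^ 2 = u ^ 2 / n := by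
        rw [mul_pow, inv_pow, Real.sq_sqrt hn0.le]; field_simp
      have habs : |(Real.sqrt n)⁻¹ * u| ≤ 1 := by
        rw [← sq_le_one_iff_abs_le_one, hsq, div_le_one hn0]; exact hn1
      have h4 : |(Real.sqrt n)⁻¹ * u| ^ 4 = u ^ 4 / n ^ 2 := by
        rw [show (4 : ℕ) = 2 * 2 from rfl, pow_mul, sq_abs, hsq, div_pow, ← pow_mul]
      have := hup _ habs
      rw [hsq, h4] at this
      calc u ^ 2 / 2 - u ^ 4 * (5 / 96) * (n : ℝ)⁻¹
          = n * (u ^ 2 / n / 2 - u ^ 4 / n ^ 2 * (5 / 96)) := by field_simp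
        _ ≤ _ := by gcongr
    · filter_upwards [Filter.eventually_gt_atTop 0] with n hn
      have hn0 : (0 : ℝ) < n := by exact_mod_cast hn
      rw [dot_smul]
      have hsq : ((Real.sqrt n)⁻¹ * u) ^ 2 = u ^ 2 / n := by
        rw [mul_pow, inv_pow, Real.sq_sqrt hn0.le]; field_simp
      have := hcos ((Real.sqrt n)⁻¹ * u)
      rw [hsq] at this
      calc (n : ℝ) * (1 - Real.cos ((Real.sqrt n)⁻¹ * u)) ≤ n * (u ^ 2 / n / 2) := by
            gcongr; linarith
        _ = u ^ 2 / 2 := by field_simp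

lemma tendsto_phi_pow (hq : IsStepLaw q) (s : Fin d → ℝ) :
    Filter.Tendsto (fun n : ℕ => phi q ((Real.sqrt n)⁻¹ • s) ^ n) Filter.atTop
      (nhds (Real.exp (-(covForm q s / 2)))) := by
  have h := Real.tendsto_one_add_pow_exp_of_tendsto
    (g := fun n : ℕ => phi q ((Real.sqrt n)⁻¹ • s) - 1) (t := -(covForm q s / 2)) (by
      have := (tendsto_mul_one_sub_phi hq s).neg
      refine this.congr fun n => by ring)
  simpa using h

lemma tendsto_phi_one (s : Fin d → ℝ) :
    Filter.Tendsto (fun n : ℕ => phi q ((Real.sqrt n)⁻¹ • s)) Filter.atTop (nhds 1) := by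
  have h0 : phi q 0 = 1 := by simp [phi, dot]
  have h1 : Filter.Tendsto (fun n : ℕ => (Real.sqrt n)⁻¹ • s) Filter.atTop (nhds ((0 : ℝ) • s)) :=
    (tendsto_inv_atTop_zero.comp (Real.tendsto_sqrt_atTop.comp
      tendsto_natCast_atTop_atTop)).smul_const s
  rw [zero_smul] at h1
  rw [← h0]
  exact ((continuous_phi q).tendsto 0).comp h1

/-- Since 1 - φ ≤ covForm/2, the bound on the frequency box passes to the quadratic form there, and
by homogeneity everywhere. One constant serves both purposes, so that a single Gaussian dominates
the rescaled integrands and their limit. -/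
lemma exists_le_covForm (hq : IsStepLaw q) :
    ∃ c : ℝ, 0 < c ∧ (∀ t ∈ freqBox d, c * ∑ i, t i ^ 2 ≤ 1 - phi q t) ∧
      ∀ s, c * ∑ i, s i ^ 2 ≤ covForm q s / 2 := by
  obtain ⟨c, hc, h⟩ := exists_le_one_sub_phi hq
  refine ⟨c, hc, h, fun s => ?_⟩
  have hpi := Real.pi_pos
  set r := ∑ i, |s i| with hr
  have hr0 : 0 ≤ r := Finset.sum_nonneg fun i _ => abs_nonneg _
  have hmem : (r + 1)⁻¹ • s ∈ freqBox d := by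
    refine Set.mem_univ_pi.2 fun i => ?_
    have h1 : |s i| ≤ r := Finset.single_le_sum (f := fun i => |s i|) (fun i _ => abs_nonneg _)
      (Finset.mem_univ i)
    have h2 : |((r + 1)⁻¹ • s) i| < 1 := by
      rw [Pi.smul_apply, smul_eq_mul, abs_mul, abs_of_pos (by positivity), ← div_eq_inv_mul,
        div_lt_one (by positivity)]
      linarith
    have h3 := abs_lt.1 h2
    constructor <;> linarith [Real.pi_gt_three, h3.1, h3.2]
  have h1 := (h _ hmem).trans (one_sub_phi_le hq _)
  rw [covForm_smul] at h1
  simp only [Pi.smul_apply, smul_eq_mul, mul_pow, ← Finset.mul_sum] at h1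
  have h2 : 0 < (r + 1)⁻¹ ^ 2 := by positivity
  nlinarith

lemma covMatrix_posDef (hq : IsStepLaw q) : (covMatrix q).PosDef := by
  rw [Matrix.posDef_iff_dotProduct_mulVec]
  refine ⟨?_, fun s hs => ?_⟩
  · ext i j
    simp only [Matrix.conjTranspose_apply, star_trivial, covMatrix_apply hq, mul_comm]
  · obtain ⟨c, hc, -, h⟩ := exists_le_covForm hq
    rw [star_trivial, covForm_eq hq]
    obtain ⟨i, hi⟩ : ∃ i, s i ≠ 0 := by
      by_contra! h'
      exact hs (funext h')
    have : 0 < ∑ i, s i ^ 2 :=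
      Finset.sum_pos' (fun i _ => sq_nonneg _) ⟨i, Finset.mem_univ i, by positivity⟩
    nlinarith [h s, mul_pos hc this]

end PhiBounds

/-! ### A Gaussian integral -/

section Gaussian

variable {d : ℕ}

open scoped MatrixOrder in
lemma exists_factor {Q : Matrix (Fin d) (Fin d) ℝ} (hQ : Q.PosDef) :
    ∃ B : Matrix (Fin d) (Fin d) ℝ, Q = B.transpose * B ∧ B.det ≠ 0 ∧ |B.det| = Real.sqrt Q.det := by
  have h0 : (0 : Matrix (Fin d) (Fin d) ℝ) ≤ Q := Matrix.nonneg_iff_posSemidef.2 hQ.posSemidef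
  have h1 : CFC.sqrt Q * CFC.sqrt Q = Q := CFC.sqrt_mul_sqrt_self Q h0
  have h2 : (CFC.sqrt Q).transpose = CFC.sqrt Q := by
    have h3 : (CFC.sqrt Q).IsHermitian :=
      (Matrix.nonneg_iff_posSemidef.1 (CFC.sqrt_nonneg Q)).isHermitian
    have h4 := h3.eq
    rwa [Matrix.conjTranspose_eq_transpose_of_trivial] at h4
  have hdet : (CFC.sqrt Q).det ^ 2 = Q.det := by
    rw [sq, ← Matrix.det_mul, h1]
  refine ⟨CFC.sqrt Q, by rw [h2, h1], fun h => ?_, ?_⟩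
  · rw [h] at hdet
    exact hQ.det_pos.ne' (by simpa using hdet.symm)
  · rw [← hdet, Real.sqrt_sq_eq_abs]

lemma integral_comp_mulVec {B : Matrix (Fin d) (Fin d) ℝ} (hB : B.det ≠ 0) (f : (Fin d → ℝ) → ℝ)
    (hf : Continuous f) :
    ∫ s, f (B.mulVec s) = |B.det|⁻¹ * ∫ s, f s := by
  have h := integral_map (μ := (volume : Measure (Fin d → ℝ))) (φ := Matrix.toLin' B)
    (f := f) (LinearMap.continuous_of_finiteDimensional _).measurable.aemeasurable
    hf.aestronglyMeasurable
  rw [Real.map_matrix_volume_pi_eq_smul_volume_pi hB, integral_smul_measure,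
    ENNReal.toReal_ofReal (abs_nonneg _), abs_inv, smul_eq_mul] at h
  simpa [Matrix.toLin'_apply] using h.symm

lemma integral_gaussian_cos (w : Fin d → ℝ) :
    ∫ s : Fin d → ℝ, Real.exp (-(∑ i, s i ^ 2) / 2) * Real.cos (s ⬝ᵥ w)
      = Real.sqrt (2 * Real.pi) ^ d * Real.exp (-(w ⬝ᵥ w) / 2) := by
  set f : Fin d → ℝ → ℂ := fun i x =>
    Complex.exp (Complex.I * (w i : ℂ) * x) * Complex.exp (-(1 / 2 : ℂ) * (x : ℂ) ^ 2) with hf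
  have h1 : ∀ i, ∫ x : ℝ, f i x
      = ((Real.sqrt (2 * Real.pi) * Real.exp (-(w i) ^ 2 / 2) : ℝ) : ℂ) := by
    intro i
    rw [hf]
    simp only
    rw [fourierIntegral_gaussian (by norm_num)]
    push_cast
    congr 1
    · rw [Real.sqrt_eq_rpow, Complex.ofReal_cpow (by positivity)]
      congr 1 <;> push_cast <;> ring
    · congr 1; ring
  have hfi : ∀ i, Integrable (f i) volume := by
    intro i
    refine (integrable_exp_neg_mul_sq (b := 1 / 2) (by norm_num)).mono'
      (Continuous.aestronglyMeasurable (by fun_prop)) (Filter.Eventually.of_forall fun x => ?_)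
    rw [hf, norm_mul, Complex.norm_exp, Complex.norm_exp]
    simp only [Complex.mul_re, Complex.I_re, Complex.I_im, Complex.ofReal_re, Complex.ofReal_im,
      Complex.neg_re, Complex.mul_im]
    norm_num [← Complex.ofReal_pow]
  have h2 : ∫ s : Fin d → ℝ, ∏ i, f i (s i)
      = ((Real.sqrt (2 * Real.pi) ^ d * Real.exp (-(w ⬝ᵥ w) / 2) : ℝ) : ℂ) := by
    rw [volume_pi, integral_fintype_prod_eq_prod, Finset.prod_congr rfl fun i _ => h1 i,
      ← Complex.ofReal_prod, Finset.prod_mul_distrib, ← Real.exp_sum]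
    simp only [Finset.prod_const, Finset.card_univ, Fintype.card_fin]
    congr 4
    rw [dotProduct, ← Finset.sum_div, Finset.sum_neg_distrib]
    congr 2
    exact Finset.sum_congr rfl fun i _ => by ring
  have hi : Integrable (fun s : Fin d → ℝ => ∏ i, f i (s i)) volume := by
    rw [volume_pi]
    exact Integrable.fintype_prod hfi
  have h3 := congrArg Complex.re h2
  rw [← RCLike.re_eq_complex_re, ← integral_re hi, RCLike.re_eq_complex_re,
    Complex.ofReal_re] at h3
  rw [← h3]
  refine integral_congr_ae (Filter.Eventually.of_forall fun s => ?_)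
  simp only [hf]
  rw [Finset.prod_mul_distrib, ← Complex.exp_sum, ← Complex.exp_sum]
  have e1 : ∑ i, Complex.I * (w i : ℂ) * (s i : ℂ) = ((s ⬝ᵥ w : ℝ) : ℂ) * Complex.I := by
    simp only [dotProduct, Complex.ofReal_sum, Finset.sum_mul, Complex.ofReal_mul]
    exact Finset.sum_congr rfl fun i _ => by ring
  have e2 : ∑ i, -(1 / 2 : ℂ) * (s i : ℂ) ^ 2 = ((-(∑ i, s i ^ 2) / 2 : ℝ) : ℂ) := by
    push_cast
    rw [← Finset.mul_sum]; ring
  rw [e1, e2, ← Complex.ofReal_exp, Complex.re_mul_ofReal, Complex.exp_ofReal_mul_I_re, mul_comm]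

/-- With Q = BᵀB, the substitution s ↦ Bs reduces to the standard Gaussian; the frequency v becomes
B⁻ᵀv, and the Jacobian is √det Q. -/
lemma integral_gaussian_quadratic_cos {Q : Matrix (Fin d) (Fin d) ℝ} (hQ : Q.PosDef)
    (v : Fin d → ℝ) :
    ∫ s : Fin d → ℝ, Real.exp (-((s ⬝ᵥ Q.mulVec s) / 2)) * Real.cos (s ⬝ᵥ v)
      = Real.sqrt (2 * Real.pi) ^ d / Real.sqrt Q.det * Real.exp (-(v ⬝ᵥ Q⁻¹.mulVec v) / 2) := by
  obtain ⟨B, rfl, hB, hdet⟩ := exists_factor hQ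
  have hu : IsUnit B.det := isUnit_iff_ne_zero.2 hB
  set w := B⁻¹.transpose.mulVec v with hw
  have h1 : ∀ s, s ⬝ᵥ (B.transpose * B).mulVec s = ∑ i, (B.mulVec s) i ^ 2 := by
    intro s
    rw [← Matrix.mulVec_mulVec, Matrix.dotProduct_mulVec, Matrix.vecMul_transpose, dotProduct]
    exact Finset.sum_congr rfl fun i _ => by ring
  have h2 : ∀ s, s ⬝ᵥ v = B.mulVec s ⬝ᵥ w := by
    intro s
    rw [hw, Matrix.dotProduct_mulVec, Matrix.vecMul_transpose, Matrix.mulVec_mulVec,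
      Matrix.nonsing_inv_mul B hu, Matrix.one_mulVec]
  have h3 : w ⬝ᵥ w = v ⬝ᵥ (B.transpose * B)⁻¹.mulVec v := by
    rw [hw, Matrix.mul_inv_rev, Matrix.dotProduct_mulVec, Matrix.vecMul_transpose,
      Matrix.mulVec_mulVec, dotProduct_comm, Matrix.transpose_nonsing_inv]
  simp only [h1, h2]
  have h4 := integral_comp_mulVec hB
    (fun s => Real.exp (-((∑ i, s i ^ 2) / 2)) * Real.cos (s ⬝ᵥ w)) (by
      simp only [dotProduct]; fun_prop)
  rw [h4, ← h3, ← hdet]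
  have h5 := integral_gaussian_cos w
  simp only [neg_div] at h5 ⊢
  rw [h5]
  ring

end Gaussian

/-! ### Local central limit theorem -/

section LCLT

variable {d : ℕ} (q : PMF (Fin d → ℤ))

/-- The average of `pⁿ⁺ʲ(o, y)` over a binomial number `j` of additional steps. -/
def lazyAvg (k n : ℕ) (y : Fin d → ℤ) : ℝ :=
  ∑ j ∈ Finset.range (k + 1), (k.choose j : ℝ) / 2 ^ k * (nStep q (n + j) y).toReal

/-- The reason for the averaging: by the binomial theorem it appears on the Fourier side as the
factor ((1+φ)/2)^k, which vanishes to order k where φ = -1. No aperiodicity is then needed. -/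
lemma integral_lazyAvg (hq : ∀ x, q (-x) = q x) (k n : ℕ) (y : Fin d → ℤ) :
    ∫ t in freqBox d, phi q t ^ n * ((1 + phi q t) / 2) ^ k * Real.cos (dot t y)
      = (2 * Real.pi) ^ d * lazyAvg q k n y := by
  have h1 : ∀ t, phi q t ^ n * ((1 + phi q t) / 2) ^ k * Real.cos (dot t y)
      = ∑ j ∈ Finset.range (k + 1),
        (k.choose j : ℝ) / 2 ^ k * (phi q t ^ (n + j) * Real.cos (dot t y)) := by
    intro t
    rw [div_pow, add_comm 1, add_pow]
    simp only [one_pow, mul_one]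
    rw [Finset.sum_div, Finset.mul_sum, Finset.sum_mul]
    refine Finset.sum_congr rfl fun j _ => ?_
    rw [pow_add]; ring
  simp only [h1]
  rw [integral_finsetSum]
  · rw [lazyAvg, Finset.mul_sum]
    refine Finset.sum_congr rfl fun j _ => ?_
    rw [integral_const_mul, integral_phi_pow_mul_cos q hq]
    ring
  · intro j _
    refine Integrable.const_mul (Integrable.of_bound (C := 1)
      (Continuous.aestronglyMeasurable (by fun_prop)) (Filter.Eventually.of_forall fun t => ?_)) _
    rw [norm_mul, norm_pow]
    exact mul_le_one₀ (pow_le_one₀ (norm_nonneg _) (abs_phi_le_one q t)) (norm_nonneg _)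
      (Real.abs_cos_le_one _)

/-- With X = n(1-u) this is X^k e^(-X) ≤ k!. It is applied to u = -φ at negative values of φ, and to
u = φ² with k = 1 for differences in time. -/
lemma pow_mul_one_sub_pow_le {u : ℝ} (h0 : 0 ≤ u) (h1 : u ≤ 1) {n : ℕ} (hn : 0 < n) (k : ℕ) :
    u ^ n * (1 - u) ^ k ≤ (k.factorial : ℝ) / n ^ k := by
  have hx : 0 ≤ n * (1 - u) := mul_nonneg n.cast_nonneg (by linarith)
  have h2 := Real.pow_div_factorial_le_exp _ hx k
  have h3 : u ≤ Real.exp (-(1 - u)) := by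
    have := Real.add_one_le_exp (-(1 - u)); linarith
  have h4 : u ^ n ≤ Real.exp (-(n * (1 - u))) := by
    calc u ^ n ≤ Real.exp (-(1 - u)) ^ n := by gcongr
      _ = _ := by rw [← Real.exp_nat_mul]; congr 1; ring
  have hf : (0 : ℝ) < k.factorial := by exact_mod_cast k.factorial_pos
  have hn' : (0 : ℝ) < n := by exact_mod_cast hn
  rw [le_div_iff₀ (by positivity)]
  rw [div_le_iff₀ hf, mul_pow] at h2
  calc u ^ n * (1 - u) ^ k * n ^ k = u ^ n * ((n : ℝ) ^ k * (1 - u) ^ k) := by ring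
    _ ≤ Real.exp (-(n * (1 - u))) * (Real.exp (n * (1 - u)) * k.factorial) := by
      refine mul_le_mul h4 h2 ?_ (Real.exp_pos _).le
      have : 0 ≤ 1 - u := by linarith
      positivity
    _ = k.factorial := by
      rw [← mul_assoc, ← Real.exp_add]; simp

/-- The integrand obtained from the positive part of the characteristic function by rescaling. -/
def scaledIntegrand (k n : ℕ) (s : Fin d → ℝ) : ℝ :=
  (freqBox d).indicator (fun t => max (phi q t) 0 ^ n * ((1 + phi q t) / 2) ^ k)
    ((Real.sqrt n)⁻¹ • s)

lemma measurable_scaledIntegrand (k n : ℕ) : Measurable (scaledIntegrand q k n) := by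
  have h : Measurable ((freqBox d).indicator
      (fun t => max (phi q t) 0 ^ n * ((1 + phi q t) / 2) ^ k)) :=
    (Continuous.measurable (by fun_prop)).indicator measurableSet_freqBox
  exact h.comp (measurable_const_smul _)

variable {q}

lemma scaledIntegrand_nonneg (k n : ℕ) (s : Fin d → ℝ) : 0 ≤ scaledIntegrand q k n s := by
  refine Set.indicator_nonneg (fun t _ => mul_nonneg (pow_nonneg (le_max_right _ _) _)
    (pow_nonneg ?_ _)) _
  have := (abs_le.1 (abs_phi_le_one q t)).1
  linarith

/-- φ ≤ 1 - c|t|² ≤ exp(-c|t|²), and the nth power cancels the rescaling, which gives a majorant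
independent of n. -/
lemma scaledIntegrand_le {c : ℝ} (h : ∀ t ∈ freqBox d, c * ∑ i, t i ^ 2 ≤ 1 - phi q t) (k : ℕ)
    {n : ℕ} (hn : 0 < n) (s : Fin d → ℝ) :
    scaledIntegrand q k n s ≤ Real.exp (-(c * ∑ i, s i ^ 2)) := by
  unfold scaledIntegrand
  by_cases hs : (Real.sqrt n)⁻¹ • s ∈ freqBox d
  · rw [Set.indicator_of_mem hs]
    have h1 := h _ hs
    have hn' : (0 : ℝ) < n := by exact_mod_cast hn
    set t := (Real.sqrt n)⁻¹ • s with ht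
    have hsum : ∑ i, s i ^ 2 = n * ∑ i, t i ^ 2 := by
      rw [ht, Finset.mul_sum]
      refine Finset.sum_congr rfl fun i _ => ?_
      rw [Pi.smul_apply, smul_eq_mul, mul_pow, inv_pow, Real.sq_sqrt hn'.le]
      field_simp
    have h2 := abs_le.1 (abs_phi_le_one q t)
    have h3 : max (phi q t) 0 ≤ Real.exp (-(c * ∑ i, t i ^ 2)) := by
      refine max_le ?_ (Real.exp_pos _).le
      have := Real.add_one_le_exp (-(c * ∑ i, t i ^ 2))
      linarith
    calc max (phi q t) 0 ^ n * ((1 + phi q t) / 2) ^ k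
        ≤ Real.exp (-(c * ∑ i, t i ^ 2)) ^ n * 1 := by
          refine mul_le_mul (pow_le_pow_left₀ (le_max_right _ _) h3 n)
            (pow_le_one₀ ?_ ?_) (pow_nonneg ?_ _) (by positivity) <;> linarith
      _ = Real.exp (-(c * ∑ i, s i ^ 2)) := by
          rw [mul_one, ← Real.exp_nat_mul, hsum]; congr 1; ring
  · rw [Set.indicator_of_notMem hs]
    exact (Real.exp_pos _).le

lemma tendsto_scaledIntegrand (hq : IsStepLaw q) (k : ℕ) (s : Fin d → ℝ) :
    Filter.Tendsto (fun n => scaledIntegrand q k n s) Filter.atTop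
      (nhds (Real.exp (-(covForm q s / 2)))) := by
  have hlim : Filter.Tendsto (fun n : ℕ => (Real.sqrt n)⁻¹ • s) Filter.atTop
      (nhds ((0 : ℝ) • s)) :=
    (tendsto_inv_atTop_zero.comp (Real.tendsto_sqrt_atTop.comp
      tendsto_natCast_atTop_atTop)).smul_const s
  rw [zero_smul] at hlim
  have hnear : ∀ᶠ n : ℕ in Filter.atTop, (Real.sqrt n)⁻¹ • s ∈ freqBox d := by
    refine hlim (set_pi_mem_nhds Set.finite_univ fun i _ => ?_)
    exact Ioc_mem_nhds (by simp [Real.pi_pos]) (by simp [Real.pi_pos])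
  have hpos : ∀ᶠ n : ℕ in Filter.atTop, 0 < phi q ((Real.sqrt n)⁻¹ • s) :=
    (tendsto_phi_one s).eventually (lt_mem_nhds one_pos)
  have h1 := (tendsto_phi_pow hq s).mul ((((tendsto_phi_one (q := q) s).const_add 1).div_const
    2).pow k)
  have : ((1 + 1 : ℝ) / 2) ^ k = 1 := by norm_num
  rw [this, mul_one] at h1
  refine h1.congr' ?_
  filter_upwards [hnear, hpos] with n hn hn'
  rw [scaledIntegrand, Set.indicator_of_mem hn, max_eq_left hn'.le]

lemma integrable_exp_neg_sum_sq {c : ℝ} (hc : 0 < c) :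
    Integrable fun s : Fin d → ℝ => Real.exp (-(c * ∑ i, s i ^ 2)) := by
  have h := Integrable.fintype_prod (ι := Fin d) (μ := fun _ => (volume : Measure ℝ))
    (f := fun _ x => Real.exp (-c * x ^ 2)) fun _ => integrable_exp_neg_mul_sq hc
  rw [← volume_pi] at h
  refine h.congr (Filter.Eventually.of_forall fun s => ?_)
  simp only
  rw [← Real.exp_sum, ← Finset.mul_sum]
  congr 1; ring

lemma continuous_covForm (hq : IsStepLaw q) : Continuous (covForm q) := by
  have : covForm q = fun s => s ⬝ᵥ (covMatrix q).mulVec s := funext fun s => (covForm_eq hq s).symm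
  rw [this]
  simp only [dotProduct, Matrix.mulVec]
  fun_prop

lemma integrable_exp_covForm (hq : IsStepLaw q) :
    Integrable fun s => Real.exp (-(covForm q s / 2)) := by
  obtain ⟨c, hc, -, h⟩ := exists_le_covForm hq
  refine (integrable_exp_neg_sum_sq hc).mono'
    (Continuous.aestronglyMeasurable (by have := continuous_covForm hq; fun_prop))
    (Filter.Eventually.of_forall fun s => ?_)
  rw [Real.norm_of_nonneg (Real.exp_pos _).le, Real.exp_le_exp]
  exact neg_le_neg (h s)

lemma integrable_scaledIntegrand (hq : IsStepLaw q) (k : ℕ) {n : ℕ} (hn : 0 < n) :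
    Integrable (scaledIntegrand q k n) := by
  obtain ⟨c, hc, h, -⟩ := exists_le_covForm hq
  refine (integrable_exp_neg_sum_sq hc).mono' (measurable_scaledIntegrand q k n).aestronglyMeasurable
    (Filter.Eventually.of_forall fun s => ?_)
  rw [Real.norm_of_nonneg (scaledIntegrand_nonneg k n s)]
  exact scaledIntegrand_le h k hn s

/-- Convergence in L¹, rather than of the integrals alone, makes the limit theorem uniform in the
end point, which enters only through a cosine bounded by 1. -/
lemma tendsto_integral_abs_scaledIntegrand_sub (hq : IsStepLaw q) (k : ℕ) :
    Filter.Tendsto (fun n => ∫ s, |scaledIntegrand q k n s - Real.exp (-(covForm q s / 2))|)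
      Filter.atTop (nhds 0) := by
  obtain ⟨c, hc, h, h'⟩ := exists_le_covForm hq
  -- The time is shifted by one because the Gaussian majorant requires n > 0.
  rw [← Filter.tendsto_add_atTop_iff_nat 1]
  have hG : Measurable fun s => Real.exp (-(covForm q s / 2)) := by
    have := continuous_covForm hq
    exact Continuous.measurable (by fun_prop)
  have := tendsto_integral_of_dominated_convergence (μ := (volume : Measure (Fin d → ℝ)))
    (F := fun n s => |scaledIntegrand q k (n + 1) s - Real.exp (-(covForm q s / 2))|)
    (f := fun _ => 0) (fun s => Real.exp (-(c * ∑ i, s i ^ 2)))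
    (fun n => ((measurable_scaledIntegrand q k (n + 1)).sub hG).abs.aestronglyMeasurable)
    (integrable_exp_neg_sum_sq hc) (fun n => Filter.Eventually.of_forall fun s => ?_)
    (Filter.Eventually.of_forall fun s => ?_)
  · simpa using this
  · have h1 := scaledIntegrand_le h k n.succ_pos s
    have h2 := scaledIntegrand_nonneg (q := q) k (n + 1) s
    have h3 : Real.exp (-(covForm q s / 2)) ≤ Real.exp (-(c * ∑ i, s i ^ 2)) :=
      Real.exp_le_exp.2 (neg_le_neg (h' s))
    have h4 := (Real.exp_pos (-(covForm q s / 2))).le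
    rw [Real.norm_eq_abs, abs_abs, abs_le]
    constructor <;> linarith
  · have h1 := (tendsto_scaledIntegrand hq k s).comp (Filter.tendsto_add_atTop_nat 1)
    have h2 := (h1.sub_const (Real.exp (-(covForm q s / 2)))).abs
    simpa using h2

/-- A uniform local limit theorem, up to a binomial number of additional steps. -/
lemma exists_lazyAvg_error (hq : IsStepLaw q) :
    ∃ ε : ℕ → ℝ, Filter.Tendsto ε Filter.atTop (nhds 0) ∧ ∀ n : ℕ, 0 < n → ∀ y : Fin d → ℤ,
      |Real.sqrt n ^ d * (2 * Real.pi) ^ d * lazyAvg q (d + 1) n y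
        - ∫ s, Real.exp (-(covForm q s / 2)) * Real.cos (dot ((Real.sqrt n)⁻¹ • s) y)| ≤ ε n := by
  -- The negative values of φ contribute O(n⁻ᵏ), which has to beat the factor n^(d/2) of the local
  -- limit theorem; k = d + 1 is ample.
  set k := d + 1 with hk
  set M : ℝ := (2 * Real.pi) ^ d * k.factorial with hM
  have hpi := Real.pi_pos
  refine ⟨fun n => (∫ s, |scaledIntegrand q k n s - Real.exp (-(covForm q s / 2))|)
    + Real.sqrt n ^ d * (M / n ^ k), ?_, fun n hn y => ?_⟩
  · have h0 : Filter.Tendsto (fun n : ℕ => Real.sqrt n ^ d * (M / n ^ k)) Filter.atTop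
        (nhds 0) := by
      have hlim : Filter.Tendsto (fun n : ℕ => M * (n : ℝ)⁻¹) Filter.atTop (nhds (M * 0)) :=
        tendsto_const_nhds.mul tendsto_inv_atTop_nhds_zero_nat
      rw [mul_zero] at hlim
      refine squeeze_zero' (Filter.Eventually.of_forall fun n => by positivity) ?_ hlim
      filter_upwards [Filter.eventually_ge_atTop 1] with n hn
      have hn' : (1 : ℝ) ≤ n := by exact_mod_cast hn
      have hs : Real.sqrt n ≤ n := by
        rw [Real.sqrt_le_left (by linarith)]; nlinarith
      calc Real.sqrt n ^ d * (M / n ^ k) ≤ (n : ℝ) ^ d * (M / n ^ k) := by gcongr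
        _ = M * (n : ℝ)⁻¹ := by
          rw [hk, pow_succ]; field_simp
    simpa using (tendsto_integral_abs_scaledIntegrand_sub hq k).add h0
  · have hn' : (0 : ℝ) < n := by exact_mod_cast hn
    have hsn : 0 < Real.sqrt n := Real.sqrt_pos.2 hn'
    have h2 : Real.sqrt n ^ d
        * ∫ t in freqBox d, max (phi q t) 0 ^ n * ((1 + phi q t) / 2) ^ k * Real.cos (dot t y)
        = ∫ s, scaledIntegrand q k n s * Real.cos (dot ((Real.sqrt n)⁻¹ • s) y) := by
      have h3 := Measure.integral_comp_smul (volume : Measure (Fin d → ℝ))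
        (fun t => (freqBox d).indicator
          (fun t => max (phi q t) 0 ^ n * ((1 + phi q t) / 2) ^ k) t * Real.cos (dot t y))
        (Real.sqrt n)⁻¹
      simp only [Module.finrank_fin_fun, inv_pow, inv_inv, abs_of_pos (pow_pos hsn d),
        smul_eq_mul] at h3
      unfold scaledIntegrand
      rw [h3, ← integral_indicator measurableSet_freqBox]
      congr 1
      refine integral_congr_ae (Filter.Eventually.of_forall fun t => ?_)
      by_cases ht : t ∈ freqBox d <;> simp [ht]
    have hw : ∀ t, 0 ≤ (1 + phi q t) / 2 ∧ (1 + phi q t) / 2 ≤ 1 := fun t => by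
      have := abs_le.1 (abs_phi_le_one q t)
      constructor <;> linarith
    have hint : ∀ g : (Fin d → ℝ) → ℝ, Continuous g → (∀ t, |g t| ≤ 1) →
        Integrable (fun t => g t ^ n * ((1 + phi q t) / 2) ^ k * Real.cos (dot t y))
          (volume.restrict (freqBox d)) := by
      intro g hg hg1
      refine Integrable.of_bound (C := 1) (Continuous.aestronglyMeasurable (by fun_prop))
        (Filter.Eventually.of_forall fun t => ?_)
      rw [norm_mul, norm_mul, norm_pow, norm_pow]
      refine mul_le_one₀ (mul_le_one₀ (pow_le_one₀ (norm_nonneg _) (hg1 t)) (by positivity)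
        (pow_le_one₀ (norm_nonneg _) ?_)) (norm_nonneg _) (Real.abs_cos_le_one _)
      rw [Real.norm_of_nonneg (hw t).1]; exact (hw t).2
    -- Replacing φ by its positive part changes the integrand only where φ < 0, and there (1+φ)/2 ≤
    -- 1 - |φ|.
    have h4 : |(∫ t in freqBox d, phi q t ^ n * ((1 + phi q t) / 2) ^ k * Real.cos (dot t y))
        - ∫ t in freqBox d, max (phi q t) 0 ^ n * ((1 + phi q t) / 2) ^ k * Real.cos (dot t y)|
        ≤ M / n ^ k := by
      rw [← integral_sub, ← Real.norm_eq_abs]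
      · have hb : ∀ t ∈ freqBox d, ‖phi q t ^ n * ((1 + phi q t) / 2) ^ k * Real.cos (dot t y)
            - max (phi q t) 0 ^ n * ((1 + phi q t) / 2) ^ k * Real.cos (dot t y)‖
            ≤ (k.factorial : ℝ) / n ^ k := by
          intro t _
          rw [← sub_mul, ← sub_mul, norm_mul, norm_mul]
          rcases le_total 0 (phi q t) with h | h
          · rw [max_eq_left h]; simp; positivity
          · rw [max_eq_right h, zero_pow hn.ne', sub_zero]
            have h5 := abs_le.1 (abs_phi_le_one q t)
            have h6 := pow_mul_one_sub_pow_le (u := -phi q t) (by linarith) (by linarith) hn k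
            calc ‖phi q t ^ n‖ * ‖((1 + phi q t) / 2) ^ k‖ * ‖Real.cos (dot t y)‖
                ≤ (-phi q t) ^ n * (1 - -phi q t) ^ k * 1 := by
                  refine mul_le_mul (mul_le_mul ?_ ?_ (norm_nonneg _) ?_)
                    (Real.abs_cos_le_one _) (norm_nonneg _) ?_
                  · rw [norm_pow, Real.norm_eq_abs, abs_of_nonpos h]
                  · rw [norm_pow, Real.norm_of_nonneg (hw t).1]
                    exact pow_le_pow_left₀ (hw t).1 (by linarith) k
                  · exact pow_nonneg (by linarith) n
                  · exact mul_nonneg (pow_nonneg (by linarith) n) (pow_nonneg (by linarith) k)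
              _ ≤ _ := by rw [mul_one]; exact h6
        have := norm_setIntegral_le_of_norm_le_const (μ := (volume : Measure (Fin d → ℝ)))
          (s := freqBox d) (by rw [volume_freqBox]; exact ENNReal.ofReal_lt_top) hb
        refine this.trans (le_of_eq ?_)
        rw [measureReal_def, volume_freqBox, ENNReal.toReal_ofReal (by positivity), hM]
        ring
      · exact hint _ (continuous_phi q) (abs_phi_le_one q)
      · refine hint _ (by fun_prop) fun t => ?_
        have := abs_le.1 (abs_phi_le_one q t)
        rw [abs_of_nonneg (le_max_right _ _)]
        exact max_le this.2 zero_le_one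
    have h7 : |(∫ s, scaledIntegrand q k n s * Real.cos (dot ((Real.sqrt n)⁻¹ • s) y))
        - ∫ s, Real.exp (-(covForm q s / 2)) * Real.cos (dot ((Real.sqrt n)⁻¹ • s) y)|
        ≤ ∫ s, |scaledIntegrand q k n s - Real.exp (-(covForm q s / 2))| := by
      have hcos : AEStronglyMeasurable (fun s : Fin d → ℝ =>
          Real.cos (dot ((Real.sqrt n)⁻¹ • s) y)) volume :=
        Continuous.aestronglyMeasurable (by fun_prop)
      have hb : ∀ᵐ s : Fin d → ℝ ∂volume, ‖Real.cos (dot ((Real.sqrt n)⁻¹ • s) y)‖ ≤ 1 :=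
        Filter.Eventually.of_forall fun s => Real.abs_cos_le_one _
      rw [← integral_sub ((integrable_scaledIntegrand hq k hn).mul_bdd hcos hb)
        ((integrable_exp_covForm hq).mul_bdd hcos hb)]
      refine (abs_integral_le_integral_abs).trans (integral_mono_of_nonneg
        (Filter.Eventually.of_forall fun _ => abs_nonneg _)
        ((integrable_scaledIntegrand hq k hn).sub (integrable_exp_covForm hq)).abs
        (Filter.Eventually.of_forall fun s => ?_))
      simp only
      rw [← sub_mul, abs_mul]
      exact mul_le_of_le_one_right (abs_nonneg _) (Real.abs_cos_le_one _)
    rw [mul_assoc, ← integral_lazyAvg q hq.symm]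
    have h8 : |Real.sqrt n ^ d *
        (∫ t in freqBox d, phi q t ^ n * ((1 + phi q t) / 2) ^ k * Real.cos (dot t y))
        - Real.sqrt n ^ d * ∫ t in freqBox d,
          max (phi q t) 0 ^ n * ((1 + phi q t) / 2) ^ k * Real.cos (dot t y)|
        ≤ Real.sqrt n ^ d * (M / n ^ k) := by
      rw [← mul_sub, abs_mul, abs_of_pos (pow_pos hsn d)]
      gcongr
    rw [h2] at h8
    have := abs_sub_le (Real.sqrt n ^ d *
        (∫ t in freqBox d, phi q t ^ n * ((1 + phi q t) / 2) ^ k * Real.cos (dot t y)))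
      (∫ s, scaledIntegrand q k n s * Real.cos (dot ((Real.sqrt n)⁻¹ • s) y))
      (∫ s, Real.exp (-(covForm q s / 2)) * Real.cos (dot ((Real.sqrt n)⁻¹ • s) y))
    linarith

end LCLT

/-! ### The norm adapted to the walk -/

section RealNorm

variable {d : ℕ}

/-- The norm adapted to the walk, on `ℝᵈ`. -/
def realNorm (q : PMF (Fin d → ℤ)) (v : Fin d → ℝ) : ℝ :=
  Real.sqrt ((1 / (d : ℝ)) * ∑ i, ∑ j, v i * (covMatrix q)⁻¹ i j * v j)

variable {q : PMF (Fin d → ℤ)}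

lemma walkNorm_eq (x : Fin d → ℤ) : walkNorm q x = realNorm q fun i => (x i : ℝ) := rfl

/-- With Q = BᵀB take A = B⁻ᵀ/√d. The adapted norm is then a Euclidean norm after a linear change of
variables, which yields the triangle inequality, homogeneity and the volumes of balls. -/
lemma exists_whitening (hq : IsStepLaw q) (hd : 0 < d) :
    ∃ A : Matrix (Fin d) (Fin d) ℝ, A.det ≠ 0 ∧
      |A.det|⁻¹ = Real.sqrt (covMatrix q).det * Real.sqrt d ^ d ∧
      (∀ v, realNorm q v = ‖(WithLp.toLp 2 (A.mulVec v) : EuclideanSpace ℝ (Fin d))‖) ∧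
      ∀ v, v ⬝ᵥ (covMatrix q)⁻¹.mulVec v = d * realNorm q v ^ 2 := by
  obtain ⟨B, hQ, hB, hdet⟩ := exists_factor (covMatrix_posDef hq)
  have hd' : (0 : ℝ) < d := by exact_mod_cast hd
  have hsd : 0 < Real.sqrt d := Real.sqrt_pos.2 hd'
  have h1 : ∀ v : Fin d → ℝ, v ⬝ᵥ (covMatrix q)⁻¹.mulVec v
      = ∑ i, (B⁻¹.transpose.mulVec v) i ^ 2 := by
    intro v
    have : v ⬝ᵥ (covMatrix q)⁻¹.mulVec v = B⁻¹.transpose.mulVec v ⬝ᵥ B⁻¹.transpose.mulVec v := by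
      rw [hQ, Matrix.mul_inv_rev, Matrix.dotProduct_mulVec (B⁻¹.transpose.mulVec v),
        Matrix.vecMul_transpose, Matrix.mulVec_mulVec, dotProduct_comm, Matrix.transpose_nonsing_inv]
    rw [this, dotProduct]
    exact Finset.sum_congr rfl fun i _ => by ring
  have h2 : ∀ v : Fin d → ℝ, ∑ i, ∑ j, v i * (covMatrix q)⁻¹ i j * v j
      = v ⬝ᵥ (covMatrix q)⁻¹.mulVec v := by
    intro v
    simp only [dotProduct, Matrix.mulVec, Finset.mul_sum, mul_assoc]
  have h3 : ∀ v, v ⬝ᵥ (covMatrix q)⁻¹.mulVec v = d * realNorm q v ^ 2 := by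
    intro v
    rw [realNorm, Real.sq_sqrt, h2]
    · field_simp
    · rw [h2, h1]; positivity
  refine ⟨(Real.sqrt d)⁻¹ • B⁻¹.transpose, ?_, ?_, ?_, h3⟩
  · rw [Matrix.det_smul, Matrix.det_transpose, Matrix.det_nonsing_inv, Ring.inverse_eq_inv']
    positivity
  · rw [Matrix.det_smul, Matrix.det_transpose, Matrix.det_nonsing_inv, Ring.inverse_eq_inv',
      abs_mul, abs_inv, mul_inv, inv_inv, hdet, abs_pow, abs_inv, abs_of_pos hsd]
    simp [mul_comm]
  · intro v
    rw [EuclideanSpace.norm_eq, realNorm, h2, h1]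
    congr 1
    rw [Finset.mul_sum]
    refine Finset.sum_congr rfl fun i _ => ?_
    simp only [Matrix.smul_mulVec, Pi.smul_apply, smul_eq_mul, Real.norm_eq_abs, sq_abs, mul_pow,
      inv_pow, Real.sq_sqrt hd'.le, one_div]

lemma realNorm_add_le (hq : IsStepLaw q) (hd : 0 < d) (v w : Fin d → ℝ) :
    realNorm q (v + w) ≤ realNorm q v + realNorm q w := by
  obtain ⟨A, -, -, h, -⟩ := exists_whitening hq hd
  rw [h, h, h, Matrix.mulVec_add, WithLp.toLp_add]
  exact norm_add_le _ _

lemma realNorm_smul (hq : IsStepLaw q) (hd : 0 < d) (a : ℝ) (v : Fin d → ℝ) :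
    realNorm q (a • v) = |a| * realNorm q v := by
  obtain ⟨A, -, -, h, -⟩ := exists_whitening hq hd
  rw [h, h, Matrix.mulVec_smul, WithLp.toLp_smul, norm_smul, Real.norm_eq_abs]

lemma realNorm_neg (hq : IsStepLaw q) (hd : 0 < d) (v : Fin d → ℝ) :
    realNorm q (-v) = realNorm q v := by
  rw [← neg_one_smul ℝ v, realNorm_smul hq hd]; simp

lemma realNorm_sub_le (hq : IsStepLaw q) (hd : 0 < d) (v w : Fin d → ℝ) :
    realNorm q (v - w) ≤ realNorm q v + realNorm q w := by
  rw [sub_eq_add_neg, ← realNorm_neg hq hd w]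
  exact realNorm_add_le hq hd v (-w)

lemma walkNorm_add_le (hq : IsStepLaw q) (hd : 0 < d) (v w : Fin d → ℤ) :
    walkNorm q (v + w) ≤ walkNorm q v + walkNorm q w := by
  rw [walkNorm_eq, walkNorm_eq, walkNorm_eq]
  convert! realNorm_add_le hq hd (fun i => (v i : ℝ)) (fun i => (w i : ℝ)) using 2
  ext i; simp

lemma walkNorm_neg (hq : IsStepLaw q) (hd : 0 < d) (v : Fin d → ℤ) :
    walkNorm q (-v) = walkNorm q v := by
  rw [walkNorm_eq, walkNorm_eq, ← realNorm_neg hq hd (fun i => (v i : ℝ))]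
  congr 1
  ext i; simp

/-- The adapted norm is bounded on a box. -/
lemma exists_realNorm_le (hq : IsStepLaw q) (hd : 0 < d) :
    ∃ R : ℝ, ∀ v : Fin d → ℝ, (∀ i, |v i| ≤ 2) → realNorm q v ≤ R := by
  obtain ⟨A, -, -, h, -⟩ := exists_whitening hq hd
  have hK : IsCompact (Set.univ.pi fun _ : Fin d => Set.Icc (-2 : ℝ) 2) :=
    isCompact_univ_pi fun _ => isCompact_Icc
  have hc : Continuous (realNorm q) := by unfold realNorm; fun_prop
  obtain ⟨R, hR⟩ := (hK.image hc).bddAbove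
  exact ⟨R, fun v hv => hR ⟨v, Set.mem_univ_pi.2 fun i => abs_le.1 (hv i), rfl⟩⟩

/-- The volume of a ball for the adapted norm is at least that of an inscribed parallelepiped. -/
lemma le_volume_realNorm_ball (hq : IsStepLaw q) (hd : 0 < d) (z : Fin d → ℝ) {r : ℝ}
    (hr : 0 ≤ r) :
    ENNReal.ofReal (Real.sqrt (covMatrix q).det * (2 * r) ^ d)
      ≤ volume {s : Fin d → ℝ | realNorm q (s - z) ≤ r} := by
  obtain ⟨A, hA, hdet, h, -⟩ := exists_whitening hq hd
  have hd' : (0 : ℝ) < d := by exact_mod_cast hd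
  have hsd : 0 < Real.sqrt d := Real.sqrt_pos.2 hd'
  have h1 : volume {s : Fin d → ℝ | realNorm q (s - z) ≤ r}
      = volume {s : Fin d → ℝ | realNorm q s ≤ r} := by
    have := measure_preimage_add_right (volume : Measure (Fin d → ℝ)) (-z)
      {s : Fin d → ℝ | realNorm q s ≤ r}
    rw [← this]
    congr 1
  -- The closed ball is one for the sup norm: the cube of half side r/√d lies in the Euclidean ball
  -- of radius r. Its volume (2r)^d/√d^d removes the factor √d^d coming from det A.
  have h2 : Matrix.toLin' A ⁻¹' Metric.closedBall 0 (r / Real.sqrt d)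
      ⊆ {s : Fin d → ℝ | realNorm q s ≤ r} := by
    intro s hs
    rw [Set.mem_preimage, mem_closedBall_zero_iff, pi_norm_le_iff_of_nonneg (by positivity),
      Matrix.toLin'_apply] at hs
    rw [Set.mem_ofPred_eq, h, EuclideanSpace.norm_eq, Real.sqrt_le_left hr]
    calc ∑ i, ‖(A.mulVec s) i‖ ^ 2 ≤ ∑ _i : Fin d, (r / Real.sqrt d) ^ 2 := by
          refine Finset.sum_le_sum fun i _ => ?_
          have := hs i
          gcongr
      _ = r ^ 2 := by
          rw [Finset.sum_const, Finset.card_univ, Fintype.card_fin, nsmul_eq_mul, div_pow,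
            Real.sq_sqrt hd'.le]
          field_simp
  rw [h1]
  refine le_trans (le_of_eq ?_) (measure_mono h2)
  rw [Measure.addHaar_preimage_linearMap _ (by rwa [LinearMap.det_toLin']), LinearMap.det_toLin',
    Real.volume_pi_closedBall _ (by positivity), ← ENNReal.ofReal_mul (abs_nonneg _), abs_inv, hdet,
    Fintype.card_fin]
  congr 1
  rw [← mul_div_assoc, div_pow]
  field_simp

end RealNorm

/-! ### Pointwise bounds for the transition probabilities -/

section Bounds

variable {d : ℕ} {q : PMF (Fin d → ℤ)}

lemma lazyAvg_integral_eq (hq : IsStepLaw q) (hd : 0 < d) {n : ℕ} (y : Fin d → ℤ) :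
    ∫ s, Real.exp (-(covForm q s / 2)) * Real.cos (dot ((Real.sqrt n)⁻¹ • s) y)
      = Real.sqrt (2 * Real.pi) ^ d / Real.sqrt (covMatrix q).det
        * Real.exp (-(d / n * walkNorm q y ^ 2) / 2) := by
  obtain ⟨A, -, -, -, h⟩ := exists_whitening hq hd
  have h2 := integral_gaussian_quadratic_cos (covMatrix_posDef hq)
    ((Real.sqrt n)⁻¹ • fun i => (y i : ℝ))
  have h3 : ∀ s : Fin d → ℝ, dot ((Real.sqrt n)⁻¹ • s) y
      = s ⬝ᵥ ((Real.sqrt n)⁻¹ • fun i => (y i : ℝ)) := by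
    intro s
    rw [dot_smul, dotProduct_smul, smul_eq_mul, dot, dotProduct]
  simp only [← covForm_eq hq, h3]
  rw [h2, h, realNorm_smul hq hd, mul_pow, sq_abs, inv_pow, Real.sq_sqrt n.cast_nonneg,
    walkNorm_eq]
  congr 3
  ring

lemma nStep_toReal_le_one (n : ℕ) (y : Fin d → ℤ) : (nStep q n y).toReal ≤ 1 := by
  have := (nStep q n).coe_le_one y
  exact ENNReal.toReal_le_of_le_ofReal zero_le_one (by simpa using this)

/-- Keep only the term without additional steps, whose weight is 2⁻ᵏ. -/
lemma nStep_le_lazyAvg (k n : ℕ) (y : Fin d → ℤ) :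
    (nStep q n y).toReal ≤ 2 ^ k * lazyAvg q k n y := by
  have h := Finset.single_le_sum (s := Finset.range (k + 1))
    (f := fun j => (k.choose j : ℝ) / 2 ^ k * (nStep q (n + j) y).toReal)
    (fun j _ => by positivity) (Finset.mem_range.2 k.succ_pos)
  simp only [Nat.choose_zero_right, Nat.cast_one, add_zero] at h
  rw [lazyAvg]
  have h2 : (0 : ℝ) < 2 ^ k := by positivity
  calc (nStep q n y).toReal = 2 ^ k * (1 / 2 ^ k * (nStep q n y).toReal) := by field_simp
    _ ≤ _ := by gcongr

lemma sqrt_det_pos (hq : IsStepLaw q) : 0 < Real.sqrt (covMatrix q).det :=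
  Real.sqrt_pos.2 (covMatrix_posDef hq).det_pos

/-- The upper bound in the local limit theorem. -/
lemma exists_nStep_le (hq : IsStepLaw q) (hd : 0 < d) :
    ∃ n₀ : ℕ, 0 < n₀ ∧ ∀ n ≥ n₀, ∀ y : Fin d → ℤ,
      (nStep q n y).toReal * (Real.sqrt n ^ d * Real.sqrt (covMatrix q).det) ≤ 2 ^ (d + 2) := by
  obtain ⟨ε, hε, h⟩ := exists_lazyAvg_error hq
  have hS := sqrt_det_pos hq
  set S := Real.sqrt (covMatrix q).det
  obtain ⟨n₁, hn₁⟩ := Filter.eventually_atTop.1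
    (hε.eventually (gt_mem_nhds (show (0 : ℝ) < S⁻¹ by positivity)))
  refine ⟨max n₁ 1, by positivity, fun n hn y => ?_⟩
  have hn0 : 0 < n := lt_of_lt_of_le one_pos ((le_max_right _ _).trans hn)
  have h1 := h n hn0 y
  have h2 := hn₁ n ((le_max_left _ _).trans hn)
  rw [lazyAvg_integral_eq hq hd] at h1
  have hn' : (0 : ℝ) < n := by exact_mod_cast hn0
  have hw : 1 ≤ Real.sqrt (2 * Real.pi) := by
    rw [Real.one_le_sqrt]; linarith [Real.pi_gt_three]
  have hpi : (2 * Real.pi) ^ d = Real.sqrt (2 * Real.pi) ^ d * Real.sqrt (2 * Real.pi) ^ d := by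
    rw [← mul_pow, Real.mul_self_sqrt Real.two_pi_pos.le]
  set w := Real.sqrt (2 * Real.pi) ^ d with hwdef
  have hw1 : 1 ≤ w := one_le_pow₀ hw
  have he : Real.exp (-(d / n * walkNorm q y ^ 2) / 2) ≤ 1 := by
    rw [Real.exp_le_one_iff]
    have : 0 ≤ d / n * walkNorm q y ^ 2 := by positivity
    linarith
  have h3 : Real.sqrt n ^ d * (2 * Real.pi) ^ d * lazyAvg q (d + 1) n y ≤ w / S + S⁻¹ := by
    have := (abs_le.1 h1).2
    have h4 : w / S * Real.exp (-(d / n * walkNorm q y ^ 2) / 2) ≤ w / S :=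
      mul_le_of_le_one_right (by positivity) he
    linarith
  have h5 : Real.sqrt n ^ d * (w * w) * lazyAvg q (d + 1) n y * S ≤ w + 1 := by
    rw [hpi] at h3
    calc _ ≤ (w / S + S⁻¹) * S := by gcongr
      _ = w + 1 := by field_simp
  have h6 : 0 ≤ lazyAvg q (d + 1) n y := Finset.sum_nonneg fun j _ => by positivity
  -- As w ≥ 1, one has w + 1 ≤ 2w². The crude constant 2 depends neither on the walk nor on d.
  have h7 : Real.sqrt n ^ d * lazyAvg q (d + 1) n y * S ≤ 2 := by
    have h8 : w * w * (Real.sqrt n ^ d * lazyAvg q (d + 1) n y * S) ≤ w * w * 2 := by nlinarith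
    exact le_of_mul_le_mul_left h8 (by positivity)
  calc _ ≤ (2 ^ (d + 1) * lazyAvg q (d + 1) n y) * (Real.sqrt n ^ d * S) := by
        gcongr; exact nStep_le_lazyAvg _ _ _
    _ = 2 ^ (d + 1) * (Real.sqrt n ^ d * lazyAvg q (d + 1) n y * S) := by ring
    _ ≤ 2 ^ (d + 1) * 2 := by gcongr
    _ = 2 ^ (d + 2) := by ring

/-- Fourier inversion with the cosine bounded by 1: the majorant φ^(2m) integrates to a return
probability, the constant ρ to itself, and the common factor (2π)^d cancels. -/
lemma abs_sub_le_of_integrand (hq : IsStepLaw q) {a b : ℕ} {y : Fin d → ℤ} {m : ℕ} {δ ρ : ℝ}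
    (h : ∀ t, |phi q t ^ a - phi q t ^ b| ≤ δ * phi q t ^ (2 * m) + ρ) :
    |(nStep q a y).toReal - (nStep q b y).toReal| ≤ δ * (nStep q (2 * m) 0).toReal + ρ := by
  have hi : ∀ (c : ℕ) (z : Fin d → ℤ), Integrable (fun t => phi q t ^ c * Real.cos (dot t z))
      (volume.restrict (freqBox d)) := by
    intro c z
    refine Integrable.of_bound (C := 1)
      (Continuous.aestronglyMeasurable (by fun_prop)) (Filter.Eventually.of_forall fun t => ?_)
    rw [norm_mul, norm_pow]
    exact mul_le_one₀ (pow_le_one₀ (norm_nonneg _) (abs_phi_le_one q t)) (norm_nonneg _)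
      (Real.abs_cos_le_one _)
  have hpi : (0 : ℝ) < (2 * Real.pi) ^ d := by have := Real.pi_pos; positivity
  have h1 : (2 * Real.pi) ^ d * |(nStep q a y).toReal - (nStep q b y).toReal|
      ≤ (2 * Real.pi) ^ d * (δ * (nStep q (2 * m) 0).toReal + ρ) := by
    rw [← abs_of_pos hpi, ← abs_mul, abs_of_pos hpi, mul_sub, ← integral_phi_pow_mul_cos q hq.symm,
      ← integral_phi_pow_mul_cos q hq.symm, ← integral_sub (hi a y) (hi b y)]
    calc |∫ t in freqBox d, (phi q t ^ a * Real.cos (dot t y) - phi q t ^ b * Real.cos (dot t y))|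
        ≤ ∫ t in freqBox d, |phi q t ^ a * Real.cos (dot t y) - phi q t ^ b * Real.cos (dot t y)| :=
          abs_integral_le_integral_abs
      _ ≤ ∫ t in freqBox d, (δ * (phi q t ^ (2 * m) * Real.cos (dot t 0)) + ρ) := by
          refine integral_mono ((hi a y).sub (hi b y)).abs
            (((hi _ 0).const_mul δ).add (integrable_const ρ)) fun t => ?_
          simp only
          rw [← sub_mul, abs_mul]
          have h0 : dot t (0 : Fin d → ℤ) = 0 := by simp [dot]
          rw [h0, Real.cos_zero, mul_one]
          exact (mul_le_of_le_one_right (abs_nonneg _) (Real.abs_cos_le_one _)).trans (h t)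
      _ = (2 * Real.pi) ^ d * (δ * (nStep q (2 * m) 0).toReal + ρ) := by
          rw [integral_add ((hi _ 0).const_mul δ) (integrable_const ρ), integral_const_mul,
            integral_phi_pow_mul_cos q hq.symm, integral_const, measureReal_def,
            Measure.restrict_apply_univ, volume_freqBox, ENNReal.toReal_ofReal hpi.le, smul_eq_mul]
          ring
  exact le_of_mul_le_mul_left h1 hpi

lemma sq_pow_mul_le {u : ℝ} (hu : |u| ≤ 1) {m : ℕ} (hm : 0 < m) :
    (u ^ 2) ^ m * (1 - u ^ 2) ≤ 1 / m := by
  have h := pow_mul_one_sub_pow_le (u := u ^ 2) (sq_nonneg u) ((sq_le_one_iff_abs_le_one u).2 hu)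
    hm 1
  simpa using h

/-- Of the power |φ|^(4m), one half absorbs the factor 1 - φ² at the gain of 1/m, and the other half
is left to integrate to a return probability. The difference is thus smaller by a factor of order n
than the probabilities themselves. -/
lemma abs_nStep_add_two_sub_le (hq : IsStepLaw q) {n m : ℕ} (hm : 0 < m) (hn : 4 * m ≤ n)
    (y : Fin d → ℤ) :
    |(nStep q (n + 2) y).toReal - (nStep q n y).toReal| ≤ 1 / m * (nStep q (2 * m) 0).toReal := by
  have := abs_sub_le_of_integrand hq (a := n + 2) (b := n) (y := y) (m := m) (δ := 1 / m) (ρ := 0)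
    fun t => ?_
  · simpa using this
  · set u := phi q t
    have hu : |u| ≤ 1 := abs_phi_le_one q t
    have hu2 : u ^ 2 ≤ 1 := (sq_le_one_iff_abs_le_one u).2 hu
    rw [add_zero, pow_add, ← mul_sub_one, abs_mul, abs_pow, abs_of_nonpos (sub_nonpos.2 hu2)]
    calc |u| ^ n * -(u ^ 2 - 1) ≤ |u| ^ (4 * m) * -(u ^ 2 - 1) :=
          mul_le_mul_of_nonneg_right (pow_le_pow_of_le_one (abs_nonneg _) hu hn) (by linarith)
      _ = ((u ^ 2) ^ m * (1 - u ^ 2)) * u ^ (2 * m) := by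
          rw [show 4 * m = 2 * m + 2 * m by ring, pow_add, pow_mul, sq_abs, pow_mul]; ring
      _ ≤ _ := by
          refine mul_le_mul_of_nonneg_right (sq_pow_mul_le hu hm) ?_
          rw [pow_mul]; positivity

/-- For an aperiodic walk the negative values of the characteristic function are bounded
away from `-1`. -/
lemma exists_neg_phi_le (hq : IsStepLaw q) {M : ℕ} (hM : Odd M) (h0 : 0 < nStep q M 0) :
    ∃ ρ : ℝ, 0 ≤ ρ ∧ ρ < 1 ∧ ∀ t, -phi q t ≤ ρ := by
  have hM0 : M ≠ 0 := hM.pos.ne'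
  set δ := (nStep q M 0).toReal with hδ
  have hδ0 : 0 < δ := ENNReal.toReal_pos h0.ne' ((nStep q M).apply_ne_top 0)
  have hδ1 : δ ≤ 1 := nStep_toReal_le_one M 0
  -- 1 + φ^M is the mean of 1 + cos under the M-step law, and the atom at the origin alone
  -- contributes 2δ.
  have h1 : ∀ t, -(phi q t ^ M) ≤ 1 - δ := by
    intro t
    rw [← phi_nStep q hq.symm M t]
    have hi : Integrable (fun x => Real.cos (dot t x)) (nStep q M).toMeasure := integrable_cos _ t
    have h2 : phi (nStep q M) t + 1 = ∫ x, (Real.cos (dot t x) + 1) ∂(nStep q M).toMeasure := by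
      rw [integral_add hi (integrable_const _)]
      simp [phi]
    have h3 : ∫ x in {(0 : Fin d → ℤ)}, (Real.cos (dot t x) + 1) ∂(nStep q M).toMeasure
        ≤ ∫ x, (Real.cos (dot t x) + 1) ∂(nStep q M).toMeasure :=
      setIntegral_le_integral (hi.add (integrable_const _))
        (Filter.Eventually.of_forall fun x => by
          have := Real.neg_one_le_cos (dot t x)
          simp only [Pi.zero_apply]; linarith)
    rw [integral_singleton, measureReal_def,
      PMF.toMeasure_apply_singleton _ _ (measurableSet_singleton _), ← hδ, ← h2] at h3
    have h4 : dot t (0 : Fin d → ℤ) = 0 := by simp [dot]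
    rw [h4, Real.cos_zero, smul_eq_mul] at h3
    linarith
  refine ⟨(1 - δ) ^ (1 / (M : ℝ)), Real.rpow_nonneg (by linarith) _,
    Real.rpow_lt_one (by linarith) (by linarith) (by positivity), fun t => ?_⟩
  rcases le_or_gt (-phi q t) 0 with h | h
  · exact h.trans (Real.rpow_nonneg (by linarith) _)
  · have h5 := h1 t
    rw [← hM.neg_pow] at h5
    calc -phi q t = ((-phi q t) ^ M) ^ (1 / (M : ℝ)) := by
          rw [one_div, Real.pow_rpow_inv_natCast h.le hM0]
      _ ≤ _ := Real.rpow_le_rpow (by positivity) h5 (by positivity)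

/-- Where φ ≥ 0, the inequality 1 - φ ≤ 1 - φ² reduces to the two-step estimate. Where φ < 0, the
integrand is at most 2ρⁿ. -/
lemma abs_nStep_succ_sub_le (hq : IsStepLaw q) {ρ : ℝ} (hρ0 : 0 ≤ ρ) (hρ : ∀ t, -phi q t ≤ ρ)
    {n m : ℕ} (hm : 0 < m) (hn : 4 * m ≤ n) (y : Fin d → ℤ) :
    |(nStep q (n + 1) y).toReal - (nStep q n y).toReal|
      ≤ 1 / m * (nStep q (2 * m) 0).toReal + 2 * ρ ^ n := by
  refine abs_sub_le_of_integrand hq fun t => ?_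
  set u := phi q t with hudef
  have hu : |u| ≤ 1 := abs_phi_le_one q t
  have hu1 := abs_le.1 hu
  rw [pow_add, ← mul_sub_one, abs_mul, abs_pow, pow_one, abs_of_nonpos (sub_nonpos.2 hu1.2)]
  rcases le_total 0 u with h | h
  · have : |u| ^ n * -(u - 1) ≤ 1 / m * u ^ (2 * m) := by
      calc |u| ^ n * -(u - 1) ≤ |u| ^ (4 * m) * (1 - u ^ 2) := by
            refine mul_le_mul (pow_le_pow_of_le_one (abs_nonneg _) hu hn) (by nlinarith)
              (by linarith) (by positivity)
        _ = ((u ^ 2) ^ m * (1 - u ^ 2)) * u ^ (2 * m) := by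
            rw [show 4 * m = 2 * m + 2 * m by ring, pow_add, pow_mul, sq_abs, pow_mul]; ring
        _ ≤ _ := by
            refine mul_le_mul_of_nonneg_right (sq_pow_mul_le hu hm) ?_
            rw [pow_mul]; positivity
    have : 0 ≤ 2 * ρ ^ n := by positivity
    linarith
  · have h1 : |u| ^ n * -(u - 1) ≤ ρ ^ n * 2 := by
      refine mul_le_mul (pow_le_pow_left₀ (abs_nonneg _) ?_ n) (by linarith) (by linarith)
        (by positivity)
      rw [abs_of_nonpos h]; exact hρ t
    have h2 : 0 ≤ 1 / m * u ^ (2 * m) := by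
      rw [pow_mul]; positivity
    linarith

end Bounds

/-! ### Lower bounds for the transition probabilities -/

section LowerBounds

variable {d : ℕ} {q : PMF (Fin d → ℤ)}

/-- Doubling a generator costs two steps, so every doubled lattice point is reached in an even
number of steps, whatever the period. -/
lemma exists_nStep_even_pos (hq : IsStepLaw q) (v : Fin d → ℤ) :
    ∃ k, 0 < nStep q (2 * k) (v + v) := by
  have hv : v ∈ AddSubgroup.closure q.support := by rw [hq.generates]; trivial
  induction hv using AddSubgroup.closure_induction with
  | mem x hx =>
    have h : 0 < nStep q 1 x := by
      rw [nStep_one_apply]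
      exact pos_iff_ne_zero.2 hx
    exact ⟨1, nStep_pos_add (m := 1) (n := 1) h h⟩
  | zero => exact ⟨0, by simp [nStep_zero_apply]⟩
  | add x y _ _ hx hy =>
    obtain ⟨k, hk⟩ := hx
    obtain ⟨l, hl⟩ := hy
    refine ⟨k + l, ?_⟩
    have := nStep_pos_add hk hl
    rw [← mul_add] at this
    convert! this using 2
    abel
  | neg x _ hx =>
    obtain ⟨k, hk⟩ := hx
    exact ⟨k, by rw [← neg_add, nStep_neg hq.symm]; exact hk⟩

/-- Transition probabilities at neighbouring times of the right parity are close. -/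
lemma exists_nStep_sub_error (hq : IsStepLaw q) (hd : 0 < d) :
    ∃ E : ℕ → ℝ, (∀ n, 0 ≤ E n) ∧
      Filter.Tendsto (fun n : ℕ => Real.sqrt n ^ d * E n) Filter.atTop (nhds 0) ∧
      ∀ n ≥ 4, ∀ y, (∃ m, m % 2 = n % 2 ∧ 0 < nStep q m y) → ∀ j,
        nStep q (n + j) y = 0 ∨
          |(nStep q (n + j) y).toReal - (nStep q n y).toReal| ≤ j * E n := by
  -- The bound of the difference estimates with m = ⌊n/4⌋; it is of order n^(-1-d/2).
  set E₀ : ℕ → ℝ := fun n => 1 / (n / 4 : ℕ) * (nStep q (2 * (n / 4)) 0).toReal with hE₀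
  have hE₀pos : ∀ n, 0 ≤ E₀ n := fun n => by positivity
  have hS := sqrt_det_pos hq
  set S := Real.sqrt (covMatrix q).det
  have hE₀lim : Filter.Tendsto (fun n : ℕ => Real.sqrt n ^ d * E₀ n) Filter.atTop (nhds 0) := by
    obtain ⟨n₀, hn₀, h⟩ := exists_nStep_le hq hd
    set K : ℝ := 2 ^ d * 2 ^ (d + 2) * 8 / S with hK
    have hlim : Filter.Tendsto (fun n : ℕ => K * (n : ℝ)⁻¹) Filter.atTop (nhds (K * 0)) :=
      tendsto_const_nhds.mul tendsto_inv_atTop_nhds_zero_nat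
    rw [mul_zero] at hlim
    refine squeeze_zero' (Filter.Eventually.of_forall fun n => by have := hE₀pos n; positivity)
      ?_ hlim
    filter_upwards [Filter.eventually_ge_atTop (4 * n₀)] with n hn
    set m := n / 4 with hm
    have hm1 : n₀ ≤ m := by omega
    have hm0 : 0 < m := by omega
    have hnm : n ≤ 8 * m := by omega
    have hm' : (0 : ℝ) < m := by exact_mod_cast hm0
    have hn' : (0 : ℝ) < n := by exact_mod_cast (by omega : 0 < n)
    have hnm' : (n : ℝ) ≤ 8 * m := by exact_mod_cast hnm
    have h1 := h (2 * m) (by omega) 0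
    push_cast at h1
    have hs2 : 0 < Real.sqrt (2 * m) := Real.sqrt_pos.2 (by positivity)
    have h2 : Real.sqrt n ≤ 2 * Real.sqrt (2 * m) := by
      rw [Real.sqrt_le_left (by positivity), mul_pow, Real.sq_sqrt (by positivity)]
      linarith
    set p := (nStep q (2 * m) 0).toReal with hp
    have hp0 : 0 ≤ p := ENNReal.toReal_nonneg
    have hinv : 1 / (m : ℝ) ≤ 8 * (n : ℝ)⁻¹ := by
      rw [← div_eq_mul_inv, div_le_div_iff₀ hm' hn']; linarith
    calc Real.sqrt n ^ d * E₀ n = Real.sqrt n ^ d * p * (1 / m) := by rw [hE₀]; ring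
      _ ≤ (2 * Real.sqrt (2 * m)) ^ d * p * (8 * (n : ℝ)⁻¹) := by gcongr
      _ = 2 ^ d * (p * (Real.sqrt (2 * m) ^ d * S)) * (8 * (n : ℝ)⁻¹) / S := by
        rw [mul_pow]; field_simp
      _ ≤ 2 ^ d * 2 ^ (d + 2) * (8 * (n : ℝ)⁻¹) / S := by gcongr
      _ = K * (n : ℝ)⁻¹ := by rw [hK]; ring
  -- If an odd return is possible, φ stays away from -1 and all later times can be compared.
  -- Otherwise only time differences of even parity can be, and at odd differences the probability
  -- vanishes.
  by_cases hper : ∃ M, Odd M ∧ 0 < nStep q M 0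
  · obtain ⟨M, hM, hM0⟩ := hper
    obtain ⟨ρ, hρ0, hρ1, hρ⟩ := exists_neg_phi_le hq hM hM0
    refine ⟨fun n => E₀ n + 2 * ρ ^ n, fun n => by have := hE₀pos n; positivity, ?_, ?_⟩
    · have h1 := tendsto_pow_const_mul_const_pow_of_lt_one d hρ0 hρ1
      have h2 : Filter.Tendsto (fun n : ℕ => Real.sqrt n ^ d * (2 * ρ ^ n)) Filter.atTop
          (nhds 0) := by
        have h3 := h1.const_mul 2
        rw [mul_zero] at h3
        refine squeeze_zero' (Filter.Eventually.of_forall fun n => by positivity) ?_ h3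
        filter_upwards [Filter.eventually_ge_atTop 1] with n hn
        have hn' : (1 : ℝ) ≤ n := by exact_mod_cast hn
        have hs : Real.sqrt n ≤ n := by
          rw [Real.sqrt_le_left (by linarith)]; nlinarith
        calc Real.sqrt n ^ d * (2 * ρ ^ n) ≤ (n : ℝ) ^ d * (2 * ρ ^ n) := by gcongr
          _ = _ := by ring
      have := hE₀lim.add h2
      simpa [mul_add] using this
    · intro n hn y _ j
      right
      induction j with
      | zero => simp
      | succ j ih =>
        have h1 := abs_nStep_succ_sub_le hq hρ0 hρ (n := n + j) (m := n / 4) (by omega) (by omega) y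
        have h2 : ρ ^ (n + j) ≤ ρ ^ n := pow_le_pow_of_le_one hρ0 hρ1.le (Nat.le_add_right _ _)
        have h3 := abs_sub_le (nStep q (n + j + 1) y).toReal (nStep q (n + j) y).toReal
          (nStep q n y).toReal
        rw [← add_assoc]
        push_cast
        simp only [hE₀] at ih ⊢
        linarith
  · push Not at hper
    refine ⟨E₀, hE₀pos, hE₀lim, ?_⟩
    rintro n hn y ⟨m, hm, hmy⟩ j
    rcases Nat.even_or_odd j with hj | hj
    · right
      obtain ⟨i, rfl⟩ := hj
      induction i with
      | zero => simp
      | succ i ih =>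
        have h1 := abs_nStep_add_two_sub_le hq (n := n + (i + i)) (m := n / 4) (by omega) (by omega)
          y
        have h3 := abs_sub_le (nStep q (n + (i + i) + 2) y).toReal
          (nStep q (n + (i + i)) y).toReal (nStep q n y).toReal
        rw [show n + (i + 1 + (i + 1)) = n + (i + i) + 2 by ring]
        push_cast at ih ⊢
        simp only [hE₀] at ih ⊢
        have := hE₀pos n
        simp only [hE₀] at this
        linarith
    -- A path to y at time n + j followed by a reversed path of length m would be a loop of odd
    -- length.
    · left
      by_contra h0
      have h1 := nStep_pos_add (pos_iff_ne_zero.2 h0) (y := y) (z := -y) (n := m)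
        (by rwa [nStep_neg hq.symm])
      rw [add_neg_cancel] at h1
      have h2 := hper (n + j + m) (by
        rw [Nat.odd_iff] at hj ⊢
        omega)
      exact absurd h1 (by simpa using h2)

/-- The constant in the lower bound of the local limit theorem. -/
def lowerConst (d : ℕ) : ℝ := Real.exp (-(d / 2)) / (2 * Real.sqrt (2 * Real.pi) ^ d)

lemma lowerConst_pos (d : ℕ) : 0 < lowerConst d := by
  have := Real.pi_pos
  unfold lowerConst
  positivity

/-- The lower bound in the local limit theorem, at points of the right parity. -/
lemma exists_le_nStep (hq : IsStepLaw q) (hd : 0 < d) :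
    ∃ n₀ : ℕ, 0 < n₀ ∧ ∀ n ≥ n₀, ∀ y : Fin d → ℤ, walkNorm q y ≤ Real.sqrt n →
      (∃ m, m % 2 = n % 2 ∧ 0 < nStep q m y) →
      lowerConst d ≤ (nStep q n y).toReal * (Real.sqrt n ^ d * Real.sqrt (covMatrix q).det) := by
  obtain ⟨ε, hε, h⟩ := exists_lazyAvg_error hq
  obtain ⟨E, hE0, hE, hsub⟩ := exists_nStep_sub_error hq hd
  have hS := sqrt_det_pos hq
  set S := Real.sqrt (covMatrix q).det
  have hpi0 := Real.pi_pos
  set w := Real.sqrt (2 * Real.pi) ^ d with hwdef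
  have hw0 : 0 < w := by positivity
  have hpi : (2 * Real.pi) ^ d = w * w := by
    rw [← mul_pow, Real.mul_self_sqrt Real.two_pi_pos.le]
  have hlc : lowerConst d = Real.exp (-(d / 2)) / (2 * w) := rfl
  have hlim : Filter.Tendsto (fun n : ℕ => S * ε n / (w * w) + (d + 1) * S * (Real.sqrt n ^ d * E n))
      Filter.atTop (nhds (S * 0 / (w * w) + (d + 1) * S * 0)) :=
    ((hε.const_mul S).div_const _).add (hE.const_mul _)
  rw [mul_zero, zero_div, mul_zero, add_zero] at hlim
  obtain ⟨n₁, hn₁⟩ := Filter.eventually_atTop.1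
    (hlim.eventually (gt_mem_nhds (lowerConst_pos d)))
  refine ⟨max n₁ 4, by positivity, fun n hn y hy hpar => ?_⟩
  have hn4 : 4 ≤ n := (le_max_right _ _).trans hn
  have h1 := h n (by omega) y
  have h2 := hn₁ n ((le_max_left _ _).trans hn)
  rw [lazyAvg_integral_eq hq hd, hpi] at h1
  have hn' : (0 : ℝ) < n := by exact_mod_cast (by omega : 0 < n)
  have hsn : 0 < Real.sqrt n := Real.sqrt_pos.2 hn'
  have he : Real.exp (-(d / 2)) ≤ Real.exp (-(d / n * walkNorm q y ^ 2) / 2) := by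
    rw [Real.exp_le_exp, neg_div, neg_le_neg_iff]
    have h3 : walkNorm q y ^ 2 ≤ n := by
      have := pow_le_pow_left₀ (Real.sqrt_nonneg _ : 0 ≤ walkNorm q y) hy 2
      rwa [Real.sq_sqrt hn'.le] at this
    calc d / n * walkNorm q y ^ 2 / 2 ≤ d / n * n / 2 := by gcongr
      _ = d / 2 := by field_simp
  set p := (nStep q n y).toReal
  -- Terms of the wrong parity are zero and so satisfy the bound as well; the binomial weights sum
  -- to 1.
  have hlazy : lazyAvg q (d + 1) n y ≤ p + (d + 1) * E n := by
    have h4 : ∀ j ∈ Finset.range (d + 1 + 1),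
        ((d + 1).choose j : ℝ) / 2 ^ (d + 1) * (nStep q (n + j) y).toReal
          ≤ ((d + 1).choose j : ℝ) / 2 ^ (d + 1) * (p + (d + 1) * E n) := by
      intro j hj
      gcongr
      have hjd : (j : ℝ) ≤ d + 1 := by
        exact_mod_cast Nat.lt_succ_iff.1 (Finset.mem_range.1 hj)
      have hEn := hE0 n
      rcases hsub n hn4 y hpar j with h5 | h5
      · rw [h5, ENNReal.toReal_zero]
        have : 0 ≤ p := ENNReal.toReal_nonneg
        positivity
      · have h6 := (abs_le.1 h5).2
        have h7 : (j : ℝ) * E n ≤ (d + 1) * E n := by gcongr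
        linarith
    refine (Finset.sum_le_sum h4).trans (le_of_eq ?_)
    rw [← Finset.sum_mul, ← Finset.sum_div, ← Nat.cast_sum, Nat.sum_range_choose]
    push_cast
    field_simp
  have h8 : w / S * Real.exp (-(d / 2)) - ε n
      ≤ Real.sqrt n ^ d * (w * w) * (p + (d + 1) * E n) := by
    have h9 := (abs_le.1 h1).1
    have h10 : w / S * Real.exp (-(d / 2)) ≤ w / S * Real.exp (-(d / n * walkNorm q y ^ 2) / 2) := by
      gcongr
    have h11 : Real.sqrt n ^ d * (w * w) * lazyAvg q (d + 1) n y
        ≤ Real.sqrt n ^ d * (w * w) * (p + (d + 1) * E n) := by gcongr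
    linarith
  -- The Gaussian limit is twice `lowerConst`; the other half absorbs both error terms for large n.
  have h12 : 2 * lowerConst d - S * ε n / (w * w)
      ≤ p * (Real.sqrt n ^ d * S) + (d + 1) * S * (Real.sqrt n ^ d * E n) := by
    have h13 := mul_le_mul_of_nonneg_right h8 (show 0 ≤ S / (w * w) by positivity)
    have e1 : (w / S * Real.exp (-(d / 2)) - ε n) * (S / (w * w))
        = 2 * lowerConst d - S * ε n / (w * w) := by
      rw [hlc]; field_simp
    have e2 : Real.sqrt n ^ d * (w * w) * (p + (d + 1) * E n) * (S / (w * w))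
        = p * (Real.sqrt n ^ d * S) + (d + 1) * S * (Real.sqrt n ^ d * E n) := by
      field_simp
    rwa [e1, e2] at h13
  linarith

/-- The `n`-step law charges every ball of radius of order `√n` whose centre is not too far. -/
lemma exists_le_sum_nStep_ball (hq : IsStepLaw q) (hd : 0 < d) {ε : ℝ} (hε : 0 < ε)
    (hε' : ε ≤ 1 / 4) :
    ∃ n₀ : ℕ, 0 < n₀ ∧ ∀ n ≥ n₀, ∀ z : Fin d → ℝ, realNorm q z ≤ 3 / 4 * Real.sqrt n →
      ENNReal.ofReal (lowerConst d * (ε / 2) ^ d)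
        ≤ ∑' y : Fin d → ℤ, if realNorm q ((fun i => (y i : ℝ)) - z) ≤ ε * Real.sqrt n
            then nStep q n y else 0 := by
  obtain ⟨n₁, hn₁, hlow⟩ := exists_le_nStep hq hd
  obtain ⟨R, hR⟩ := exists_realNorm_le hq hd
  have hS := sqrt_det_pos hq
  set S := Real.sqrt (covMatrix q).det with hSdef
  refine ⟨max n₁ ⌈(2 * R / ε) ^ 2⌉₊, by positivity, fun n hn z hz => ?_⟩
  have hn1 : n₁ ≤ n := (le_max_left _ _).trans hn
  have hn' : (0 : ℝ) < n := by exact_mod_cast (by omega : 0 < n)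
  have hsn : 0 < Real.sqrt n := Real.sqrt_pos.2 hn'
  have hRn : R ≤ ε * Real.sqrt n / 2 := by
    have h1 : (2 * R / ε) ^ 2 ≤ n := (Nat.le_ceil _).trans
      (by exact_mod_cast (le_max_right _ _).trans hn)
    have h2 := Real.le_sqrt_of_sq_le h1
    rw [div_le_iff₀ hε] at h2
    linarith
  -- A base point of the parity of n. All points e + 2v are then of the right parity for the
  -- pointwise lower bound.
  obtain ⟨e, k, hk, he⟩ : ∃ (e : Fin d → ℤ) (k : ℕ), k % 2 = n % 2 ∧ 0 < nStep q k e := by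
    rcases Nat.mod_two_eq_zero_or_one n with h | h
    · exact ⟨0, 0, by omega, by simp [nStep_zero_apply]⟩
    · obtain ⟨e, he⟩ := q.support_nonempty
      exact ⟨e, 1, by omega, by rw [nStep_one_apply]; exact pos_iff_ne_zero.2 he⟩
  set r := ε * Real.sqrt n with hr
  set P : (Fin d → ℤ) → Prop := fun v => realNorm q ((fun i => ((e + (v + v)) i : ℝ)) - z) ≤ r
    with hP
  set c : ℝ≥0∞ := ENNReal.ofReal (lowerConst d / (Real.sqrt n ^ d * S)) with hc
  have hpt : ∀ v, P v → c ≤ nStep q n (e + (v + v)) := by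
    intro v hv
    have h1 : walkNorm q (e + (v + v)) ≤ Real.sqrt n := by
      rw [walkNorm_eq]
      have h2 := realNorm_add_le hq hd ((fun i => ((e + (v + v)) i : ℝ)) - z) z
      rw [sub_add_cancel] at h2
      have h3 : ε * Real.sqrt n ≤ 1 / 4 * Real.sqrt n := by gcongr
      have hv' : realNorm q ((fun i => ((e + (v + v)) i : ℝ)) - z) ≤ r := hv
      linarith
    obtain ⟨l, hl⟩ := exists_nStep_even_pos hq v
    have h4 := hlow n hn1 _ h1 ⟨k + 2 * l, by omega, nStep_pos_add he hl⟩
    rw [hc, ENNReal.ofReal_le_iff_le_toReal ((nStep q n).apply_ne_top _),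
      div_le_iff₀ (by positivity)]
    exact h4
  have hinj : Function.Injective fun v : Fin d → ℤ => e + (v + v) := by
    intro v w h
    have h1 : v + v = w + w := add_left_cancel h
    funext i
    have := congrFun h1 i
    simp only [Pi.add_apply] at this
    omega
  -- The points e + 2v form a translate of a sublattice of index 2^d, so the covering boxes have
  -- side 2. Their diameter is bounded, hence covering the ball of radius r/2 uses only points in
  -- the ball of radius r.
  set box : (Fin d → ℤ) → Set (Fin d → ℝ) := fun v =>
    Set.univ.pi fun i => Set.Ico ((e i : ℝ) + 2 * v i) ((e i : ℝ) + 2 * v i + 2) with hbox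
  have hcover : {s : Fin d → ℝ | realNorm q (s - z) ≤ r / 2} ⊆ ⋃ v ∈ {v | P v}, box v := by
    intro s hs
    set v : Fin d → ℤ := fun i => ⌊(s i - e i) / 2⌋ with hv
    have hv1 : ∀ i, (v i : ℝ) ≤ (s i - e i) / 2 := fun i => Int.floor_le _
    have hv2 : ∀ i, (s i - e i) / 2 < v i + 1 := fun i => Int.lt_floor_add_one _
    refine Set.mem_iUnion₂.2 ⟨v, ?_, Set.mem_univ_pi.2 fun i => ⟨?_, ?_⟩⟩
    · have h1 : (fun i => ((e + (v + v)) i : ℝ)) - z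
          = (s - z) - (s - fun i => ((e + (v + v)) i : ℝ)) := by abel
      have h2 : realNorm q (s - fun i => ((e + (v + v)) i : ℝ)) ≤ R := by
        refine hR _ fun i => ?_
        simp only [Pi.sub_apply, Pi.add_apply, Int.cast_add]
        rw [abs_le]
        constructor <;> linarith [hv1 i, hv2 i]
      change realNorm q _ ≤ r
      rw [h1]
      have h3 := realNorm_sub_le hq hd (s - z) (s - fun i => ((e + (v + v)) i : ℝ))
      have hs' : realNorm q (s - z) ≤ r / 2 := hs
      linarith
    · linarith [hv1 i]
    · linarith [hv2 i]
  have hvol := (le_volume_realNorm_ball hq hd z (r := r / 2) (by positivity)).trans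
    ((measure_mono hcover).trans (measure_biUnion_le volume (Set.to_countable _) box))
  have hboxvol : ∀ v, volume (box v) = 2 ^ d := by
    intro v
    rw [hbox, volume_pi_pi]
    simp
  have hsum : c * ∑' v : {v | P v}, volume (box v)
      ≤ 2 ^ d * ∑' y : Fin d → ℤ, if realNorm q ((fun i => (y i : ℝ)) - z) ≤ r
            then nStep q n y else 0 := by
    simp only [hboxvol]
    rw [← ENNReal.tsum_mul_left, ← ENNReal.tsum_mul_left]
    refine le_trans (ENNReal.tsum_le_tsum fun v => ?_)
      (ENNReal.tsum_comp_le_tsum_of_injective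
        (f := fun v : {v | P v} => e + (v.1 + v.1))
        (fun v w h => Subtype.ext (hinj h)) _)
    have hv : realNorm q ((fun i => ((e + (v.1 + v.1)) i : ℝ)) - z) ≤ r := v.2
    rw [if_pos hv, mul_comm]
    gcongr
    exact hpt v.1 v.2
  have h1 := (mul_le_mul_right hvol c).trans hsum
  have h2 : c * ENNReal.ofReal (S * (2 * (r / 2)) ^ d)
      = 2 ^ d * ENNReal.ofReal (lowerConst d * (ε / 2) ^ d) := by
    have hlc := lowerConst_pos d
    rw [hc, ← ENNReal.ofReal_mul (by positivity),
      show (2 : ℝ≥0∞) ^ d = ENNReal.ofReal (2 ^ d) by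
        rw [ENNReal.ofReal_pow (by norm_num)]; simp,
      ← ENNReal.ofReal_mul (by positivity)]
    congr 1
    rw [hr, div_pow]
    field_simp
    ring
  rw [← hSdef, h2] at h1
  exact (ENNReal.mul_le_mul_iff_right (by positivity) (by finiteness)).1 h1

end LowerBounds

/-! ### Sums over generations -/

section GenSum

/-- The sum of `f` over all words of length `j`. -/
def genSum (j : ℕ) (f : List ℕ → ℝ≥0∞) : ℝ≥0∞ :=
  ∑' w : List ℕ, if w.length = j then f w else 0

lemma genSum_zero (f : List ℕ → ℝ≥0∞) : genSum 0 f = f [] := by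
  rw [genSum, tsum_eq_single []]
  · simp
  · intro w hw
    simp [hw]

lemma genSum_succ (j : ℕ) (f : List ℕ → ℝ≥0∞) :
    genSum (j + 1) f = genSum j fun w => ∑' c, f (c :: w) := by
  have hinj : Function.Injective fun z : List ℕ × ℕ => z.2 :: z.1 := by
    rintro ⟨w, c⟩ ⟨w', c'⟩ h
    simp at h
    simp [h]
  rw [genSum, ← hinj.tsum_eq, ENNReal.tsum_prod', genSum]
  · refine tsum_congr fun w => ?_
    by_cases h : w.length = j <;> simp [h]
  · intro w hw
    cases w with
    | nil => simp at hw
    | cons c w => exact ⟨(w, c), rfl⟩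

lemma genSum_congr {j : ℕ} {f g : List ℕ → ℝ≥0∞} (h : ∀ w, w.length = j → f w = g w) :
    genSum j f = genSum j g := by
  refine tsum_congr fun w => ?_
  split_ifs with hw
  exacts [h w hw, rfl]

lemma genSum_mono {j : ℕ} {f g : List ℕ → ℝ≥0∞} (h : ∀ w, w.length = j → f w ≤ g w) :
    genSum j f ≤ genSum j g := by
  refine ENNReal.tsum_le_tsum fun w => ?_
  split_ifs with hw
  exacts [h w hw, le_rfl]

lemma genSum_mul_right (j : ℕ) (f : List ℕ → ℝ≥0∞) (c : ℝ≥0∞) :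
    genSum j (fun w => f w * c) = genSum j f * c := by
  rw [genSum, genSum, ← ENNReal.tsum_mul_right]
  exact tsum_congr fun w => by split_ifs <;> simp

lemma genSum_add (j : ℕ) (f g : List ℕ → ℝ≥0∞) :
    genSum j (fun w => f w + g w) = genSum j f + genSum j g := by
  rw [genSum, genSum, genSum, ← ENNReal.tsum_add]
  exact tsum_congr fun w => by split_ifs <;> simp

lemma genSum_tsum {α : Type*} (j : ℕ) (f : α → List ℕ → ℝ≥0∞) :
    genSum j (fun w => ∑' x, f x w) = ∑' x, genSum j (f x) := by
  simp only [genSum]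
  rw [ENNReal.tsum_comm]
  exact tsum_congr fun w => by split_ifs <;> simp

lemma genSum_comm (j k : ℕ) (f : List ℕ → List ℕ → ℝ≥0∞) :
    genSum j (fun w => genSum k (f w)) = genSum k fun w' => genSum j fun w => f w w' := by
  have h1 : genSum j (fun w => genSum k (f w))
      = ∑' w, ∑' w', if w.length = j ∧ w'.length = k then f w w' else 0 := by
    simp only [genSum]
    refine tsum_congr fun w => ?_
    by_cases h : w.length = j <;> simp [h]
  have h2 : (genSum k fun w' => genSum j fun w => f w w')
      = ∑' w', ∑' w, if w.length = j ∧ w'.length = k then f w w' else 0 := by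
    simp only [genSum]
    refine tsum_congr fun w => ?_
    by_cases h : w.length = k <;> simp [h]
  rw [h1, h2, ENNReal.tsum_comm]

/-- Two words either are comparable for the suffix order, or branch at a common suffix. -/
lemma exists_branching (w w' : List ℕ) :
    (∃ a, w = a ++ w') ∨ (∃ a, w' = a ++ w) ∨
      ∃ u c c' a a', c ≠ c' ∧ w = a ++ c :: u ∧ w' = a' ++ c' :: u := by
  have key : ∀ x y : List ℕ, (∃ a, x = y ++ a) ∨ (∃ a, y = x ++ a) ∨
      ∃ u c c' a a', c ≠ c' ∧ x = u ++ c :: a ∧ y = u ++ c' :: a' := by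
    intro x
    induction x with
    | nil => exact fun y => Or.inr (Or.inl ⟨y, rfl⟩)
    | cons b x ih =>
      intro y
      cases y with
      | nil => exact Or.inl ⟨b :: x, rfl⟩
      | cons b' y =>
        by_cases h : b = b'
        · subst h
          rcases ih y with ⟨a, rfl⟩ | ⟨a, rfl⟩ | ⟨u, c, c', a, a', hc, rfl, rfl⟩
          · exact Or.inl ⟨a, rfl⟩
          · exact Or.inr (Or.inl ⟨a, rfl⟩)
          · exact Or.inr (Or.inr ⟨b :: u, c, c', a, a', hc, rfl, rfl⟩)
        · exact Or.inr (Or.inr ⟨[], b, b', x, y, h, rfl, rfl⟩)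
  rcases key w.reverse w'.reverse with ⟨a, h⟩ | ⟨a, h⟩ | ⟨u, c, c', a, a', hc, h, h'⟩
  · refine Or.inl ⟨a.reverse, ?_⟩
    rw [← List.reverse_reverse w, h]; simp
  · refine Or.inr (Or.inl ⟨a.reverse, ?_⟩)
    rw [← List.reverse_reverse w', h]; simp
  · refine Or.inr (Or.inr ⟨u.reverse, c, c', a.reverse, a'.reverse, hc, ?_, ?_⟩)
    · rw [← List.reverse_reverse w, h]; simp
    · rw [← List.reverse_reverse w', h']; simp

/-- The sum over pairs of words, organized according to their longest common suffix. -/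
lemma tsum_pair_le (F : List ℕ → List ℕ → ℝ≥0∞) :
    ∑' w, ∑' w', F w w' ≤ ∑' u, (∑' a, F (a ++ u) u + ∑' a, F u (a ++ u)
      + ∑' c, ∑' c', if c ≠ c' then ∑' a, ∑' a', F (a ++ c :: u) (a' ++ c' :: u) else 0) := by
  have h : ∀ w w', F w w' ≤ ∑' u, (∑' a, (if w = a ++ u ∧ w' = u then F w w' else 0)
      + ∑' a, (if w = u ∧ w' = a ++ u then F w w' else 0)
      + ∑' c, ∑' c', if c ≠ c' then
          ∑' a, ∑' a', (if w = a ++ c :: u ∧ w' = a' ++ c' :: u then F w w' else 0) else 0) := by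
    intro w w'
    rcases exists_branching w w' with ⟨a, rfl⟩ | ⟨a, rfl⟩ | ⟨u, c, c', a, a', hc, rfl, rfl⟩
    · refine le_trans ?_ (ENNReal.le_tsum w')
      refine le_trans ?_ (le_add_right (le_add_right (ENNReal.le_tsum a)))
      simp
    · refine le_trans ?_ (ENNReal.le_tsum w)
      refine le_trans ?_ (le_add_right (le_add_left (ENNReal.le_tsum a)))
      simp
    · refine le_trans ?_ (ENNReal.le_tsum u)
      refine le_trans ?_ (le_add_left (ENNReal.le_tsum c))
      refine le_trans ?_ (ENNReal.le_tsum c')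
      rw [if_pos hc]
      refine le_trans ?_ (ENNReal.le_tsum a)
      refine le_trans ?_ (ENNReal.le_tsum a')
      simp
  refine (ENNReal.tsum_le_tsum fun w => ENNReal.tsum_le_tsum fun w' => h w w').trans (le_of_eq ?_)
  have single : ∀ (v v' : List ℕ), ∑' w, ∑' w', (if w = v ∧ w' = v' then F w w' else 0) = F v v' := by
    intro v v'
    rw [tsum_eq_single v, tsum_eq_single v']
    · simp
    · intro w' hw'; simp [hw']
    · intro w hw; simp [hw]
  have swap : ∀ {α : Type} (G : α → List ℕ → List ℕ → ℝ≥0∞),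
      ∑' w, ∑' w', ∑' x, G x w w' = ∑' x, ∑' w, ∑' w', G x w w' := by
    intro α G
    rw [ENNReal.tsum_comm]
    rw [show (∑' w', ∑' w, ∑' x, G x w w') = ∑' w', ∑' x, ∑' w, G x w w' from
      tsum_congr fun w' => ENNReal.tsum_comm, ENNReal.tsum_comm]
    exact tsum_congr fun x => ENNReal.tsum_comm
  rw [swap]
  refine tsum_congr fun u => ?_
  simp only [ENNReal.tsum_add]
  refine congrArg₂ (· + ·) (congrArg₂ (· + ·) ?_ ?_) ?_
  · exact (swap fun a w w' => if w = a ++ u ∧ w' = u then F w w' else 0).trans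
      (tsum_congr fun a => single _ _)
  · exact (swap fun a w w' => if w = u ∧ w' = a ++ u then F w w' else 0).trans
      (tsum_congr fun a => single _ _)
  · refine (swap fun c w w' => ∑' c', if c ≠ c' then ∑' a, ∑' a',
      (if w = a ++ c :: u ∧ w' = a' ++ c' :: u then F w w' else 0) else 0).trans
      (tsum_congr fun c => ?_)
    refine (swap fun c' w w' => if c ≠ c' then ∑' a, ∑' a',
      (if w = a ++ c :: u ∧ w' = a' ++ c' :: u then F w w' else 0) else 0).trans
      (tsum_congr fun c' => ?_)
    split_ifs with hc
    · refine (swap fun a w w' => ∑' a',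
        (if w = a ++ c :: u ∧ w' = a' ++ c' :: u then F w w' else 0)).trans
        (tsum_congr fun a => ?_)
      exact (swap fun a' w w' => if w = a ++ c :: u ∧ w' = a' ++ c' :: u then F w w' else 0).trans
        (tsum_congr fun a' => single _ _)
    · simp

end GenSum

/-! ### Moments of a law on `ℕ` -/

section Moments

/-- The mean of a law on `ℕ`. -/
def pmean (r : PMF ℕ) : ℝ≥0∞ := ∑' k : ℕ, (k : ℝ≥0∞) * r k

/-- The second factorial moment of a law on `ℕ`. -/
def pfact (r : PMF ℕ) : ℝ≥0∞ := ∑' k : ℕ, ((k * (k - 1) : ℕ) : ℝ≥0∞) * r k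

lemma toMeasure_eq_tsum (r : PMF ℕ) (s : Set ℕ) [DecidablePred (· ∈ s)] :
    r.toMeasure s = ∑' k, if k ∈ s then r k else 0 := by
  rw [PMF.toMeasure_apply _ (s.to_countable.measurableSet)]
  refine tsum_congr fun k => ?_
  by_cases h : k ∈ s <;> simp [h]

lemma tsum_ite_eq_card (s : Finset ℕ) (P : ℕ → Prop) [DecidablePred P]
    (h : ∀ c, P c ↔ c ∈ s) (x : ℝ≥0∞) : ∑' c, (if P c then x else 0) = s.card * x := by
  rw [tsum_eq_sum (s := s)]
  · rw [Finset.sum_congr rfl fun c hc => if_pos ((h c).2 hc), Finset.sum_const, nsmul_eq_mul]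
  · intro c hc
    rw [if_neg (fun h' => hc ((h c).1 h'))]

lemma tsum_tail (r : PMF ℕ) : ∑' c, r.toMeasure {k | c < k} = pmean r := by
  have h1 : ∀ c, r.toMeasure {k | c < k} = ∑' k, if c < k then r k else 0 := fun c =>
    toMeasure_eq_tsum r {k | c < k}
  rw [tsum_congr h1, ENNReal.tsum_comm]
  refine tsum_congr fun k => ?_
  rw [tsum_ite_eq_card (Finset.range k) _ (fun c => by simp), Finset.card_range]

lemma tsum_tail_pair (r : PMF ℕ) :
    ∑' c, ∑' c', (if c ≠ c' then r.toMeasure {k | c < k ∧ c' < k} else 0) = pfact r := by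
  have h1 : ∀ c c', (if c ≠ c' then r.toMeasure {k | c < k ∧ c' < k} else 0)
      = ∑' k, if c ≠ c' ∧ c < k ∧ c' < k then r k else 0 := by
    intro c c'
    split_ifs with h
    · rw [toMeasure_eq_tsum r {k | c < k ∧ c' < k}]
      exact tsum_congr fun k => by simp [h]
    · simp [h]
  simp only [h1]
  rw [show (∑' c, ∑' c', ∑' k, if c ≠ c' ∧ c < k ∧ c' < k then r k else 0)
      = ∑' c, ∑' k, ∑' c', if c ≠ c' ∧ c < k ∧ c' < k then r k else 0 from
    tsum_congr fun c => ENNReal.tsum_comm, ENNReal.tsum_comm]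
  refine tsum_congr fun k => ?_
  have h2 : ∀ c, ∑' c', (if c ≠ c' ∧ c < k ∧ c' < k then r k else 0)
      = if c < k then ((k - 1 : ℕ) : ℝ≥0∞) * r k else 0 := by
    intro c
    split_ifs with hc
    · rw [tsum_ite_eq_card ((Finset.range k).erase c) _ (fun c' => by simp [hc, eq_comm]),
        Finset.card_erase_of_mem (Finset.mem_range.2 hc), Finset.card_range]
    · simp [hc]
  rw [tsum_congr h2, tsum_ite_eq_card (Finset.range k) _ (fun c => by simp), Finset.card_range]
  push_cast
  ring

/-! ### Moments of the progeny law and of its size-biased version -/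

variable {p : PMF ℕ} {σ C₃ : ℝ}

lemma tsum_mul_eq_ofReal {f : ℕ → ℝ} (hf : ∀ k, 0 ≤ f k) {a : ℝ}
    (h : HasSum (fun k => f k * (p k).toReal) a) :
    ∑' k, ENNReal.ofReal (f k) * p k = ENNReal.ofReal a := by
  rw [← h.tsum_eq, ENNReal.ofReal_tsum_of_nonneg (fun k => mul_nonneg (hf k) ENNReal.toReal_nonneg)
    h.summable]
  refine tsum_congr fun k => ?_
  rw [ENNReal.ofReal_mul (hf k), ENNReal.ofReal_toReal (p.apply_ne_top k)]

lemma pmean_eq_one (hp : HasSum (fun k : ℕ => (k : ℝ) * (p k).toReal) 1) : pmean p = 1 := by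
  have := tsum_mul_eq_ofReal (p := p) (f := fun k => (k : ℝ)) (fun k => k.cast_nonneg) hp
  simpa [pmean] using this

lemma natCast_mul_pred (k : ℕ) : ((k * (k - 1) : ℕ) : ℝ) = (k : ℝ) * ((k : ℝ) - 1) := by
  cases k <;> simp

lemma pfact_eq (hp : IsProgenyLaw p σ C₃) : pfact p = ENNReal.ofReal (σ ^ 2) := by
  have h : HasSum (fun k : ℕ => ((k * (k - 1) : ℕ) : ℝ) * (p k).toReal) (σ ^ 2) := by
    simpa only [natCast_mul_pred] using hp.second
  have := tsum_mul_eq_ofReal (p := p) (fun k => Nat.cast_nonneg _) h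
  rw [← this, pfact]
  exact tsum_congr fun k => by rw [ENNReal.ofReal_natCast]

lemma sizeBiased_apply (hp : HasSum (fun k : ℕ => (k : ℝ) * (p k).toReal) 1) (k : ℕ) :
    sizeBiased p hp k = ((k + 1 : ℕ) : ℝ≥0∞) * p (k + 1) := rfl

lemma pmean_sizeBiased (hp : IsProgenyLaw p σ C₃) :
    pmean (sizeBiased p hp.mean) = ENNReal.ofReal (σ ^ 2) := by
  rw [← pfact_eq hp, pfact, tsum_eq_zero_add' ENNReal.summable, pmean]
  simp only [Nat.cast_zero, zero_mul, zero_add, Nat.add_sub_cancel]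
  refine tsum_congr fun k => ?_
  rw [sizeBiased_apply]
  push_cast
  ring

lemma pfact_sizeBiased_le (hp : IsProgenyLaw p σ C₃) :
    pfact (sizeBiased p hp.mean) ≤ ENNReal.ofReal C₃ := by
  have h3 : HasSum (fun k : ℕ => (k : ℝ) ^ 3 * (p k).toReal) (∑' k : ℕ, (k : ℝ) ^ 3 * (p k).toReal) :=
    hp.third_summable.hasSum
  have h := tsum_mul_eq_ofReal (p := p) (fun k => by positivity) h3
  refine le_trans ?_ (ENNReal.ofReal_le_ofReal hp.third_le)
  rw [← h, tsum_eq_zero_add' ENNReal.summable, pfact]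
  refine le_add_left (ENNReal.tsum_le_tsum fun k => ?_)
  rw [sizeBiased_apply, ← mul_assoc, ← ENNReal.ofReal_natCast (k * (k - 1)),
    ← ENNReal.ofReal_natCast (k + 1), ← ENNReal.ofReal_mul (by positivity)]
  gcongr
  rw [natCast_mul_pred]
  push_cast
  have : (0 : ℝ) ≤ k := k.cast_nonneg
  nlinarith [mul_nonneg this this, mul_nonneg this (mul_nonneg this this)]

lemma one_le_third (hp : IsProgenyLaw p σ C₃) : 1 ≤ C₃ := by
  refine le_trans ?_ hp.third_le
  rw [← hp.mean.tsum_eq]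
  refine hp.mean.summable.tsum_le_tsum (fun k => ?_) hp.third_summable
  gcongr
  rcases Nat.eq_zero_or_pos k with rfl | hk
  · simp
  · have : (1 : ℝ) ≤ k := by exact_mod_cast hk
    calc (k : ℝ) = k * 1 := by ring
      _ ≤ k * k ^ 2 := by gcongr; exact one_le_pow₀ this
      _ = k ^ 3 := by ring

lemma sq_le_third (hp : IsProgenyLaw p σ C₃) : σ ^ 2 ≤ C₃ := by
  refine le_trans ?_ hp.third_le
  rw [← hp.second.tsum_eq]
  refine hp.second.summable.tsum_le_tsum (fun k => ?_) hp.third_summable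
  gcongr
  rw [← natCast_mul_pred]
  exact_mod_cast (Nat.mul_le_mul_left k (Nat.sub_le k 1)).trans (by
    rcases Nat.eq_zero_or_pos k with rfl | hk
    · simp
    · calc k * k = k * k * 1 := by ring
        _ ≤ k * k * k := Nat.mul_le_mul_left _ hk
        _ = k ^ 3 := by ring)

end Moments

/-! ### Random trees with independent offspring numbers -/

section TreeLaw

/-- The law of independent offspring numbers, with law `ν w` at the vertex `w`. -/
def treeLaw (ν : List ℕ → PMF ℕ) : Measure (List ℕ → ℕ) :=
  Measure.infinitePi fun w => (ν w).toMeasure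

instance (ν : List ℕ → PMF ℕ) : IsProbabilityMeasure (treeLaw ν) := by
  unfold treeLaw; infer_instance

/-- The proper ancestors of a vertex. -/
def properSuffixes (w : List ℕ) : Set (List ℕ) := {v | v <:+ w ∧ v ≠ w}

/-- The descendants of a vertex, including itself. -/
def descendants (v : List ℕ) : Set (List ℕ) := {w | v <:+ w}

lemma mem_properSuffixes_cons {c : ℕ} {v w : List ℕ} :
    v ∈ properSuffixes (c :: w) ↔ v <:+ w := by
  constructor
  · rintro ⟨h, h'⟩
    rcases List.suffix_cons_iff.1 h with rfl | h
    · exact absurd rfl h'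
    · exact h
  · intro h
    refine ⟨h.trans (List.suffix_cons c w), ?_⟩
    rintro rfl
    have := h.length_le
    simp at this

lemma properSuffixes_subset_cons (c : ℕ) (w : List ℕ) :
    properSuffixes w ⊆ properSuffixes (c :: w) := fun _ h => mem_properSuffixes_cons.2 h.1

lemma measurableSet_eval {S : Set (List ℕ)} {u : List ℕ} (hu : u ∈ S) (B : Set ℕ) :
    MeasurableSet[coordSigma S] {ξ : List ℕ → ℕ | ξ u ∈ B} :=
  measurable_coord (X := fun _ : List ℕ => ℕ) hu B.to_countable.measurableSet

lemma inTree_cons (c : ℕ) (w : List ℕ) :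
    {ξ | InTree ξ (c :: w)} = {ξ | InTree ξ w} ∩ {ξ | ξ w ∈ {k | c < k}} := by
  ext ξ
  simp [InTree, and_comm]

lemma measurableSet_inTree (w : List ℕ) :
    MeasurableSet[coordSigma (properSuffixes w)] {ξ | InTree ξ w} := by
  induction w with
  | nil => simp [InTree]
  | cons c w ih =>
    rw [inTree_cons]
    exact MeasurableSet.inter (coordSigma_mono (properSuffixes_subset_cons c w) _ ih)
      (measurableSet_eval (mem_properSuffixes_cons.2 List.suffix_rfl) _)

lemma measurableSet_inTree' (w : List ℕ) : MeasurableSet {ξ | InTree ξ w} :=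
  coordSigma_le _ _ (measurableSet_inTree w)

lemma InTree.of_suffix {ξ : List ℕ → ℕ} {v w : List ℕ} (h : InTree ξ w) (hv : v <:+ w) :
    InTree ξ v := by
  induction w with
  | nil => rwa [List.suffix_nil.1 hv]
  | cons c w ih =>
    rcases List.suffix_cons_iff.1 hv with rfl | hv
    · exact h
    · exact ih h.2 hv

variable (ν : List ℕ → PMF ℕ)

lemma treeLaw_inter {S T : Set (List ℕ)} (hST : Disjoint S T) {A B : Set (List ℕ → ℕ)}
    (hA : MeasurableSet[coordSigma S] A) (hB : MeasurableSet[coordSigma T] B) :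
    treeLaw ν (A ∩ B) = treeLaw ν A * treeLaw ν B :=
  infinitePi_inter hST hA hB

lemma treeLaw_eval (u : List ℕ) (B : Set ℕ) :
    treeLaw ν {ξ | ξ u ∈ B} = (ν u).toMeasure B :=
  infinitePi_eval_preimage u B.to_countable.measurableSet

lemma treeLaw_inter_eval {S : Set (List ℕ)} {A : Set (List ℕ → ℕ)}
    (hA : MeasurableSet[coordSigma S] A) {u : List ℕ} (hu : u ∉ S) (B : Set ℕ) :
    treeLaw ν (A ∩ {ξ | ξ u ∈ B}) = treeLaw ν A * (ν u).toMeasure B := by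
  rw [treeLaw_inter ν (T := {u}) (by simpa using hu) hA
    (measurableSet_eval (Set.mem_singleton u) B), treeLaw_eval]

lemma self_notMem_properSuffixes (w : List ℕ) : w ∉ properSuffixes w := fun h => h.2 rfl

variable {ν}

/-- With mean offspring number `1`, the expected number of descendants of a vertex in each
generation is constant, also on an event determined outside of its subtree. -/
lemma genSum_descendants {v : List ℕ} (hν : ∀ w, v <:+ w → pmean (ν w) = 1) {S : Set (List ℕ)}
    (hS : Disjoint S (descendants v)) {A : Set (List ℕ → ℕ)} (hA : MeasurableSet[coordSigma S] A)
    (hAv : A ⊆ {ξ | InTree ξ v}) (j : ℕ) :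
    genSum j (fun a => treeLaw ν (A ∩ {ξ | InTree ξ (a ++ v)})) = treeLaw ν A := by
  induction j with
  | zero => rw [genSum_zero, List.nil_append, Set.inter_eq_left.2 hAv]
  | succ j ih =>
    rw [genSum_succ, ← ih]
    refine genSum_congr fun a _ => ?_
    have h1 : ∀ c, treeLaw ν (A ∩ {ξ | InTree ξ (c :: a ++ v)})
        = treeLaw ν (A ∩ {ξ | InTree ξ (a ++ v)}) * (ν (a ++ v)).toMeasure {k | c < k} := by
      intro c
      rw [List.cons_append, inTree_cons, ← Set.inter_assoc]
      refine treeLaw_inter_eval ν (S := S ∪ properSuffixes (a ++ v)) ?_ ?_ _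
      · exact MeasurableSet.inter (coordSigma_mono Set.subset_union_left _ hA)
          (coordSigma_mono Set.subset_union_right _ (measurableSet_inTree _))
      · rintro (h | h)
        · exact Set.disjoint_left.1 hS h (List.suffix_append a v)
        · exact self_notMem_properSuffixes _ h
    rw [tsum_congr h1, ENNReal.tsum_mul_left, tsum_tail, hν _ (List.suffix_append a v), mul_one]

lemma properSuffixes_disjoint_descendants (v : List ℕ) :
    Disjoint (properSuffixes v) (descendants v) := by
  refine Set.disjoint_left.2 fun w hw hw' => hw.2 ?_
  exact hw.1.eq_of_length_le hw'.length_le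

/-- A path through one child depends on no offspring number in the subtree of a sibling; this is the
source of independence after a branching. -/
lemma properSuffixes_append_disjoint {u : List ℕ} {c c' : ℕ} (hc : c ≠ c') (a : List ℕ) :
    Disjoint (properSuffixes (a ++ c' :: u)) (descendants (c :: u)) := by
  refine Set.disjoint_left.2 fun w hw hw' => hc ?_
  have h1 : c :: u <:+ a ++ c' :: u := List.IsSuffix.trans hw' hw.1
  have h2 : c' :: u <:+ a ++ c' :: u := List.suffix_append a _
  have h3 := List.suffix_of_suffix_length_le h1 h2 (by simp)
  have h4 := h3.eq_of_length (by simp)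
  simpa using h4

lemma genSum_inTree_succ (hν : ∀ w ≠ [], pmean (ν w) = 1) (j : ℕ) :
    genSum (j + 1) (fun w => treeLaw ν {ξ | InTree ξ w}) = pmean (ν []) := by
  have h1 : ∀ w c, treeLaw ν {ξ | InTree ξ (c :: w)}
      = treeLaw ν {ξ | InTree ξ w} * (ν w).toMeasure {k | c < k} := fun w c => by
    rw [inTree_cons]
    exact treeLaw_inter_eval ν (measurableSet_inTree w) (self_notMem_properSuffixes w) _
  have h2 : ∀ w, ∑' c, treeLaw ν {ξ | InTree ξ (c :: w)}
      = treeLaw ν {ξ | InTree ξ w} * pmean (ν w) := fun w => by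
    rw [tsum_congr (h1 w), ENNReal.tsum_mul_left, tsum_tail]
  induction j with
  | zero =>
    rw [genSum_succ, genSum_zero, h2]
    simp [InTree]
  | succ j ih =>
    rw [genSum_succ, ← ih]
    refine genSum_congr fun w hw => ?_
    rw [h2, hν w (by rintro rfl; simp at hw), mul_one]

/-- The expected number of pairs of distinct siblings at generation `l + 1`. -/
lemma tsum_siblings (u : List ℕ) :
    ∑' c, ∑' c', (if c ≠ c' then
        treeLaw ν ({ξ | InTree ξ (c :: u)} ∩ {ξ | InTree ξ (c' :: u)}) else 0)
      = treeLaw ν {ξ | InTree ξ u} * pfact (ν u) := by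
  rw [← tsum_tail_pair, ← ENNReal.tsum_mul_left]
  refine tsum_congr fun c => ?_
  rw [← ENNReal.tsum_mul_left]
  refine tsum_congr fun c' => ?_
  split_ifs with hc
  · rw [← treeLaw_inter_eval ν (measurableSet_inTree u) (self_notMem_properSuffixes u)]
    congr 1
    ext ξ
    simp only [InTree, Set.mem_inter_iff, Set.mem_ofPred_eq]
    tauto
  · simp

/-- Below two distinct siblings the subtrees are independent and critical, so the two sums over
descendants can be evaluated one after the other, each with total mass preserved. -/
lemma treeLaw_pair_le (hν : ∀ w ≠ [], pmean (ν w) = 1) {u : List ℕ} {c c' : ℕ} (hc : c ≠ c')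
    (j j' : ℕ) :
    genSum j (fun a => genSum j' fun a' =>
      treeLaw ν ({ξ | InTree ξ (a ++ c :: u)} ∩ {ξ | InTree ξ (a' ++ c' :: u)}))
      = treeLaw ν ({ξ | InTree ξ (c :: u)} ∩ {ξ | InTree ξ (c' :: u)}) := by
  have hne : ∀ (c : ℕ) (w : List ℕ), c :: u <:+ w → pmean (ν w) = 1 := by
    rintro c w h
    refine hν w ?_
    rintro rfl
    simp at h
  rw [genSum_comm]
  have h1 : ∀ a', genSum j (fun a =>
      treeLaw ν ({ξ | InTree ξ (a ++ c :: u)} ∩ {ξ | InTree ξ (a' ++ c' :: u)}))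
      = treeLaw ν (({ξ | InTree ξ (c :: u)} ∩ {ξ | InTree ξ (a' ++ c' :: u)})) := by
    intro a'
    rw [← genSum_descendants (hne c) (S := properSuffixes (c :: u) ∪ properSuffixes (a' ++ c' :: u))
      (A := {ξ | InTree ξ (c :: u)} ∩ {ξ | InTree ξ (a' ++ c' :: u)}) ?_ ?_ ?_ j]
    · refine genSum_congr fun a _ => ?_
      congr 1
      ext ξ
      simp only [Set.mem_inter_iff, Set.mem_ofPred_eq]
      constructor
      · rintro ⟨h, h'⟩
        exact ⟨⟨h.of_suffix (List.suffix_append _ _), h'⟩, h⟩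
      · rintro ⟨⟨_, h'⟩, h⟩
        exact ⟨h, h'⟩
    · rw [Set.disjoint_union_left]
      exact ⟨properSuffixes_disjoint_descendants _, properSuffixes_append_disjoint hc _⟩
    · exact MeasurableSet.inter (coordSigma_mono Set.subset_union_left _ (measurableSet_inTree _))
        (coordSigma_mono Set.subset_union_right _ (measurableSet_inTree _))
    · exact Set.inter_subset_left
  rw [genSum_congr fun a' _ => h1 a', ← genSum_descendants (hne c')
    (S := properSuffixes (c' :: u) ∪ properSuffixes (c :: u))
    (A := {ξ | InTree ξ (c :: u)} ∩ {ξ | InTree ξ (c' :: u)}) ?_ ?_ ?_ j']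
  · refine genSum_congr fun a _ => ?_
    congr 1
    ext ξ
    simp only [Set.mem_inter_iff, Set.mem_ofPred_eq]
    constructor
    · rintro ⟨h, h'⟩
      exact ⟨⟨h, h'.of_suffix (List.suffix_append _ _)⟩, h'⟩
    · rintro ⟨⟨h, _⟩, h'⟩
      exact ⟨h, h'⟩
  · rw [Set.disjoint_union_left]
    refine ⟨properSuffixes_disjoint_descendants _, ?_⟩
    simpa using properSuffixes_append_disjoint hc.symm []
  · exact MeasurableSet.inter (coordSigma_mono Set.subset_union_right _ (measurableSet_inTree _))
      (coordSigma_mono Set.subset_union_left _ (measurableSet_inTree _))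
  · exact Set.inter_subset_right

/-- The expected number of pairs of vertices in given generations that branch at `u`. -/
lemma tsum_branching_pairs (hν : ∀ w ≠ [], pmean (ν w) = 1) (u : List ℕ) (j j' : ℕ) :
    ∑' c, ∑' c', (if c ≠ c' then genSum j (fun a => genSum j' fun a' =>
      treeLaw ν ({ξ | InTree ξ (a ++ c :: u)} ∩ {ξ | InTree ξ (a' ++ c' :: u)})) else 0)
      = treeLaw ν {ξ | InTree ξ u} * pfact (ν u) := by
  rw [← tsum_siblings]
  refine tsum_congr fun c => tsum_congr fun c' => ?_
  split_ifs with hc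
  · exact treeLaw_pair_le hν hc j j'
  · rfl

end TreeLaw

/-! ### Survival -/

section Survival

/-- The subtree of `v` reaches generation `j`, counted from `v`. -/
def subSurvives (v : List ℕ) (j : ℕ) : Set (List ℕ → ℕ) :=
  {ξ | ∃ a : List ℕ, a.length = j ∧ InTree (fun b => ξ (b ++ v)) a}

lemma inTree_append {ξ : List ℕ → ℕ} {a v : List ℕ} :
    InTree ξ (a ++ v) ↔ InTree (fun b => ξ (b ++ v)) a ∧ InTree ξ v := by
  induction a with
  | nil => simp [InTree]
  | cons c a ih => simp only [List.cons_append, InTree, ih, and_assoc]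

lemma measurable_shift (v : List ℕ) :
    Measurable[coordSigma (descendants v)] fun (ξ : List ℕ → ℕ) (b : List ℕ) => ξ (b ++ v) := by
  refine @measurable_pi_lambda _ _ _ (coordSigma (descendants v)) _ _ fun b => ?_
  exact measurable_coord (X := fun _ : List ℕ => ℕ)
    (show b ++ v ∈ descendants v from List.suffix_append b v)

lemma measurableSet_survives (j : ℕ) : MeasurableSet (subSurvives [] j) := by
  have : subSurvives [] j = ⋃ a ∈ {a : List ℕ | a.length = j}, {ξ | InTree ξ a} := by
    ext ξ
    simp [subSurvives]
  rw [this]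
  exact MeasurableSet.biUnion (Set.to_countable _) fun a _ => measurableSet_inTree' a

lemma subSurvives_eq_preimage (v : List ℕ) (j : ℕ) :
    subSurvives v j = (fun (ξ : List ℕ → ℕ) (b : List ℕ) => ξ (b ++ v)) ⁻¹' subSurvives [] j := by
  ext ξ
  simp [subSurvives]

lemma measurableSet_subSurvives (v : List ℕ) (j : ℕ) :
    MeasurableSet[coordSigma (descendants v)] (subSurvives v j) := by
  rw [subSurvives_eq_preimage]
  exact measurable_shift v (measurableSet_survives j)

/-- The probability that a Galton-Watson tree reaches generation `j`. -/
def survivalProb (p : PMF ℕ) (j : ℕ) : ℝ≥0∞ := treeLaw (fun _ => p) (subSurvives [] j)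

/-- The offspring numbers below v, relabelled by removing the suffix v, are again i.i.d. with law p.
-/
lemma treeLaw_subSurvives {ν : List ℕ → PMF ℕ} {p : PMF ℕ} {v : List ℕ}
    (hν : ∀ w, v <:+ w → ν w = p) (j : ℕ) :
    treeLaw ν (subSurvives v j) = survivalProb p j := by
  have h := Measure.map_infinitePi_infinitePi_of_inj (P := fun w => (ν w).toMeasure)
    (f := fun b : List ℕ => b ++ v) (List.append_left_injective v)
  have h2 : (fun b : List ℕ => (ν (b ++ v)).toMeasure) = fun _ => p.toMeasure :=
    funext fun b => by rw [hν _ (List.suffix_append b v)]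
  rw [h2] at h
  rw [survivalProb, treeLaw, treeLaw, ← h, subSurvives_eq_preimage,
    Measure.map_apply (by fun_prop) (measurableSet_survives j)]

lemma subSurvives_antitone (v : List ℕ) : Antitone (subSurvives v) := by
  refine antitone_nat_of_succ_le fun j => ?_
  rintro ξ ⟨a, ha, h⟩
  cases a with
  | nil => simp at ha
  | cons c a => exact ⟨a, by simpa using ha, h.2⟩

lemma survivalProb_antitone (p : PMF ℕ) : Antitone (survivalProb p) := fun _ _ h =>
  measure_mono (subSurvives_antitone [] h)

lemma survivalProb_le_one (p : PMF ℕ) (j : ℕ) : survivalProb p j ≤ 1 := prob_le_one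

lemma mem_subSurvives_succ {ξ : List ℕ → ℕ} {j : ℕ} :
    ξ ∈ subSurvives [] (j + 1) ↔ ∃ c < ξ [], ξ ∈ subSurvives [c] j := by
  constructor
  · rintro ⟨a, ha, h⟩
    have hne : a ≠ [] := by rintro rfl; simp at ha
    obtain ⟨a', c, rfl⟩ := (List.eq_nil_or_concat' a).resolve_left hne
    simp only [List.append_nil] at h
    have h2 := inTree_append.1 h
    refine ⟨c, h2.2.1, a', by simpa using ha, h2.1⟩
  · rintro ⟨c, hc, a, ha, h⟩
    refine ⟨a ++ [c], by simp [ha], ?_⟩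
    simp only [List.append_nil]
    exact inTree_append.2 ⟨h, hc, trivial⟩

end Survival

/-! ### The recursion for the survival probabilities -/

section Kolmogorov

variable {p : PMF ℕ} {σ C₃ : ℝ}

/-- Measurability is proved in the same induction because splitting off the next child requires
knowing which coordinates the previous event uses. -/
lemma treeLaw_extinct (p : PMF ℕ) (j k m : ℕ) :
    MeasurableSet[coordSigma {w : List ℕ | w = [] ∨ ∃ c < m, [c] <:+ w}]
      ({ξ : List ℕ → ℕ | ξ [] ∈ ({k} : Set ℕ)} ∩ ⋂ c < m, (subSurvives [c] j)ᶜ) ∧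
    treeLaw (fun _ => p) ({ξ : List ℕ → ℕ | ξ [] ∈ ({k} : Set ℕ)} ∩ ⋂ c < m, (subSurvives [c] j)ᶜ)
      = p k * (1 - survivalProb p j) ^ m := by
  induction m with
  | zero =>
    have h : (⋂ c < 0, (subSurvives [c] j)ᶜ) = (Set.univ : Set (List ℕ → ℕ)) := by simp
    rw [h, Set.inter_univ]
    refine ⟨measurableSet_eval (by simp) _, ?_⟩
    rw [treeLaw_eval, PMF.toMeasure_apply_singleton _ _ (measurableSet_singleton k), pow_zero,
      mul_one]
  | succ m ih =>
    have h : (⋂ c < m + 1, (subSurvives [c] j)ᶜ)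
        = (⋂ c < m, (subSurvives [c] j)ᶜ) ∩ (subSurvives [m] j)ᶜ := by
      ext ξ
      simp only [Set.mem_iInter, Set.mem_inter_iff, Nat.lt_succ_iff_lt_or_eq]
      constructor
      · exact fun h => ⟨fun c hc => h c (Or.inl hc), h m (Or.inr rfl)⟩
      · rintro ⟨h, h'⟩ c (hc | rfl)
        exacts [h c hc, h']
    have hB : MeasurableSet[coordSigma (descendants [m])] (subSurvives [m] j)ᶜ :=
      MeasurableSet.compl (measurableSet_subSurvives [m] j)
    have hBm := measurableSet_subSurvives [m] j
    rw [h, ← Set.inter_assoc]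
    constructor
    · refine MeasurableSet.inter (coordSigma_mono ?_ _ ih.1) (coordSigma_mono ?_ _ hB)
      · rintro w (hw | ⟨c, hc, hw⟩)
        exacts [Or.inl hw, Or.inr ⟨c, by omega, hw⟩]
      · exact fun w hw => Or.inr ⟨m, by omega, hw⟩
    · rw [treeLaw_inter _ _ ih.1 hB, ih.2, prob_compl_eq_one_sub (coordSigma_le _ _ hBm),
        treeLaw_subSurvives (fun _ _ => rfl), pow_succ, mul_assoc]
      refine Set.disjoint_left.2 ?_
      rintro w (rfl | ⟨c, hc, hw⟩) hw'
      · simp [descendants] at hw'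
      · have := (List.suffix_of_suffix_length_le hw hw' (by simp)).eq_of_length (by simp)
        simp only [List.cons.injEq, and_true] at this
        omega

/-- Condition on the number of children of the root: all their subtrees must independently fail to
reach generation j. -/
lemma one_sub_survivalProb_succ (p : PMF ℕ) (j : ℕ) :
    1 - survivalProb p (j + 1) = ∑' k, p k * (1 - survivalProb p j) ^ k := by
  rw [survivalProb, ← prob_compl_eq_one_sub (measurableSet_survives (j + 1))]
  have h1 : (subSurvives [] (j + 1))ᶜ
      = ⋃ k, ({ξ : List ℕ → ℕ | ξ [] ∈ ({k} : Set ℕ)} ∩ ⋂ c < k, (subSurvives [c] j)ᶜ) := by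
    ext ξ
    rw [Set.mem_compl_iff, mem_subSurvives_succ]
    simp only [Set.mem_iUnion, Set.mem_inter_iff, Set.mem_ofPred_eq, Set.mem_singleton_iff,
      Set.mem_iInter, Set.mem_compl_iff]
    push Not
    constructor
    · exact fun h => ⟨ξ [], rfl, h⟩
    · rintro ⟨k, rfl, h⟩
      exact h
  rw [h1, measure_iUnion]
  · exact tsum_congr fun k => (treeLaw_extinct p j k k).2
  · intro k l hkl
    refine Set.disjoint_left.2 fun ξ hk hl => hkl ?_
    exact (hk.1 : ξ [] = k).symm.trans hl.1
  · exact fun k => coordSigma_le _ _ (treeLaw_extinct p j k k).1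

/-- The decrease of the survival probability from one generation to the next. -/
def survivalGap (p : PMF ℕ) (x : ℝ) : ℝ := ∑' k : ℕ, (p k).toReal * ((1 - x) ^ k - 1 + k * x)

lemma summable_toReal (p : PMF ℕ) : Summable fun k => (p k).toReal :=
  ENNReal.summable_toReal p.tsum_coe_ne_top

lemma tsum_toReal (p : PMF ℕ) : ∑' k, (p k).toReal = 1 := by
  rw [← ENNReal.tsum_toReal_eq p.apply_ne_top, p.tsum_coe, ENNReal.toReal_one]

lemma summable_pow {x : ℝ} (h0 : 0 ≤ x) (h1 : x ≤ 1) (p : PMF ℕ) :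
    Summable fun k => (p k).toReal * (1 - x) ^ k :=
  (summable_toReal p).of_nonneg_of_le
    (fun k => mul_nonneg ENNReal.toReal_nonneg (pow_nonneg (by linarith) k))
    (fun k => mul_le_of_le_one_right ENNReal.toReal_nonneg (pow_le_one₀ (by linarith) (by linarith)))

lemma summable_gap {x : ℝ} (h0 : 0 ≤ x) (h1 : x ≤ 1)
    (hp : HasSum (fun k : ℕ => (k : ℝ) * (p k).toReal) 1) :
    Summable fun k : ℕ => (p k).toReal * ((1 - x) ^ k - 1 + k * x) := by
  have := ((summable_pow h0 h1 p).sub (summable_toReal p)).add (hp.summable.mul_right x)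
  refine this.congr fun k => by ring

lemma survivalProb_toReal_succ (hp : HasSum (fun k : ℕ => (k : ℝ) * (p k).toReal) 1) (j : ℕ) :
    (survivalProb p (j + 1)).toReal
      = (survivalProb p j).toReal - survivalGap p (survivalProb p j).toReal := by
  set x := (survivalProb p j).toReal with hx
  have hx0 : 0 ≤ x := ENNReal.toReal_nonneg
  have hx1 : x ≤ 1 := ENNReal.toReal_le_of_le_ofReal zero_le_one
    (by simpa using survivalProb_le_one p j)
  have h1 := congrArg ENNReal.toReal (one_sub_survivalProb_succ p j)
  rw [ENNReal.toReal_sub_of_le (survivalProb_le_one p _) ENNReal.one_ne_top,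
    ENNReal.tsum_toReal_eq (fun k => ENNReal.mul_ne_top (p.apply_ne_top k)
      (ENNReal.pow_ne_top (by finiteness)))] at h1
  simp only [ENNReal.toReal_mul, ENNReal.toReal_pow,
    ENNReal.toReal_sub_of_le (survivalProb_le_one p j) ENNReal.one_ne_top, ENNReal.toReal_one] at h1
  rw [← hx] at h1
  have h2 : survivalGap p x = (∑' k, (p k).toReal * (1 - x) ^ k) - 1 + x := by
    have e1 : ∀ k : ℕ, (p k).toReal * ((1 - x) ^ k - 1 + k * x)
        = ((p k).toReal * (1 - x) ^ k - (p k).toReal) + (k : ℝ) * (p k).toReal * x := fun k => by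
      ring
    rw [survivalGap, tsum_congr e1,
      ((summable_pow hx0 hx1 p).sub (summable_toReal p)).tsum_add (hp.summable.mul_right x),
      (summable_pow hx0 hx1 p).tsum_sub (summable_toReal p), tsum_toReal, tsum_mul_right,
      hp.tsum_eq, one_mul]
  rw [h2]
  linarith

lemma gap_mono {x y : ℝ} (hx : 0 ≤ x) (hxy : x ≤ y) (hy : y ≤ 1) (k : ℕ) :
    (1 - x) ^ k - 1 + k * x ≤ (1 - y) ^ k - 1 + k * y := by
  induction k with
  | zero => simp
  | succ k ih =>
    have h1 : (1 - x) ^ k ≤ 1 := pow_le_one₀ (by linarith) (by linarith)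
    have h2 : (1 - y) ^ k ≤ (1 - x) ^ k := pow_le_pow_left₀ (by linarith) (by linarith) k
    have h3 : 0 ≤ (1 - y) ^ k := pow_nonneg (by linarith) k
    rw [pow_succ, pow_succ]
    push_cast
    nlinarith

/-- The third order Bonferroni inequality for (1-x)^k; the induction step multiplies by 1 - x and
drops a nonnegative term in x⁴. -/
lemma gap_lower {x : ℝ} (hx : 0 ≤ x) (hx1 : x ≤ 1) (k : ℕ) :
    (k : ℝ) * (k - 1) / 2 * x ^ 2 - (k : ℝ) * (k - 1) * (k - 2) / 6 * x ^ 3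
      ≤ (1 - x) ^ k - 1 + k * x := by
  induction k with
  | zero => simp
  | succ k ih =>
    have h0 : (0 : ℝ) ≤ (k : ℝ) * (k - 1) * (k - 2) := by
      rcases Nat.lt_or_ge k 2 with h | h
      · interval_cases k <;> simp
      · have : (2 : ℝ) ≤ k := by exact_mod_cast h
        have h1 : (0 : ℝ) ≤ k - 1 := by linarith
        have h2 : (0 : ℝ) ≤ k - 2 := by linarith
        positivity
    have h1 : 0 ≤ (k : ℝ) * (k - 1) * (k - 2) / 6 * x ^ 4 := by positivity
    have h2 := mul_le_mul_of_nonneg_right ih (show 0 ≤ 1 - x by linarith)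
    rw [pow_succ (1 - x) k]
    push_cast
    linarith

lemma survivalGap_mono (hp : HasSum (fun k : ℕ => (k : ℝ) * (p k).toReal) 1) {x y : ℝ}
    (hx : 0 ≤ x) (hxy : x ≤ y) (hy : y ≤ 1) : survivalGap p x ≤ survivalGap p y :=
  (summable_gap hx (hxy.trans hy) hp).tsum_le_tsum
    (fun k => mul_le_mul_of_nonneg_left (gap_mono hx hxy hy k) ENNReal.toReal_nonneg)
    (summable_gap (hx.trans hxy) hy hp)

/-- Second order term σ²x²/2 minus at most C₃x³/6; for C₃x ≤ σ² this leaves 1/2 - 1/6 = 1/3. -/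
lemma survivalGap_lower (hp : IsProgenyLaw p σ C₃) {x : ℝ} (hx : 0 ≤ x) (hx1 : x ≤ 1)
    (hxσ : C₃ * x ≤ σ ^ 2) : σ ^ 2 / 3 * x ^ 2 ≤ survivalGap p x := by
  have hs1 := hp.second.mul_right (x ^ 2 / 2)
  have hs2 := hp.third_summable.hasSum.mul_right (x ^ 3 / 6)
  have h1 := hs1.sub hs2
  have h2 : σ ^ 2 * (x ^ 2 / 2) - (∑' k : ℕ, (k : ℝ) ^ 3 * (p k).toReal) * (x ^ 3 / 6)
      ≤ survivalGap p x := by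
    rw [← h1.tsum_eq]
    refine h1.summable.tsum_le_tsum (fun k => ?_) (summable_gap hx hx1 hp.mean)
    have h3 := mul_le_mul_of_nonneg_left (gap_lower hx hx1 k)
      (ENNReal.toReal_nonneg : 0 ≤ (p k).toReal)
    have h4 : (k : ℝ) * (k - 1) * (k - 2) ≤ (k : ℝ) ^ 3 := by
      have : (0 : ℝ) ≤ k := k.cast_nonneg
      rcases Nat.eq_zero_or_pos k with rfl | hk
      · simp
      · have : (1 : ℝ) ≤ k := by exact_mod_cast hk
        nlinarith
    have h5 : (p k).toReal * ((k : ℝ) * (k - 1) * (k - 2) * x ^ 3) ≤ (p k).toReal * (k ^ 3 * x ^ 3) := by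
      gcongr
    linarith
  have h6 : (∑' k : ℕ, (k : ℝ) ^ 3 * (p k).toReal) * (x ^ 3 / 6) ≤ C₃ * (x ^ 3 / 6) := by
    gcongr; exact hp.third_le
  have h7 : C₃ * x * (x ^ 2 / 6) ≤ σ ^ 2 * (x ^ 2 / 6) := by gcongr
  nlinarith

/-- The upper bound in Kolmogorov's estimate for the survival probability, uniformly in the
progeny distribution. -/
lemma exists_survivalProb_le (σ C₃ : ℝ) (hσ : 0 < σ) :
    ∃ j₁ : ℕ, ∀ p : PMF ℕ, IsProgenyLaw p σ C₃ → ∀ i : ℕ,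
      (survivalProb p (j₁ + i)).toReal * (σ ^ 2 * i) ≤ 3 := by
  -- Below ε the quadratic bound for the gap applies. Above ε, monotonicity makes the gap at least
  -- δ, so the survival probability can stay there for at most about 1/δ generations, a number
  -- depending only on σ and C₃.
  set ε := σ ^ 2 / C₃ with hε
  set δ := σ ^ 2 / 3 * ε ^ 2 with hδ
  refine ⟨⌈1 / δ⌉₊, fun p hp i => ?_⟩
  have hC : 0 < C₃ := lt_of_lt_of_le one_pos (one_le_third hp)
  have hε0 : 0 < ε := by positivity
  have hε1 : ε ≤ 1 := (div_le_one hC).2 (sq_le_third hp)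
  have hδ0 : 0 < δ := by positivity
  set θ : ℕ → ℝ := fun j => (survivalProb p j).toReal with hθ
  have hθ0 : ∀ j, 0 ≤ θ j := fun j => ENNReal.toReal_nonneg
  have hθ1 : ∀ j, θ j ≤ 1 := fun j => ENNReal.toReal_le_of_le_ofReal zero_le_one
    (by simpa using survivalProb_le_one p j)
  have hrec : ∀ j, θ (j + 1) = θ j - survivalGap p (θ j) := survivalProb_toReal_succ hp.mean
  have hanti : Antitone θ := fun a b h => ENNReal.toReal_mono
    (ne_top_of_le_ne_top ENNReal.one_ne_top (survivalProb_le_one p a)) (survivalProb_antitone p h)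
  have hsmall : θ ⌈1 / δ⌉₊ ≤ ε := by
    by_contra! hgt
    have h1 : ∀ j ≤ ⌈1 / δ⌉₊, θ j ≤ 1 - j * δ := by
      intro j
      induction j with
      | zero => intro _; simpa using hθ1 0
      | succ j ih =>
        intro hj
        have h2 := ih (by omega)
        have h3 : ε ≤ θ j := hgt.le.trans (hanti (by omega))
        have h4 := (survivalGap_lower hp hε0.le hε1 (by rw [hε]; field_simp; rfl)).trans
          (survivalGap_mono hp.mean hε0.le h3 (hθ1 j))
        rw [hrec]
        push_cast
        linarith
    have h2 := h1 _ le_rfl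
    have h3 : 1 ≤ (⌈1 / δ⌉₊ : ℝ) * δ := by
      rw [← div_le_iff₀ hδ0]; exact Nat.le_ceil _
    linarith
  -- Discrete form of θ' ≤ -σ²θ²/3. With y = σ²θ/3 one has to pass from y·i ≤ 1 to y(1-y)(i+1) ≤ 1,
  -- which is clear if y(i+1) ≤ 1; otherwise y²(i+1) ≥ y.
  have hmain : ∀ i : ℕ, θ (⌈1 / δ⌉₊ + i) * (σ ^ 2 / 3 * i) ≤ 1 := by
    intro i
    induction i with
    | zero => simp
    | succ i ih =>
      have h1 : θ (⌈1 / δ⌉₊ + i) ≤ ε := (hanti (Nat.le_add_right _ _)).trans hsmall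
      set t := θ (⌈1 / δ⌉₊ + i) with ht
      have ht0 : 0 ≤ t := hθ0 _
      have h2 := survivalGap_lower hp ht0 (h1.trans hε1) (by
        calc C₃ * t ≤ C₃ * ε := by gcongr
          _ = σ ^ 2 := by rw [hε]; field_simp)
      have h3 : θ (⌈1 / δ⌉₊ + (i + 1)) ≤ t - σ ^ 2 / 3 * t ^ 2 := by
        rw [← add_assoc, hrec]; linarith
      set y := σ ^ 2 / 3 * t with hy
      have hy0 : 0 ≤ y := by positivity
      have hyi : y * i ≤ 1 := by rw [hy]; linarith
      have h4 : θ (⌈1 / δ⌉₊ + (i + 1)) * (σ ^ 2 / 3 * (i + 1 : ℕ)) ≤ y * (1 - y) * (i + 1) := by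
        calc _ ≤ (t - σ ^ 2 / 3 * t ^ 2) * (σ ^ 2 / 3 * (i + 1 : ℕ)) := by gcongr
          _ = _ := by rw [hy]; push_cast; ring
      refine h4.trans ?_
      have hi : (0 : ℝ) ≤ i := i.cast_nonneg
      rcases le_total (y * (i + 1)) 1 with h5 | h5
      · nlinarith
      · nlinarith
  have := hmain i
  linarith

end Kolmogorov

/-! ### The trees hanging off the backbone -/

section Hanging

lemma tsum_eq_tsum_genSum (h : List ℕ → ℝ≥0∞) : ∑' w, h w = ∑' l, genSum l h := by
  simp only [genSum]
  rw [ENNReal.tsum_comm]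
  refine tsum_congr fun w => ?_
  rw [tsum_eq_single w.length]
  · simp
  · intro l hl
    rw [if_neg (Ne.symm hl)]

variable {p : PMF ℕ} {σ C₃ : ℝ}

/-- The offspring laws in a tree hanging off the backbone. -/
def hangingFamily (p : PMF ℕ) (hp : HasSum (fun k : ℕ => (k : ℝ) * (p k).toReal) 1) :
    List ℕ → PMF ℕ := fun w => if w = [] then sizeBiased p hp else p

lemma hangingTreeLaw_eq (hp : HasSum (fun k : ℕ => (k : ℝ) * (p k).toReal) 1) :
    hangingTreeLaw p hp = treeLaw (hangingFamily p hp) := by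
  unfold hangingTreeLaw treeLaw hangingFamily
  congr 1
  funext w
  split_ifs <;> rfl

lemma hangingFamily_nil (hp : HasSum (fun k : ℕ => (k : ℝ) * (p k).toReal) 1) :
    hangingFamily p hp [] = sizeBiased p hp := if_pos rfl

lemma hangingFamily_of_ne (hp : HasSum (fun k : ℕ => (k : ℝ) * (p k).toReal) 1) {w : List ℕ}
    (hw : w ≠ []) : hangingFamily p hp w = p := if_neg hw

lemma pmean_hangingFamily (hp : HasSum (fun k : ℕ => (k : ℝ) * (p k).toReal) 1) :
    ∀ w ≠ [], pmean (hangingFamily p hp w) = 1 := fun _ hw => by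
  rw [hangingFamily_of_ne hp hw, pmean_eq_one hp]

instance (hp : HasSum (fun k : ℕ => (k : ℝ) * (p k).toReal) 1) :
    IsProbabilityMeasure (hangingTreeLaw p hp) := by
  rw [hangingTreeLaw_eq]; infer_instance

lemma genSum_hanging (hp : IsProgenyLaw p σ C₃) (k : ℕ) :
    genSum (k + 1) (fun w => hangingTreeLaw p hp.mean {ξ | InTree ξ w}) = ENNReal.ofReal (σ ^ 2) := by
  rw [hangingTreeLaw_eq, genSum_inTree_succ (pmean_hangingFamily hp.mean), hangingFamily_nil,
    pmean_sizeBiased hp]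

/-- The expected number of ordered pairs of children of vertices in generation `l`. -/
lemma genSum_pfact_le (hp : IsProgenyLaw p σ C₃) (l : ℕ) :
    genSum l (fun u => hangingTreeLaw p hp.mean {ξ | InTree ξ u} * pfact (hangingFamily p hp.mean u))
      ≤ ENNReal.ofReal (if l = 0 then C₃ else σ ^ 4) := by
  cases l with
  | zero =>
    rw [genSum_zero, hangingFamily_nil, if_pos rfl]
    simp only [InTree, Set.ofPred_true, measure_univ, one_mul]
    exact pfact_sizeBiased_le hp
  | succ l =>
    rw [if_neg (Nat.succ_ne_zero l)]
    refine le_of_eq ?_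
    rw [genSum_congr (g := fun u => hangingTreeLaw p hp.mean {ξ | InTree ξ u} *
      ENNReal.ofReal (σ ^ 2)), genSum_mul_right, genSum_hanging hp,
      ← ENNReal.ofReal_mul (sq_nonneg σ)]
    · congr 1; ring
    · intro u hu
      rw [hangingFamily_of_ne hp.mean (by rintro rfl; simp at hu), pfact_eq hp]

/-! ### Extinction times of hanging trees and generation sizes -/

lemma compl_diesOutBy (t : ℕ) : (diesOutBy t)ᶜ = subSurvives [] t := by
  ext ξ
  simp only [diesOutBy, Set.mem_compl_iff, Set.mem_ofPred_eq, subSurvives, List.append_nil]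
  push Not
  constructor
  · rintro ⟨w, hw, ht⟩
    exact ⟨w.drop (w.length - t), by simp; omega, hw.of_suffix (List.drop_suffix _ _)⟩
  · rintro ⟨a, ha, h⟩
    exact ⟨a, h, ha.ge⟩

lemma measurableSet_diesOutBy (t : ℕ) : MeasurableSet (diesOutBy t) := by
  rw [← MeasurableSet.compl_iff, compl_diesOutBy]
  exact measurableSet_survives t

/-- Union bound over the children of the root, whose mean number is σ². -/
lemma hanging_survives_le (hp : IsProgenyLaw p σ C₃) (t : ℕ) :
    hangingTreeLaw p hp.mean (subSurvives [] (t + 1))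
      ≤ ENNReal.ofReal (σ ^ 2) * survivalProb p t := by
  have h1 : subSurvives [] (t + 1) ⊆ ⋃ c : ℕ, (subSurvives [c] t ∩ {ξ | ξ [] ∈ {k | c < k}}) := by
    intro ξ hξ
    obtain ⟨c, hc, h⟩ := mem_subSurvives_succ.1 hξ
    exact Set.mem_iUnion.2 ⟨c, h, hc⟩
  refine (measure_mono h1).trans ((measure_iUnion_le _).trans (le_of_eq ?_))
  rw [hangingTreeLaw_eq]
  have h2 : ∀ c, treeLaw (hangingFamily p hp.mean)
      (subSurvives [c] t ∩ {ξ | ξ [] ∈ {k | c < k}})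
      = (hangingFamily p hp.mean []).toMeasure {k | c < k} * survivalProb p t := by
    intro c
    rw [treeLaw_inter_eval _ (measurableSet_subSurvives [c] t) (by simp [descendants]),
      treeLaw_subSurvives (p := p), mul_comm]
    rintro w hw
    exact hangingFamily_of_ne hp.mean (by rintro rfl; simp at hw)
  rw [tsum_congr h2, ENNReal.tsum_mul_right, tsum_tail, hangingFamily_nil, pmean_sizeBiased hp]

/-- A surviving line either passes through w, or leaves the path to w at some u through a sibling c'
of the next vertex on that path. In each case some vertex of generation at most k + 1 still has at
least t - (k+1) generations below it. -/
lemma inTree_inter_survives_subset {w : List ℕ} {k t : ℕ} (hw : w.length = k + 1) (ht : k + 1 ≤ t) :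
    {ξ | InTree ξ w} ∩ subSurvives [] t ⊆
      ({ξ | InTree ξ w} ∩ subSurvives w (t - (k + 1))) ∪
      ⋃ u, ⋃ c : ℕ, ⋃ c' : ℕ, ⋃ a, {ξ | (c ≠ c' ∧ w = a ++ c :: u) ∧
        ξ ∈ ({ξ | InTree ξ (a ++ c :: u)} ∩ {ξ | InTree ξ (c' :: u)})
          ∩ subSurvives (c' :: u) (t - (k + 1))} := by
  rintro ξ ⟨hξ, s, hs, h⟩
  simp only [List.append_nil] at h
  rcases exists_branching w s with ⟨a, rfl⟩ | ⟨a, rfl⟩ | ⟨u, c, c', a, a', hc, rfl, rfl⟩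
  · refine Or.inl ⟨hξ, [], ?_, trivial⟩
    rw [List.length_append] at hw
    simp
    omega
  · refine Or.inl ⟨hξ, a, ?_, (inTree_append.1 h).1⟩
    rw [List.length_append] at hs
    omega
  · refine Or.inr ?_
    simp only [Set.mem_iUnion]
    refine ⟨u, c, c', a, ⟨hc, rfl⟩, ⟨hξ, (inTree_append.1 h).2⟩, ?_⟩
    refine subSurvives_antitone (c' :: u) ?_ ⟨a', rfl, (inTree_append.1 h).1⟩
    simp only [List.length_append, List.length_cons] at hw hs
    omega

lemma treeLaw_inter_subSurvives {ν : List ℕ → PMF ℕ} {v : List ℕ} (hν : ∀ w, v <:+ w → ν w = p)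
    {S : Set (List ℕ)} (hS : Disjoint S (descendants v)) {A : Set (List ℕ → ℕ)}
    (hA : MeasurableSet[coordSigma S] A) (j : ℕ) :
    treeLaw ν (A ∩ subSurvives v j) = treeLaw ν A * survivalProb p j := by
  rw [treeLaw_inter ν hS hA (measurableSet_subSurvives v j), treeLaw_subSurvives hν]

/-- The expected number of vertices in generation `k + 1`, on the event of survival. -/
lemma genSum_inter_survives_le (hp : IsProgenyLaw p σ C₃) {k t : ℕ} (ht : k + 1 ≤ t) :
    genSum (k + 1) (fun w => hangingTreeLaw p hp.mean ({ξ | InTree ξ w} ∩ subSurvives [] t))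
      ≤ ENNReal.ofReal (σ ^ 2 + C₃ + k * σ ^ 4) * survivalProb p (t - (k + 1)) := by
  set s := t - (k + 1) with hs
  set ν := hangingFamily p hp.mean with hν
  rw [hangingTreeLaw_eq]
  have hνp : ∀ v : List ℕ, v ≠ [] → ∀ w, v <:+ w → ν w = p := by
    rintro v hv w hw
    refine hangingFamily_of_ne hp.mean ?_
    rintro rfl
    exact hv (List.suffix_nil.1 hw)
  set G : List ℕ → ℕ → ℕ → List ℕ → ℝ≥0∞ := fun u c c' a =>
    treeLaw ν ({ξ | InTree ξ (a ++ c :: u)} ∩ {ξ | InTree ξ (c' :: u)}) with hG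
  have h1 : ∀ w, w.length = k + 1 → treeLaw ν ({ξ | InTree ξ w} ∩ subSurvives [] t)
      ≤ treeLaw ν {ξ | InTree ξ w} * survivalProb p s
        + ∑' u, ∑' c, ∑' c', ∑' a, (if c ≠ c' ∧ w = a ++ c :: u then G u c c' a else 0)
          * survivalProb p s := by
    intro w hw
    refine (measure_mono (inTree_inter_survives_subset hw ht)).trans
      ((measure_union_le _ _).trans (add_le_add ?_ ?_))
    · refine le_of_eq (treeLaw_inter_subSurvives (hνp w ?_)
        (properSuffixes_disjoint_descendants w) (measurableSet_inTree w) s)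
      rintro rfl
      simp at hw
    · refine (measure_iUnion_le _).trans (ENNReal.tsum_le_tsum fun u => ?_)
      refine (measure_iUnion_le _).trans (ENNReal.tsum_le_tsum fun c => ?_)
      refine (measure_iUnion_le _).trans (ENNReal.tsum_le_tsum fun c' => ?_)
      refine (measure_iUnion_le _).trans (ENNReal.tsum_le_tsum fun a => ?_)
      by_cases h : c ≠ c' ∧ w = a ++ c :: u
      · rw [if_pos h, hG]
        refine le_of_eq ?_
        simp only [h, true_and, ne_eq, not_false_eq_true]
        refine treeLaw_inter_subSurvives (hνp (c' :: u) (by simp))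
          (S := properSuffixes (a ++ c :: u) ∪ properSuffixes (c' :: u)) ?_ ?_ s
        · rw [Set.disjoint_union_left]
          exact ⟨properSuffixes_append_disjoint h.1.symm a, properSuffixes_disjoint_descendants _⟩
        · exact MeasurableSet.inter (coordSigma_mono Set.subset_union_left _ (measurableSet_inTree _))
            (coordSigma_mono Set.subset_union_right _ (measurableSet_inTree _))
      · simp [h]
  refine (genSum_mono h1).trans ?_
  rw [genSum_add, genSum_mul_right, ← hangingTreeLaw_eq, genSum_hanging hp]
  simp only [genSum_tsum, genSum_mul_right]
  -- The data a, c, u determine w, so the sum over w disappears; what remains are branching pairs at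
  -- u with one partner in the first generation below u.
  have h2 : ∀ u, (∑' c, ∑' c', ∑' a, genSum (k + 1)
      (fun w => if c ≠ c' ∧ w = a ++ c :: u then G u c c' a else 0) * survivalProb p s)
      = (if u.length ≤ k then treeLaw ν {ξ | InTree ξ u} * pfact (ν u) else 0)
        * survivalProb p s := by
    intro u
    simp only [ENNReal.tsum_mul_right]
    congr 1
    have h3 : ∀ c c' a, genSum (k + 1) (fun w => if c ≠ c' ∧ w = a ++ c :: u then G u c c' a else 0)
        = if c ≠ c' then (if a.length + u.length = k then G u c c' a else 0) else 0 := by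
      intro c c' a
      rw [genSum, tsum_eq_single (a ++ c :: u)]
      · by_cases hc : c = c'
        · simp [hc]
        · simp only [hc, ne_eq, not_false_eq_true, and_true, if_true, List.length_append,
            List.length_cons]
          congr 1
          rw [← add_assoc, Nat.add_right_cancel_iff]
      · intro w hw
        simp [hw]
    simp only [h3]
    split_ifs with hu
    · rw [← tsum_branching_pairs (pmean_hangingFamily hp.mean) u (k - u.length) 0]
      refine tsum_congr fun c => tsum_congr fun c' => ?_
      split_ifs with hc
      · simp only [genSum_zero]
        refine tsum_congr fun a => ?_
        congr 1
        rw [eq_iff_iff]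
        omega
      · simp
    · simp only [ENNReal.tsum_eq_zero]
      intro c c' a
      split_ifs <;> first | rfl | omega
  rw [tsum_congr h2, ENNReal.tsum_mul_right, ← add_mul]
  gcongr
  have h4 : ∑' u, (if u.length ≤ k then treeLaw ν {ξ | InTree ξ u} * pfact (ν u) else 0)
      ≤ ENNReal.ofReal (C₃ + k * σ ^ 4) := by
    rw [tsum_eq_tsum_genSum, tsum_eq_sum (s := Finset.range (k + 1))]
    · have hC : 0 ≤ C₃ := zero_le_one.trans (one_le_third hp)
      calc ∑ l ∈ Finset.range (k + 1),
            genSum l (fun u => if u.length ≤ k then treeLaw ν {ξ | InTree ξ u} * pfact (ν u) else 0)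
          ≤ ∑ l ∈ Finset.range (k + 1), ENNReal.ofReal (if l = 0 then C₃ else σ ^ 4) := by
            refine Finset.sum_le_sum fun l hl => ?_
            refine le_trans (genSum_mono fun u _ => ?_) (genSum_pfact_le hp l)
            rw [hangingTreeLaw_eq]
            split_ifs
            · exact le_rfl
            · exact zero_le
        _ = ENNReal.ofReal (C₃ + k * σ ^ 4) := by
            rw [← ENNReal.ofReal_sum_of_nonneg (fun l _ => by split_ifs <;> positivity),
              Finset.sum_range_succ']
            simp
            congr 1; ring
    · intro l hl
      rw [Finset.mem_range, not_lt] at hl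
      rw [genSum_congr (g := fun _ => 0)]
      · simp [genSum]
      · intro u hu
        rw [if_neg (by omega)]
  have hC : 0 ≤ C₃ := zero_le_one.trans (one_le_third hp)
  calc ENNReal.ofReal (σ ^ 2) + _ ≤ ENNReal.ofReal (σ ^ 2) + ENNReal.ofReal (C₃ + k * σ ^ 4) := by
        gcongr
    _ = _ := by
        rw [← ENNReal.ofReal_add (by positivity) (by positivity)]
        congr 1; ring

/-- Hanging trees are likely to die out early. -/
lemma exists_diesOutBy_ge (σ C₃ : ℝ) (hσ : 0 < σ) :
    ∃ t₀ : ℕ, ∀ (p : PMF ℕ) (hp : IsProgenyLaw p σ C₃), ∀ t ≥ t₀,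
      (1 / 2 : ℝ≥0∞) ≤ hangingTreeLaw p hp.mean (diesOutBy t) := by
  obtain ⟨j₁, h⟩ := exists_survivalProb_le σ C₃ hσ
  -- One generation is spent on the root; the remaining i ≥ 6 give σ²θ ≤ 3/i ≤ 1/2.
  refine ⟨j₁ + 7, fun p hp t ht => ?_⟩
  obtain ⟨i, rfl⟩ : ∃ i, t = j₁ + i + 1 := ⟨t - j₁ - 1, by omega⟩
  have hi : 6 ≤ i := by omega
  have h1 := hanging_survives_le hp (j₁ + i)
  have h2 := h p hp i
  have hi' : (6 : ℝ) ≤ i := by exact_mod_cast hi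
  have h3 : ENNReal.ofReal (σ ^ 2) * survivalProb p (j₁ + i) ≤ 1 / 2 := by
    rw [← ENNReal.ofReal_toReal (ne_top_of_le_ne_top ENNReal.one_ne_top
      (survivalProb_le_one p (j₁ + i))), ← ENNReal.ofReal_mul (by positivity)]
    have : (1 / 2 : ℝ≥0∞) = ENNReal.ofReal (1 / 2) := by
      rw [ENNReal.ofReal_div_of_pos (by norm_num)]; simp
    rw [this]
    refine ENNReal.ofReal_le_ofReal ?_
    have h0 : 0 ≤ σ ^ 2 * (survivalProb p (j₁ + i)).toReal := by positivity
    nlinarith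
  have h4 : hangingTreeLaw p hp.mean (diesOutBy (j₁ + i + 1))ᶜ ≤ 1 / 2 := by
    rw [compl_diesOutBy]
    exact h1.trans h3
  rw [prob_compl_eq_one_sub (measurableSet_diesOutBy _), tsub_le_iff_left] at h4
  have h5 : (1 / 2 : ℝ≥0∞) + 1 / 2 ≤ hangingTreeLaw p hp.mean (diesOutBy (j₁ + i + 1)) + 1 / 2 := by
    rwa [ENNReal.add_halves]
  exact (ENNReal.add_le_add_iff_right (by finiteness)).1 h5

/-- The expected number of vertices of a hanging tree in generation `k + 1`, on the event that the
tree dies out at a time which is large compared with `k`. -/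
lemma exists_genSum_diesOutBy_ge (σ C₃ : ℝ) (hσ : 0 < σ) :
    ∃ s₀ : ℕ, ∀ (p : PMF ℕ) (hp : IsProgenyLaw p σ C₃), ∀ k s : ℕ, s₀ ≤ s → 9 * k ≤ 2 * s →
      ENNReal.ofReal (σ ^ 2 / 4) ≤ genSum (k + 1) fun w =>
        hangingTreeLaw p hp.mean ({ξ | InTree ξ w} ∩ diesOutBy (k + 1 + s)) := by
  obtain ⟨j₁, h⟩ := exists_survivalProb_le σ C₃ hσ
  set A : ℝ := 60 * (σ ^ 2 + C₃) / σ ^ 4 with hA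
  -- With s = j₁ + i this gives i ≥ A and j₁ ≤ i/20, hence k ≤ (2/9)(21/20)i = 7i/30. As θ ≤
  -- 3/(σ²i), survival takes away at most (1/20 + 7/10)σ² = 3σ²/4 of the mean σ².
  refine ⟨21 * j₁ + 1 + ⌈A⌉₊ + j₁, fun p hp k s hs hk => ?_⟩
  have hC : 0 ≤ C₃ := zero_le_one.trans (one_le_third hp)
  obtain ⟨i, rfl⟩ : ∃ i, s = j₁ + i := ⟨s - j₁, by omega⟩
  have h1 := genSum_inter_survives_le hp (k := k) (t := k + 1 + (j₁ + i)) (by omega)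
  rw [Nat.add_sub_cancel_left] at h1
  have h2 := h p hp i
  set θ := (survivalProb p (j₁ + i)).toReal with hθ
  have hθ0 : 0 ≤ θ := ENNReal.toReal_nonneg
  have h3 : ENNReal.ofReal (σ ^ 2 + C₃ + k * σ ^ 4) * survivalProb p (j₁ + i)
      ≤ ENNReal.ofReal (3 / 4 * σ ^ 2) := by
    rw [← ENNReal.ofReal_toReal (ne_top_of_le_ne_top ENNReal.one_ne_top
      (survivalProb_le_one p (j₁ + i))), ← ENNReal.ofReal_mul (by positivity), ← hθ]
    refine ENNReal.ofReal_le_ofReal ?_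
    have hiA : A ≤ i := (Nat.le_ceil A).trans (by exact_mod_cast (by omega))
    have hi21 : 20 * (j₁ : ℝ) ≤ i := by exact_mod_cast (by omega : 20 * j₁ ≤ i)
    have hi0 : (0 : ℝ) < i := by exact_mod_cast (by omega : 0 < i)
    have hk' : 9 * (k : ℝ) ≤ 2 * (j₁ + i) := by exact_mod_cast hk
    have e1 : θ * (σ ^ 2 + C₃) ≤ 1 / 20 * σ ^ 2 := by
      have : 60 * (σ ^ 2 + C₃) ≤ i * σ ^ 4 := by
        rwa [hA, div_le_iff₀ (by positivity)] at hiA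
      have h5 : θ * (60 * (σ ^ 2 + C₃)) ≤ θ * (i * σ ^ 4) := by gcongr
      have h6 : θ * (i * σ ^ 4) = (θ * (σ ^ 2 * i)) * σ ^ 2 := by ring
      have h7 : (θ * (σ ^ 2 * i)) * σ ^ 2 ≤ 3 * σ ^ 2 := by gcongr
      linarith
    have e2 : θ * (k * σ ^ 4) ≤ 7 / 10 * σ ^ 2 := by
      have h5 : (k : ℝ) ≤ 7 / 30 * i := by linarith
      calc θ * (k * σ ^ 4) ≤ θ * (7 / 30 * i * σ ^ 4) := by gcongr
        _ = 7 / 30 * (θ * (σ ^ 2 * i)) * σ ^ 2 := by ring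
        _ ≤ 7 / 30 * 3 * σ ^ 2 := by gcongr
        _ = 7 / 10 * σ ^ 2 := by ring
    linarith
  have h4 : ENNReal.ofReal (σ ^ 2) ≤ (genSum (k + 1) fun w =>
      hangingTreeLaw p hp.mean ({ξ | InTree ξ w} ∩ diesOutBy (k + 1 + (j₁ + i))))
      + ENNReal.ofReal (3 / 4 * σ ^ 2) := by
    rw [← genSum_hanging hp k]
    refine le_trans (genSum_mono fun w _ => ?_) ((genSum_add _ _ _).le.trans
      (add_le_add_right (h1.trans h3) _))
    rw [← compl_diesOutBy]
    exact (measure_inter_add_sdiff _ (measurableSet_diesOutBy _)).ge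
  have e : ENNReal.ofReal (σ ^ 2) = ENNReal.ofReal (σ ^ 2 / 4) + ENNReal.ofReal (3 / 4 * σ ^ 2) := by
    rw [← ENNReal.ofReal_add (by positivity) (by positivity)]
    congr 1; ring
  rw [e] at h4
  exact (ENNReal.add_le_add_iff_right ENNReal.ofReal_ne_top).1 h4

end Hanging

/-! ### Paths in a tree with a backbone -/

section Paths

variable {N d : ℕ}

/-- The edges (coded by their lower end) between the root and the backbone vertex `V_i`. -/
def backPath (i : Fin (N + 1)) : Finset (Vertex N) :=
  (Finset.Ioc 0 i).image fun j => (j, [])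

/-- The edges on the path from the backbone vertex `V_i` to its descendant `(i, w)`. -/
def hangPath (i : Fin (N + 1)) : List ℕ → Finset (Vertex N)
  | [] => ∅
  | c :: w => insert (i, c :: w) (hangPath i w)

/-- The edges on the path from the root to a vertex. -/
def path (U : Vertex N) : Finset (Vertex N) := backPath U.1 ∪ hangPath U.1 U.2

lemma mem_backPath {i : Fin (N + 1)} {e : Vertex N} :
    e ∈ backPath i ↔ e.2 = [] ∧ 0 < e.1 ∧ e.1 ≤ i := by
  obtain ⟨j, v⟩ := e
  simp only [backPath, Finset.mem_image, Finset.mem_Ioc, Prod.mk.injEq]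
  constructor
  · rintro ⟨k, hk, rfl, rfl⟩
    exact ⟨rfl, hk⟩
  · rintro ⟨rfl, h⟩
    exact ⟨j, h, rfl, rfl⟩

lemma mem_hangPath {i : Fin (N + 1)} {w : List ℕ} {e : Vertex N} :
    e ∈ hangPath i w ↔ e.1 = i ∧ e.2 <:+ w ∧ e.2 ≠ [] := by
  obtain ⟨j, v⟩ := e
  induction w with
  | nil =>
    simp only [hangPath, Finset.notMem_empty, false_iff, List.suffix_nil]
    tauto
  | cons c w ih =>
    simp only [hangPath, Finset.mem_insert, ih, List.suffix_cons_iff, Prod.mk.injEq]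
    constructor
    · rintro (⟨rfl, rfl⟩ | ⟨rfl, h, h'⟩)
      · exact ⟨rfl, Or.inl rfl, by simp⟩
      · exact ⟨rfl, Or.inr h, h'⟩
    · rintro ⟨rfl, rfl | h, h'⟩
      · exact Or.inl ⟨rfl, rfl⟩
      · exact Or.inr ⟨rfl, h, h'⟩

lemma disjoint_backPath_hangPath (i j : Fin (N + 1)) (w : List ℕ) :
    Disjoint (backPath i) (hangPath j w) :=
  Finset.disjoint_left.2 fun _ h h' => (mem_hangPath.1 h').2.2 (mem_backPath.1 h).1

lemma card_backPath (i : Fin (N + 1)) : (backPath i).card = i := by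
  rw [backPath, Finset.card_image_of_injective _ (fun j k h => by simpa using h)]
  simp

lemma cons_notMem_hangPath (i : Fin (N + 1)) (c : ℕ) (w : List ℕ) :
    (i, c :: w) ∉ hangPath i w := fun h => by
  have := (mem_hangPath.1 h).2.1.length_le
  simp at this

lemma card_hangPath (i : Fin (N + 1)) (w : List ℕ) : (hangPath i w).card = w.length := by
  induction w with
  | nil => rfl
  | cons c w ih =>
    rw [hangPath, Finset.card_insert_of_notMem (cons_notMem_hangPath i c w), ih, List.length_cons]

lemma card_path (U : Vertex N) : (path U).card = height U := by
  rw [path, Finset.card_union_of_disjoint (disjoint_backPath_hangPath _ _ _), card_backPath,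
    card_hangPath, height]

lemma hangingDisplacement_eq (ω : Sample d N) (i : Fin (N + 1)) (w : List ℕ) :
    hangingDisplacement ω i w = ∑ e ∈ hangPath i w, ω.2 e := by
  induction w with
  | nil => rfl
  | cons c w ih =>
    rw [hangingDisplacement, hangPath, Finset.sum_insert (cons_notMem_hangPath i c w), ih, add_comm]

lemma sum_backPath (ω : Sample d N) (i : Fin (N + 1)) :
    ∑ j ∈ Finset.Ioc 0 i, ω.2 (j, []) = ∑ e ∈ backPath i, ω.2 e := by
  rw [backPath, Finset.sum_image fun j _ k _ h => by simpa using h]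

lemma location_eq (x : Fin d → ℤ) (ω : Sample d N) (U : Vertex N) :
    location x ω U = x + ∑ e ∈ path U, ω.2 e := by
  rw [location, hangingDisplacement_eq, sum_backPath, path,
    Finset.sum_union (disjoint_backPath_hangPath _ _ _), add_assoc]

/-- The height at which the paths to two vertices separate. -/
def meet (U U' : Vertex N) : ℕ := (path U ∩ path U').card

lemma meet_comm (U U' : Vertex N) : meet U U' = meet U' U := by
  rw [meet, meet, Finset.inter_comm]

lemma meet_le_left (U U' : Vertex N) : meet U U' ≤ height U := by
  rw [← card_path]; exact Finset.card_le_card Finset.inter_subset_left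

lemma meet_le_right (U U' : Vertex N) : meet U U' ≤ height U' := by
  rw [meet_comm]; exact meet_le_left U' U

lemma mem_path {U e : Vertex N} :
    e ∈ path U ↔ (e.2 = [] ∧ 0 < e.1 ∧ e.1 ≤ U.1) ∨ (e.1 = U.1 ∧ e.2 <:+ U.2 ∧ e.2 ≠ []) := by
  rw [path, Finset.mem_union, mem_backPath, mem_hangPath]

lemma meet_append (i : Fin (N + 1)) (a u : List ℕ) : meet (i, a ++ u) (i, u) = i + u.length := by
  rw [meet, Finset.inter_eq_right.2, card_path, height]
  intro e he
  rw [mem_path] at he ⊢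
  rcases he with h | ⟨h1, h2, h3⟩
  · exact Or.inl h
  · exact Or.inr ⟨h1, h2.trans (List.suffix_append a u), h3⟩

lemma meet_branching (i : Fin (N + 1)) {c c' : ℕ} (hc : c ≠ c') (a a' u : List ℕ) :
    meet (i, a ++ c :: u) (i, a' ++ c' :: u) = i + u.length := by
  have : path ((i, a ++ c :: u) : Vertex N) ∩ path (i, a' ++ c' :: u) = path (i, u) := by
    ext ⟨j, v⟩
    simp only [Finset.mem_inter, mem_path]
    constructor
    · rintro ⟨h | ⟨h1, h2, h3⟩, h' | ⟨h1', h2', h3'⟩⟩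
      · exact Or.inl h
      · exact Or.inl h
      · exact Or.inl h'
      · refine Or.inr ⟨h1, ?_, h3⟩
        have hu : u <:+ a ++ c :: u := (List.suffix_cons c u).trans (List.suffix_append a _)
        rcases le_or_gt v.length u.length with hl | hl
        · exact List.suffix_of_suffix_length_le h2 hu hl
        · exfalso
          have k1 : c :: u <:+ v := List.suffix_of_suffix_length_le (List.suffix_append a _) h2
            (by simpa using hl)
          have k2 : c' :: u <:+ v := List.suffix_of_suffix_length_le (List.suffix_append a' _) h2'
            (by simpa using hl)
          have := (List.suffix_of_suffix_length_le k1 k2 (by simp)).eq_of_length (by simp)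
          simp only [List.cons.injEq, and_true] at this
          exact hc this
    · rintro (h | ⟨h1, h2, h3⟩)
      · exact ⟨Or.inl h, Or.inl h⟩
      · exact ⟨Or.inr ⟨h1, (h2.trans (List.suffix_cons c u)).trans (List.suffix_append a _), h3⟩,
          Or.inr ⟨h1, (h2.trans (List.suffix_cons c' u)).trans (List.suffix_append a' _), h3⟩⟩
  rw [meet, this, card_path, height]

lemma meet_of_ne {i i' : Fin (N + 1)} (h : i ≠ i') (w w' : List ℕ) :
    meet (i, w) (i', w') = min (i : ℕ) i' := by
  have : path ((i, w) : Vertex N) ∩ path (i', w') = backPath (min i i') := by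
    ext ⟨j, v⟩
    simp only [Finset.mem_inter, mem_path, mem_backPath, le_min_iff]
    constructor
    · rintro ⟨h | ⟨h1, h2, h3⟩, h' | ⟨h1', h2', h3'⟩⟩
      · exact ⟨h.1, h.2.1, h.2.2, h'.2.2⟩
      · exact absurd h.1 h3'
      · exact absurd h'.1 h3
      · exact absurd (h1.symm.trans h1') h
    · rintro ⟨h1, h2, h3, h4⟩
      exact ⟨Or.inl ⟨h1, h2, h3⟩, Or.inl ⟨h1, h2, h4⟩⟩
  rw [meet, this, card_backPath]
  exact Fin.coe_min i i'

/-! ### The highest common ancestor with the end of the backbone -/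

/-- An ancestor of the last backbone vertex lies on the backbone, so the branch point is determined
by the label of U, and the existential quantifiers in `intersections` involve no choice. -/
lemma isHighestCommonAncestor_iff {Z U : Vertex N} :
    IsHighestCommonAncestor Z U (lastBackbone N) ↔ Z = (U.1, []) := by
  obtain ⟨k, z⟩ := Z
  obtain ⟨i, w⟩ := U
  constructor
  · rintro ⟨h1, h2, h3⟩
    have hz : z = [] := by
      rcases h2 with h | h
      · exact h.1
      · exact List.suffix_nil.1 h.2
    subst hz
    have hk : k ≤ i := by
      rcases h1 with h | h
      · exact h.2
      · exact h.1.le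
    have h4 := h3 (i, []) (Or.inl ⟨rfl, le_rfl⟩) (Or.inl ⟨rfl, Fin.le_last i⟩)
    simp only [height, List.length_nil, add_zero, Fin.val_fin_le] at h4
    rw [le_antisymm hk h4]
  · rintro h
    obtain ⟨rfl, rfl⟩ := Prod.mk.injEq .. ▸ h
    refine ⟨Or.inl ⟨rfl, le_rfl⟩, Or.inl ⟨rfl, Fin.le_last _⟩, ?_⟩
    rintro ⟨j, v⟩ h1 h2
    have hv : v = [] := by
      rcases h2 with h | h
      · exact h.1
      · exact List.suffix_nil.1 h.2
    subst hv
    simp only [height, List.length_nil, add_zero, Fin.val_fin_le]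
    rcases h1 with h | h
    · exact h.2
    · exact h.1.le

lemma isChildToward_iff {Z' : Vertex N} {i : Fin (N + 1)} {w : List ℕ} :
    IsChildToward Z' (i, []) (i, w) ↔ ∃ c, Z' = (i, [c]) ∧ [c] <:+ w := by
  obtain ⟨j, v⟩ := Z'
  constructor
  · rintro ⟨-, h1, h2⟩
    simp only [height, List.length_nil, add_zero] at h1
    rcases h2 with ⟨h3, h4⟩ | ⟨h3, h4⟩
    · simp only at h3 h4
      subst h3
      have : (j : ℕ) ≤ i := h4
      simp at h1
      omega
    · simp only at h3 h4
      subst h3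
      obtain ⟨c, rfl⟩ := List.length_eq_one_iff.1 (by omega : v.length = 1)
      exact ⟨c, rfl, h4⟩
  · rintro ⟨c, h, hc⟩
    obtain ⟨rfl, rfl⟩ := Prod.mk.injEq .. ▸ h
    exact ⟨⟨Or.inl ⟨rfl, le_rfl⟩, by simp⟩, by simp [height], Or.inr ⟨rfl, hc⟩⟩

end Paths

/-! ### The trees conditioned to die out -/

section Trees

variable {N : ℕ} {p : PMF ℕ} {σ C₃ : ℝ}

/-- The law of the trees attached to the backbone `V_0, …, V_N` of `𝒯_{N,2N}`. -/
def treesLaw (p : PMF ℕ) (hp : HasSum (fun k : ℕ => (k : ℝ) * (p k).toReal) 1) (N : ℕ) :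
    Measure (Fin (N + 1) → List ℕ → ℕ) :=
  Measure.pi fun i : Fin (N + 1) => cond (hangingTreeLaw p hp) (diesOutBy (2 * N - (i : ℕ)))

/-- All the trees attached to the backbone of `𝒯_{N,2N}` are at least as likely to die out in
time as not. -/
def LikelyExtinct (p : PMF ℕ) (hp : HasSum (fun k : ℕ => (k : ℝ) * (p k).toReal) 1) (N : ℕ) :
    Prop := ∀ t, N ≤ t → 1 / 2 ≤ hangingTreeLaw p hp (diesOutBy t)

/-- The price of conditioning in upper bounds: every tree has at least N generations in which to die
out, and does so with probability at least 1/2. -/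
lemma cond_le_two_mul {Ω : Type*} [MeasurableSpace Ω] {μ : Measure Ω} {s : Set Ω}
    (hs : MeasurableSet s) (h : 1 / 2 ≤ μ s) (A : Set Ω) : cond μ s A ≤ 2 * μ A := by
  rw [cond_apply hs]
  gcongr
  · rw [ENNReal.inv_le_iff_inv_le]
    simpa using h
  · exact Set.inter_subset_right

lemma inter_le_cond {Ω : Type*} [MeasurableSpace Ω] {μ : Measure Ω} [IsProbabilityMeasure μ]
    {s : Set Ω} (hs : MeasurableSet s) (A : Set Ω) : μ (A ∩ s) ≤ cond μ s A := by
  rw [cond_apply hs, Set.inter_comm]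
  exact le_mul_of_one_le_left' (ENNReal.one_le_inv.2 prob_le_one)

variable {hp : HasSum (fun k : ℕ => (k : ℝ) * (p k).toReal) 1}

lemma isProbabilityMeasure_cond_diesOutBy (hN : LikelyExtinct p hp N) (i : Fin (N + 1)) :
    IsProbabilityMeasure (cond (hangingTreeLaw p hp) (diesOutBy (2 * N - (i : ℕ)))) :=
  cond_isProbabilityMeasure fun h => by
    have := hN (2 * N - (i : ℕ)) (by omega)
    rw [h] at this
    simp at this

lemma treesLaw_eval (hN : LikelyExtinct p hp N) (i : Fin (N + 1)) {A : Set (List ℕ → ℕ)}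
    (hA : MeasurableSet A) :
    treesLaw p hp N {ξ | ξ i ∈ A} = cond (hangingTreeLaw p hp) (diesOutBy (2 * N - (i : ℕ))) A := by
  have := isProbabilityMeasure_cond_diesOutBy hN
  rw [treesLaw, ← Measure.infinitePi_eq_pi]
  exact infinitePi_eval_preimage i hA

lemma treesLaw_eval_le (hN : LikelyExtinct p hp N) (i : Fin (N + 1)) {A : Set (List ℕ → ℕ)}
    (hA : MeasurableSet A) : treesLaw p hp N {ξ | ξ i ∈ A} ≤ 2 * hangingTreeLaw p hp A := by
  rw [treesLaw_eval hN i hA]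
  exact cond_le_two_mul (measurableSet_diesOutBy _) (hN _ (by omega)) A

lemma le_treesLaw_eval (hN : LikelyExtinct p hp N) (i : Fin (N + 1)) {A : Set (List ℕ → ℕ)}
    (hA : MeasurableSet A) :
    hangingTreeLaw p hp (A ∩ diesOutBy (2 * N - (i : ℕ))) ≤ treesLaw p hp N {ξ | ξ i ∈ A} := by
  rw [treesLaw_eval hN i hA]
  exact inter_le_cond (measurableSet_diesOutBy _) A

lemma treesLaw_eval_inter_le (hN : LikelyExtinct p hp N) {i i' : Fin (N + 1)} (hi : i ≠ i')
    {A B : Set (List ℕ → ℕ)} (hA : MeasurableSet A) (hB : MeasurableSet B) :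
    treesLaw p hp N ({ξ | ξ i ∈ A} ∩ {ξ | ξ i' ∈ B})
      ≤ 4 * (hangingTreeLaw p hp A * hangingTreeLaw p hp B) := by
  have := isProbabilityMeasure_cond_diesOutBy hN
  have h : treesLaw p hp N ({ξ | ξ i ∈ A} ∩ {ξ | ξ i' ∈ B})
      = treesLaw p hp N {ξ | ξ i ∈ A} * treesLaw p hp N {ξ | ξ i' ∈ B} := by
    rw [treesLaw, ← Measure.infinitePi_eq_pi]
    refine infinitePi_inter (S := {i}) (T := {i'}) (by simpa using hi) ?_ ?_
    · exact measurable_coord (X := fun _ : Fin (N + 1) => List ℕ → ℕ) (Set.mem_singleton i) hA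
    · exact measurable_coord (X := fun _ : Fin (N + 1) => List ℕ → ℕ) (Set.mem_singleton i') hB
  rw [h]
  calc _ ≤ (2 * hangingTreeLaw p hp A) * (2 * hangingTreeLaw p hp B) :=
        mul_le_mul' (treesLaw_eval_le hN i hA) (treesLaw_eval_le hN i' hB)
    _ = _ := by ring

/-! ### Expected numbers of pairs of vertices -/

/-- The probability that the vertices `U` and `U'` belong to the tree. -/
def pairProb (p : PMF ℕ) (hp : HasSum (fun k : ℕ => (k : ℝ) * (p k).toReal) 1) (U U' : Vertex N) :
    ℝ≥0∞ := treesLaw p hp N {ξ | InTree (ξ U.1) U.2 ∧ InTree (ξ U'.1) U'.2}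

lemma genSum_genSum_descendants (hp : IsProgenyLaw p σ C₃) (k m : ℕ) :
    genSum (k + 1) (fun u => genSum m fun a =>
      hangingTreeLaw p hp.mean ({ξ | InTree ξ u} ∩ {ξ | InTree ξ (a ++ u)}))
      = ENNReal.ofReal (σ ^ 2) := by
  rw [← genSum_hanging hp k]
  refine genSum_congr fun u hu => ?_
  rw [hangingTreeLaw_eq]
  refine genSum_descendants ?_ (properSuffixes_disjoint_descendants u) (measurableSet_inTree u)
    subset_rfl m
  intro w hw
  refine pmean_hangingFamily hp.mean w ?_
  rintro rfl
  rw [List.suffix_nil.1 hw] at hu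
  simp at hu

/-- The expected number of pairs of vertices in generations `j` and `j'` of a tree hanging off the
backbone whose paths from the root of this tree share `l` edges. -/
lemma tsum_pair_hanging_le (hp : IsProgenyLaw p σ C₃) {j j' : ℕ} (hj : 0 < j) (hj' : 0 < j')
    (i : Fin (N + 1)) (l : ℕ) :
    ∑' w : List ℕ, ∑' w' : List ℕ, (if w.length = j ∧ w'.length = j' ∧ meet (i, w) (i, w') = i + l
        then hangingTreeLaw p hp.mean ({ξ | InTree ξ w} ∩ {ξ | InTree ξ w'}) else 0)
      ≤ (if l = min j j' then ENNReal.ofReal (2 * σ ^ 2) else 0)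
        + ENNReal.ofReal (if l = 0 then C₃ else σ ^ 4) := by
  set μ := hangingTreeLaw p hp.mean with hμ
  obtain ⟨k, rfl⟩ := Nat.exists_eq_succ_of_ne_zero hj.ne'
  obtain ⟨k', rfl⟩ := Nat.exists_eq_succ_of_ne_zero hj'.ne'
  refine (tsum_pair_le _).trans ?_
  rw [ENNReal.tsum_add, ENNReal.tsum_add]
  refine add_le_add ?_ ?_
  -- Pairs in which one vertex is an ancestor of, or equal to, the other: their paths separate at
  -- the lower of the two heights.
  · by_cases hl : l = min (k + 1) (k' + 1)
    · rw [if_pos hl, two_mul, ENNReal.ofReal_add (sq_nonneg σ) (sq_nonneg σ)]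
      refine add_le_add ?_ ?_
      · rw [← genSum_genSum_descendants hp k' (k - k')]
        refine ENNReal.tsum_le_tsum fun u => ?_
        split_ifs with hu
        · refine ENNReal.tsum_le_tsum fun a => ?_
          split_ifs with h1 h2 h2
          · rw [Set.inter_comm]
          · exfalso
            have := h1.1
            rw [List.length_append] at this
            omega
          · exact zero_le
          · exact zero_le
        · refine (ENNReal.tsum_eq_zero.2 fun a => if_neg ?_).le
          rintro ⟨-, h, -⟩
          exact hu h
      · rw [← genSum_genSum_descendants hp k (k' - k)]
        refine ENNReal.tsum_le_tsum fun u => ?_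
        split_ifs with hu
        · refine ENNReal.tsum_le_tsum fun a => ?_
          split_ifs with h1 h2 h2
          · exact le_rfl
          · exfalso
            have := h1.2.1
            rw [List.length_append] at this
            omega
          · exact zero_le
          · exact zero_le
        · refine (ENNReal.tsum_eq_zero.2 fun a => if_neg ?_).le
          rintro ⟨h, -, -⟩
          exact hu h
    · rw [if_neg hl, ← ENNReal.tsum_add]
      refine (ENNReal.tsum_eq_zero.2 fun u => ?_).le
      rw [add_eq_zero, ENNReal.tsum_eq_zero, ENNReal.tsum_eq_zero]
      refine ⟨fun a => if_neg ?_, fun a => if_neg ?_⟩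
      · rintro ⟨h1, h2, h3⟩
        rw [meet_append] at h3
        rw [List.length_append] at h1
        omega
      · rintro ⟨h1, h2, h3⟩
        rw [meet_comm, meet_append] at h3
        rw [List.length_append] at h2
        omega
  -- Pairs that truly branch, at a vertex of generation l. The exceptional value C₃ at l = 0 comes
  -- from the size-biased offspring law of the root.
  · refine le_trans ?_ (genSum_pfact_le hp l)
    refine ENNReal.tsum_le_tsum fun u => ?_
    by_cases hu : u.length = l
    · rw [if_pos hu]
      rw [hangingTreeLaw_eq]
      beta_reduce
      rw [← tsum_branching_pairs (pmean_hangingFamily hp.mean) u (k - l) (k' - l)]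
      refine ENNReal.tsum_le_tsum fun c => ENNReal.tsum_le_tsum fun c' => ?_
      split_ifs with hc
      · refine ENNReal.tsum_le_tsum fun a => ?_
        split_ifs with ha
        · refine ENNReal.tsum_le_tsum fun a' => ?_
          split_ifs with h1 h2 h2
          · rw [hμ, hangingTreeLaw_eq]
          · exfalso
            have := h1.2.1
            simp only [List.length_append, List.length_cons] at this
            omega
          · exact zero_le
          · exact zero_le
        · refine (ENNReal.tsum_eq_zero.2 fun a' => if_neg ?_).le
          rintro ⟨h, -, -⟩
          simp only [List.length_append, List.length_cons] at h
          omega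
      · exact le_rfl
    · rw [if_neg hu]
      refine (ENNReal.tsum_eq_zero.2 fun c => ENNReal.tsum_eq_zero.2 fun c' => ?_).le
      split_ifs with hc
      · refine ENNReal.tsum_eq_zero.2 fun a => ENNReal.tsum_eq_zero.2 fun a' => if_neg ?_
        rintro ⟨-, -, h⟩
        rw [meet_branching i hc] at h
        omega
      · rfl

/-- `U` has height between `5N/6` and `N`, and branches off the backbone between `N/2` and
`4N/6`. -/
def InWindow (U : Vertex N) : Prop :=
  5 * N ≤ 6 * height U ∧ height U ≤ N ∧ N ≤ 2 * (U.1 : ℕ) ∧ 3 * (U.1 : ℕ) ≤ 2 * N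

instance (U : Vertex N) : Decidable (InWindow U) := by
  unfold InWindow; infer_instance

/-- The expected number of pairs of vertices at heights `h`, `h'` whose paths separate at
height `a`. -/
def pairWeight (p : PMF ℕ) (hp : HasSum (fun k : ℕ => (k : ℝ) * (p k).toReal) 1) (N h h' a : ℕ) :
    ℝ≥0∞ :=
  ∑' U : Vertex N, ∑' U' : Vertex N,
    if InWindow U ∧ InWindow U' ∧ height U = h ∧ height U' = h' ∧ meet U U' = a
      then pairProb p hp U U' else 0

/-- Both vertices hang off the same backbone vertex: twice the unconditioned estimate. The term with
C₃ occurs for a single i only, so that it does not grow with N after summation. -/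
lemma tsum_same_le (hp : IsProgenyLaw p σ C₃) (hN : LikelyExtinct p hp.mean N) (hN1 : 1 ≤ N)
    (h h' a : ℕ) (i : Fin (N + 1)) :
    ∑' w : List ℕ, ∑' w' : List ℕ, (if InWindow (i, w) ∧ InWindow (i, w') ∧
        height (i, w) = h ∧ height (i, w') = h' ∧ meet (i, w) (i, w') = a
          then pairProb p hp.mean (i, w) (i, w') else 0)
      ≤ (if a = min h h' then ENNReal.ofReal (4 * σ ^ 2) else 0) + ENNReal.ofReal (2 * σ ^ 4)
        + if a = i then ENNReal.ofReal (2 * C₃) else 0 := by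
  by_cases H : (i : ℕ) < h ∧ (i : ℕ) < h' ∧ (i : ℕ) ≤ a
  · obtain ⟨hi, hi', hia⟩ := H
    calc _ ≤ 2 * ∑' w : List ℕ, ∑' w' : List ℕ, (if w.length = h - i ∧ w'.length = h' - i ∧
          meet (i, w) (i, w') = i + (a - i)
        then hangingTreeLaw p hp.mean ({ξ | InTree ξ w} ∩ {ξ | InTree ξ w'}) else 0) := by
          rw [← ENNReal.tsum_mul_left]
          refine ENNReal.tsum_le_tsum fun w => ?_
          rw [← ENNReal.tsum_mul_left]
          refine ENNReal.tsum_le_tsum fun w' => ?_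
          split_ifs with h1 h2 h2
          · exact treesLaw_eval_le hN i ((measurableSet_inTree' w).inter (measurableSet_inTree' w'))
          · exfalso
            simp only [height] at h1
            omega
          · exact zero_le
          · exact zero_le
      _ ≤ 2 * ((if a - i = min (h - i) (h' - i) then ENNReal.ofReal (2 * σ ^ 2) else 0)
        + ENNReal.ofReal (if a - i = 0 then C₃ else σ ^ 4)) := by
          gcongr
          exact tsum_pair_hanging_le hp (by omega) (by omega) i (a - i)
      _ ≤ _ := by
          have h4 : (4 : ℝ) * σ ^ 2 = 2 * (2 * σ ^ 2) := by ring
          have e2 : ENNReal.ofReal 2 = 2 := by simp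
          rw [mul_add, add_assoc, h4, ENNReal.ofReal_mul zero_le_two, ENNReal.ofReal_mul zero_le_two,
            ENNReal.ofReal_mul zero_le_two, ENNReal.ofReal_mul zero_le_two, e2]
          refine add_le_add ?_ ?_
          · have : (a - i = min (h - i) (h' - i)) ↔ a = min h h' := by omega
            simp only [this]
            split_ifs
            · exact le_rfl
            · simp
          · have : a - i = 0 ↔ a = i := by omega
            simp only [this]
            split_ifs
            · rw [ENNReal.ofReal_mul zero_le_two, e2]
              exact le_add_self
            · exact le_self_add
  · refine le_trans (ENNReal.tsum_eq_zero.2 fun w => ENNReal.tsum_eq_zero.2 fun w' =>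
      if_neg ?_).le zero_le
    rintro ⟨h1, h2, h3, h4, h5⟩
    refine H ⟨?_, ?_, ?_⟩
    · obtain ⟨h6, h7, h8, h9⟩ := h1
      simp only at h8 h9
      omega
    · obtain ⟨h6, h7, h8, h9⟩ := h2
      simp only at h8 h9
      omega
    · rw [← h5, meet, path, path]
      refine (card_backPath i).symm.trans_le (Finset.card_le_card ?_)
      exact Finset.subset_inter Finset.subset_union_left Finset.subset_union_left

/-- Trees at different backbone vertices are independent, each with mean generation size σ², and the
paths separate at the lower index; so one of the two indices must equal a. -/
lemma tsum_ne_le (hp : IsProgenyLaw p σ C₃) (hN : LikelyExtinct p hp.mean N) (hN1 : 1 ≤ N)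
    (h h' a : ℕ) {i i' : Fin (N + 1)} (hi : i ≠ i') :
    ∑' w : List ℕ, ∑' w' : List ℕ, (if InWindow (i, w) ∧ InWindow (i', w') ∧
        height (i, w) = h ∧ height (i', w') = h' ∧ meet (i, w) (i', w') = a
          then pairProb p hp.mean (i, w) (i', w') else 0)
      ≤ if (i : ℕ) = a ∨ (i' : ℕ) = a then ENNReal.ofReal (4 * σ ^ 4) else 0 := by
  by_cases H : (i : ℕ) < h ∧ (i' : ℕ) < h' ∧ min (i : ℕ) i' = a
  · obtain ⟨h1, h2, h3⟩ := H
    rw [if_pos (by omega)]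
    obtain ⟨k, hk⟩ := Nat.exists_eq_add_of_lt h1
    obtain ⟨k', hk'⟩ := Nat.exists_eq_add_of_lt h2
    calc _ ≤ 4 * (genSum (k + 1) (fun w => hangingTreeLaw p hp.mean {ξ | InTree ξ w})
          * genSum (k' + 1) (fun w' => hangingTreeLaw p hp.mean {ξ | InTree ξ w'})) := by
          simp only [genSum]
          rw [← ENNReal.tsum_mul_right, ← ENNReal.tsum_mul_left]
          refine ENNReal.tsum_le_tsum fun w => ?_
          rw [← ENNReal.tsum_mul_left, ← ENNReal.tsum_mul_left]
          refine ENNReal.tsum_le_tsum fun w' => ?_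
          split_ifs with g1 g2 g3 g3 g2 g3 g3
          · exact treesLaw_eval_inter_le hN hi (measurableSet_inTree' w) (measurableSet_inTree' w')
          all_goals first | exact zero_le | (exfalso; simp only [height] at g1; omega)
      _ = _ := by
          rw [genSum_hanging hp, genSum_hanging hp, ← ENNReal.ofReal_mul (sq_nonneg σ)]
          have h4 : (4 : ℝ≥0∞) = ENNReal.ofReal 4 := by simp
          rw [h4, ← ENNReal.ofReal_mul (by norm_num)]
          congr 1
          ring
  · refine le_trans (ENNReal.tsum_eq_zero.2 fun w => ENNReal.tsum_eq_zero.2 fun w' =>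
      if_neg ?_).le zero_le
    rintro ⟨⟨g1, g2, g3, g4⟩, ⟨g5, g6, g7, g8⟩, h3, h4, h5⟩
    rw [meet_of_ne hi] at h5
    simp only at g3 g4 g7 g8
    exact H ⟨by omega, by omega, h5⟩

lemma pairWeight_le (hp : IsProgenyLaw p σ C₃) (hN : LikelyExtinct p hp.mean N) (hN1 : 1 ≤ N)
    (hσ : 0 < σ) (hC : C₃ ≤ N * σ ^ 4) (h h' a : ℕ) :
    pairWeight p hp.mean N h h' a
      ≤ ENNReal.ofReal (N * σ ^ 4 * (22 + if a = min h h' then 8 / σ ^ 2 else 0)) := by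
  have h1 : pairWeight p hp.mean N h h' a = ∑' i : Fin (N + 1), ∑' i' : Fin (N + 1),
      ∑' w : List ℕ, ∑' w' : List ℕ, (if InWindow (i, w) ∧ InWindow (i', w') ∧
        height (i, w) = h ∧ height (i', w') = h' ∧ meet (i, w) (i', w') = a
          then pairProb p hp.mean (i, w) (i', w') else 0) := by
    rw [pairWeight, ENNReal.tsum_prod']
    refine tsum_congr fun i => ?_
    exact (tsum_congr fun w => ENNReal.tsum_prod').trans ENNReal.tsum_comm
  set X := (if a = min h h' then ENNReal.ofReal (4 * σ ^ 2) else 0) + ENNReal.ofReal (2 * σ ^ 4)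
    with hX
  set Y := ENNReal.ofReal (2 * C₃) with hY
  set Z := ENNReal.ofReal (4 * σ ^ 4) with hZ
  have hone : ∀ T : ℝ≥0∞, ∑ i : Fin (N + 1), (if a = (i : ℕ) then T else 0) ≤ T := by
    intro T
    rw [Fin.sum_univ_eq_sum_range (fun i => if a = i then T else 0), Finset.sum_ite_eq]
    split_ifs
    exacts [le_rfl, zero_le]
  calc pairWeight p hp.mean N h h' a
      ≤ ∑' i : Fin (N + 1), ∑' i' : Fin (N + 1), ((if i = i' then X + (if a = i then Y else 0) else 0)
          + ((if a = (i : ℕ) then Z else 0) + if a = (i' : ℕ) then Z else 0)) := by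
        rw [h1]
        refine ENNReal.tsum_le_tsum fun i => ENNReal.tsum_le_tsum fun i' => ?_
        by_cases hi : i = i'
        · subst hi
          rw [if_pos rfl]
          exact (tsum_same_le hp hN hN1 h h' a i).trans le_self_add
        · rw [if_neg hi, zero_add]
          refine (tsum_ne_le hp hN hN1 h h' a hi).trans ?_
          rw [← hZ]
          split_ifs with g1 <;> first | omega | exact zero_le | exact le_self_add | exact le_add_self
    _ = ((N + 1 : ℕ) * X + ∑ i : Fin (N + 1), (if a = (i : ℕ) then Y else 0))
          + ((N + 1 : ℕ) * (∑ i : Fin (N + 1), (if a = (i : ℕ) then Z else 0))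
            + (N + 1 : ℕ) * (∑ i : Fin (N + 1), (if a = (i : ℕ) then Z else 0))) := by
        simp only [tsum_fintype, Finset.sum_add_distrib, Finset.sum_ite_eq, Finset.mem_univ, if_true,
          Finset.sum_const, Finset.card_univ, Fintype.card_fin, nsmul_eq_mul, Finset.mul_sum]
    _ ≤ ((N + 1 : ℕ) * X + Y) + ((N + 1 : ℕ) * Z + (N + 1 : ℕ) * Z) := by
        gcongr <;> exact hone _
    _ = ENNReal.ofReal ((N + 1) * ((if a = min h h' then 4 * σ ^ 2 else 0) + 2 * σ ^ 4) + 2 * C₃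
          + ((N + 1) * (4 * σ ^ 4) + (N + 1) * (4 * σ ^ 4))) := by
        have hC₃ : 0 ≤ C₃ := zero_le_one.trans (one_le_third hp)
        have e : ((N + 1 : ℕ) : ℝ≥0∞) = ENNReal.ofReal ((N : ℝ) + 1) := by
          rw [← ENNReal.ofReal_natCast]; push_cast; rfl
        have hX' : X = ENNReal.ofReal ((if a = min h h' then 4 * σ ^ 2 else 0) + 2 * σ ^ 4) := by
          rw [hX, ENNReal.ofReal_add (by split_ifs <;> positivity) (by positivity)]
          split_ifs <;> simp
        have hite : (0 : ℝ) ≤ if a = min h h' then 4 * σ ^ 2 else 0 := by split_ifs <;> positivity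
        rw [e, hX', hY, hZ, ← ENNReal.ofReal_mul (by positivity), ← ENNReal.ofReal_mul (by positivity),
          ← ENNReal.ofReal_add (by positivity) (by positivity),
          ← ENNReal.ofReal_add (by positivity) (by positivity),
          ← ENNReal.ofReal_add (by positivity) (by positivity)]
    _ ≤ _ := by
        refine ENNReal.ofReal_le_ofReal ?_
        -- From N + 1 ≤ 2N and C₃ ≤ Nσ⁴: 22 = 4 + 2 + 16, for a common backbone vertex, the term
        -- with C₃, and different backbone vertices; the exceptional term 4σ²(N+1) is at most 8Nσ².
        have hN2 : (1 : ℝ) ≤ N := by exact_mod_cast hN1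
        have h4 : 0 < σ ^ 4 := by positivity
        have h2 : 0 < σ ^ 2 := by positivity
        split_ifs
        · have e3 : (N : ℝ) * σ ^ 4 * (22 + 8 / σ ^ 2) = 22 * (N * σ ^ 4) + 8 * (N * σ ^ 2) := by
            field_simp
          rw [e3]
          nlinarith
        · nlinarith

end Trees

/-! ### Two walks meeting at two places -/

section Meeting

variable {d N : ℕ} {q : PMF (Fin d → ℤ)}

/-- The law of the displacements along the edges. -/
def stepsLaw (q : PMF (Fin d → ℤ)) (N : ℕ) : Measure (Vertex N → Fin d → ℤ) :=
  Measure.infinitePi fun _ : Vertex N => q.toMeasure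

instance : IsProbabilityMeasure (stepsLaw q N) := by
  unfold stepsLaw; infer_instance

/-- The joint law of the end points of two walks, starting from the origin, that share their first
`a` steps, and make `b` and `c` further steps. -/
def forkProb (q : PMF (Fin d → ℤ)) (a b c : ℕ) (y y' : Fin d → ℤ) : ℝ≥0∞ :=
  ∑' v, nStep q a v * (nStep q b (y - v) * nStep q c (y' - v))

lemma stepsLaw_pair_le (U U' : Vertex N) (y y' : Fin d → ℤ) :
    stepsLaw q N {ω | ∑ e ∈ path U, ω e = y ∧ ∑ e ∈ path U', ω e = y'}
      ≤ forkProb q (meet U U') (height U - meet U U') (height U' - meet U U') y y' := by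
  have h1 : ((path U) \ (path U ∩ path U')).card = height U - meet U U' := by
    rw [Finset.card_sdiff_of_subset Finset.inter_subset_left, card_path, meet]
  have h2 : ((path U') \ (path U ∩ path U')).card = height U' - meet U U' := by
    rw [Finset.card_sdiff_of_subset Finset.inter_subset_right, card_path, meet]
  have hsub : {ω : Vertex N → Fin d → ℤ | ∑ e ∈ path U, ω e = y ∧ ∑ e ∈ path U', ω e = y'}
      ⊆ ⋃ v, {ω | ∑ e ∈ path U ∩ path U', ω e = v ∧
          ∑ e ∈ path U \ (path U ∩ path U'), ω e = y - v ∧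
          ∑ e ∈ path U' \ (path U ∩ path U'), ω e = y' - v} := by
    rintro ω ⟨h3, h4⟩
    refine Set.mem_iUnion.2 ⟨_, rfl, ?_, ?_⟩
    · rw [← h3, ← Finset.sum_sdiff (Finset.inter_subset_left (s₁ := path U) (s₂ := path U')),
        add_sub_cancel_right]
    · rw [← h4, ← Finset.sum_sdiff (Finset.inter_subset_right (s₁ := path U) (s₂ := path U')),
        add_sub_cancel_right]
  refine (measure_mono hsub).trans ((measure_iUnion_le _).trans (le_of_eq ?_))
  refine tsum_congr fun v => ?_
  rw [stepsLaw, infinitePi_sum_eq_three, h1, h2]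
  · rfl
  · exact Finset.disjoint_sdiff
  · exact Finset.disjoint_sdiff
  · rw [Finset.disjoint_left]
    intro e he he'
    simp only [Finset.mem_sdiff, Finset.mem_inter] at he he'
    tauto

/-- Reversing the second walk joins two meeting walks into a single one. -/
lemma tsum_nStep_sub_mul (hs : ∀ x, q (-x) = q x) (b b' : ℕ) (v v' : Fin d → ℤ) :
    ∑' y, nStep q b (y - v) * nStep q b' (y - v') = nStep q (b + b') (v' - v) := by
  rw [← nStep_add, ← (Equiv.addRight v).tsum_eq]
  refine tsum_congr fun y => ?_
  rw [← nStep_neg hs b']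
  simp only [Equiv.coe_addRight, add_sub_cancel_right]
  congr 2
  abel

/-- The probability that two pairs of walks as in `forkProb` end at the same two points. -/
lemma tsum_forkProb_mul_le (hs : ∀ x, q (-x) = q x) (a b c a' b' c' : ℕ) (x : Fin d → ℤ) {M : ℝ≥0∞}
    (hM : ∀ z, nStep q (a + a') z ≤ M) :
    ∑' y, ∑' y', forkProb q a b c y y' * forkProb q a' b' c' (y - x) (y' - x)
      ≤ M * nStep q (b + b' + (c + c')) 0 := by
  have h1 : ∀ y y', forkProb q a b c y y' * forkProb q a' b' c' (y - x) (y' - x)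
      = ∑' v, ∑' v', nStep q a v * nStep q a' v' *
        ((nStep q b (y - v) * nStep q b' (y - (x + v'))) *
          (nStep q c (y' - v) * nStep q c' (y' - (x + v')))) := by
    intro y y'
    rw [forkProb, forkProb, ← ENNReal.tsum_mul_right]
    refine tsum_congr fun v => ?_
    rw [← ENNReal.tsum_mul_left]
    refine tsum_congr fun v' => ?_
    rw [sub_sub, sub_sub]
    ring
  have h2 : ∑' y, ∑' y', forkProb q a b c y y' * forkProb q a' b' c' (y - x) (y' - x)
      = ∑' v, ∑' v', nStep q a v * nStep q a' v' *
        (nStep q (b + b') (x + v' - v) * nStep q (c + c') (x + v' - v)) := by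
    simp only [h1]
    calc _ = ∑' y, ∑' v, ∑' y', ∑' v', nStep q a v * nStep q a' v' *
        ((nStep q b (y - v) * nStep q b' (y - (x + v'))) *
          (nStep q c (y' - v) * nStep q c' (y' - (x + v')))) :=
          tsum_congr fun y => ENNReal.tsum_comm
      _ = ∑' v, ∑' y, ∑' v', ∑' y', nStep q a v * nStep q a' v' *
        ((nStep q b (y - v) * nStep q b' (y - (x + v'))) *
          (nStep q c (y' - v) * nStep q c' (y' - (x + v')))) := by
          rw [ENNReal.tsum_comm]
          exact tsum_congr fun v => tsum_congr fun y => ENNReal.tsum_comm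
      _ = _ := by
          refine tsum_congr fun v => ?_
          rw [ENNReal.tsum_comm]
          refine tsum_congr fun v' => ?_
          simp only [ENNReal.tsum_mul_left, ENNReal.tsum_mul_right]
          rw [tsum_nStep_sub_mul hs, tsum_nStep_sub_mul hs]
  rw [h2]
  -- The new variable z is the difference of the two separation points. Joining the initial pieces
  -- gives a factor p^(a+a') bounded by M, and the two meetings, by symmetry of the second factor,
  -- form a loop through z.
  calc _ = ∑' v', ∑' z, nStep q a (x + v' - z) * nStep q a' v' *
        (nStep q (b + b') z * nStep q (c + c') z) := by
        rw [ENNReal.tsum_comm]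
        refine tsum_congr fun v' => ?_
        rw [← (Equiv.subLeft (x + v')).tsum_eq]
        refine tsum_congr fun z => ?_
        simp only [Equiv.subLeft_apply, sub_sub_cancel]
    _ = ∑' z, (∑' v', nStep q a' v' * nStep q a (z - x - v')) *
        (nStep q (b + b') z * nStep q (c + c') (0 - z)) := by
        rw [ENNReal.tsum_comm]
        refine tsum_congr fun z => ?_
        rw [← ENNReal.tsum_mul_right]
        refine tsum_congr fun v' => ?_
        rw [zero_sub, nStep_neg hs, mul_comm (nStep q a' v'), ← nStep_neg hs a]
        congr 3
        abel
    _ ≤ ∑' z, M * (nStep q (b + b') z * nStep q (c + c') (0 - z)) := by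
        refine ENNReal.tsum_le_tsum fun z => ?_
        gcongr
        rw [nStep_add, add_comm]
        exact hM _
    _ = _ := by rw [ENNReal.tsum_mul_left, nStep_add]

lemma brwLaw_eq (p : PMF ℕ) (hp : HasSum (fun k : ℕ => (k : ℝ) * (p k).toReal) 1) :
    brwLaw q p hp N (2 * N) = (treesLaw p hp N).prod (stepsLaw q N) := rfl

instance (p : PMF ℕ) (hp : HasSum (fun k : ℕ => (k : ℝ) * (p k).toReal) 1) :
    SigmaFinite (treesLaw p hp N) := by
  unfold treesLaw; infer_instance

instance (p : PMF ℕ) (hp : HasSum (fun k : ℕ => (k : ℝ) * (p k).toReal) 1) :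
    SigmaFinite (brwLaw q p hp N (2 * N)) := by
  rw [brwLaw_eq]; infer_instance

/-- The vertices `U` and `U'` belong to the tree and have locations `y` and `y'`. -/
def pairEvent (x : Fin d → ℤ) (U U' : Vertex N) (y y' : Fin d → ℤ) : Set (Sample d N) :=
  {ξ | InTree (ξ U.1) U.2 ∧ InTree (ξ U'.1) U'.2} ×ˢ
    {ω | ∑ e ∈ path U, ω e = y - x ∧ ∑ e ∈ path U', ω e = y' - x}

lemma brwLaw_pairEvent_le (p : PMF ℕ) (hp : HasSum (fun k : ℕ => (k : ℝ) * (p k).toReal) 1)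
    (x : Fin d → ℤ) (U U' : Vertex N) (y y' : Fin d → ℤ) :
    brwLaw q p hp N (2 * N) (pairEvent x U U' y y') ≤ pairProb p hp U U' *
      forkProb q (meet U U') (height U - meet U U') (height U' - meet U U') (y - x) (y' - x) := by
  rw [brwLaw_eq, pairEvent, Measure.prod_prod]
  exact mul_le_mul' le_rfl (stepsLaw_pair_le U U' _ _)

/-- Two pairs of vertices belong to the trees, and each pair has equal locations. -/
def meetEvent (x : Fin d → ℤ) (U U' : Vertex N × Vertex N) : Set (Sample d N × Sample d N) :=
  {ω | (U.1 ∈ vertices ω.1 ∧ U'.1 ∈ vertices ω.1) ∧ (U.2 ∈ vertices ω.2 ∧ U'.2 ∈ vertices ω.2) ∧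
    location 0 ω.1 U.1 = location x ω.2 U.2 ∧ location 0 ω.1 U'.1 = location x ω.2 U'.2}

lemma meetEvent_subset (x : Fin d → ℤ) (U U' : Vertex N × Vertex N) :
    meetEvent x U U' ⊆ ⋃ y, ⋃ y', pairEvent 0 U.1 U'.1 y y' ×ˢ pairEvent x U.2 U'.2 y y' := by
  rintro ω ⟨h1, h2, h3, h4⟩
  simp only [Set.mem_iUnion]
  refine ⟨location 0 ω.1 U.1, location 0 ω.1 U'.1, ⟨h1, ?_, ?_⟩, ⟨h2, ?_, ?_⟩⟩
  · rw [location_eq]; abel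
  · rw [location_eq]; abel
  · rw [h3, location_eq]; abel
  · rw [h4, location_eq]; abel

lemma pairLaw_meetEvent_le (hs : ∀ x, q (-x) = q x) (p : PMF ℕ)
    (hp : HasSum (fun k : ℕ => (k : ℝ) * (p k).toReal) 1) (x : Fin d → ℤ)
    (U U' : Vertex N × Vertex N) (h1 : height U.1 = height U.2) (h2 : height U'.1 = height U'.2)
    {M : ℝ≥0∞} (hM : ∀ z, nStep q (meet U.1 U'.1 + meet U.2 U'.2) z ≤ M) :
    pairLaw q p hp N (meetEvent x U U') ≤ pairProb p hp U.1 U'.1 * pairProb p hp U.2 U'.2 *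
      (M * nStep q (2 * (height U.1 + height U'.1 - meet U.1 U'.1 - meet U.2 U'.2)) 0) := by
  have e : ∀ y : Fin d → ℤ, y - 0 = y := sub_zero
  calc _ ≤ ∑' y, ∑' y', pairLaw q p hp N (pairEvent 0 U.1 U'.1 y y' ×ˢ pairEvent x U.2 U'.2 y y') :=
        (measure_mono (meetEvent_subset x U U')).trans ((measure_iUnion_le _).trans
          (ENNReal.tsum_le_tsum fun y => measure_iUnion_le _))
    _ ≤ ∑' y, ∑' y', (pairProb p hp U.1 U'.1 * pairProb p hp U.2 U'.2) *
        (forkProb q (meet U.1 U'.1) (height U.1 - meet U.1 U'.1) (height U'.1 - meet U.1 U'.1) y y' *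
         forkProb q (meet U.2 U'.2) (height U.2 - meet U.2 U'.2) (height U'.2 - meet U.2 U'.2)
          (y - x) (y' - x)) := by
        refine ENNReal.tsum_le_tsum fun y => ENNReal.tsum_le_tsum fun y' => ?_
        rw [pairLaw, Measure.prod_prod]
        refine (mul_le_mul' (brwLaw_pairEvent_le p hp 0 U.1 U'.1 y y')
          (brwLaw_pairEvent_le p hp x U.2 U'.2 y y')).trans (le_of_eq ?_)
        rw [e, e]
        ring
    _ ≤ _ := by
        simp only [ENNReal.tsum_mul_left]
        gcongr
        refine (tsum_forkProb_mul_le hs _ _ _ _ _ _ x hM).trans (le_of_eq ?_)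
        have := meet_le_left U.1 U'.1
        have := meet_le_right U.1 U'.1
        have := meet_le_left U.2 U'.2
        have := meet_le_right U.2 U'.2
        have e2 : height U.1 - meet U.1 U'.1 + (height U.2 - meet U.2 U'.2) +
            (height U'.1 - meet U.1 U'.1 + (height U'.2 - meet U.2 U'.2))
            = 2 * (height U.1 + height U'.1 - meet U.1 U'.1 - meet U.2 U'.2) := by omega
        rw [e2]

end Meeting

/-! ### The second moment as a sum over heights -/

section SecondMoment

lemma count_eq_tsum {α : Type*} (s : Set α) : count s = ∑' x, s.indicator 1 x := by
  rw [count, ← ENNReal.tsum_set_one, ← tsum_subtype]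
  rfl

/-- Measurable hulls of the events replace any measurability of the random set. -/
lemma lintegral_count_sq_le {Ω α : Type*} [MeasurableSpace Ω] [Countable α] (μ : Measure Ω)
    (S : Ω → Set α) :
    ∫⁻ ω, count (S ω) ^ 2 ∂μ ≤ ∑' a, ∑' b, μ {ω | a ∈ S ω ∧ b ∈ S ω} := by
  have h1 : ∀ ω, count (S ω) ^ 2
      ≤ ∑' a, ∑' b, (toMeasurable μ {ω | a ∈ S ω ∧ b ∈ S ω}).indicator 1 ω := by
    intro ω
    rw [sq, count_eq_tsum, ← ENNReal.tsum_mul_right]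
    refine ENNReal.tsum_le_tsum fun a => ?_
    rw [← ENNReal.tsum_mul_left]
    refine ENNReal.tsum_le_tsum fun b => ?_
    by_cases h : a ∈ S ω ∧ b ∈ S ω
    · rw [Set.indicator_of_mem (subset_toMeasurable μ _ h), Set.indicator_of_mem h.1,
        Set.indicator_of_mem h.2]
      simp
    · rcases not_and_or.1 h with h | h <;> simp [h]
  have hm : ∀ a b, Measurable ((toMeasurable μ {ω | a ∈ S ω ∧ b ∈ S ω}).indicator (1 : Ω → ℝ≥0∞)) :=
    fun a b => measurable_one.indicator (measurableSet_toMeasurable μ _)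
  refine (lintegral_mono h1).trans (le_of_eq ?_)
  rw [lintegral_tsum fun a => (Measurable.tsum fun b => hm a b).aemeasurable]
  refine tsum_congr fun a => ?_
  rw [lintegral_tsum fun b => (hm a b).aemeasurable]
  refine tsum_congr fun b => ?_
  rw [lintegral_indicator_one (measurableSet_toMeasurable μ _), measure_toMeasurable]

variable {d N : ℕ} {q : PMF (Fin d → ℤ)}

lemma BranchesWell.inWindow {x : Fin d → ℤ} {ω : Sample d N} {U Z Z' : Vertex N}
    (h : BranchesWell q x ω U Z Z') : InWindow U := by
  have hZ := isHighestCommonAncestor_iff.1 h.isHCA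
  have h1 := h.height_ge
  have h3 := h.branch_ge
  have h4 := h.branch_le
  have h5 : height Z = U.1 := by rw [hZ]; simp [height]
  rw [h5] at h3 h4
  refine ⟨?_, h.height_le, ?_, ?_⟩
  · have : (5 * N : ℝ) ≤ 6 * (height U : ℝ) := by linarith
    exact_mod_cast this
  · have : (N : ℝ) ≤ 2 * ((U.1 : ℕ) : ℝ) := by linarith
    exact_mod_cast this
  · have : 3 * ((U.1 : ℕ) : ℝ) ≤ 2 * N := by linarith
    exact_mod_cast this

/-- Both paths follow the backbone up to height N/2. Over two trees this gives at least N common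
steps, hence the factor N⁻³ in the second moment. -/
lemma inWindow_le_meet {U U' : Vertex N} (h : InWindow U) (h' : InWindow U') :
    N ≤ 2 * meet U U' := by
  obtain ⟨i, w⟩ := U
  obtain ⟨i', w'⟩ := U'
  obtain ⟨-, -, h3, -⟩ := h
  obtain ⟨-, -, h7, -⟩ := h'
  simp only at h3 h7
  have : min (i : ℕ) i' ≤ meet (i, w) (i', w') := by
    have e : min (i : ℕ) i' = (backPath (min i i')).card := by
      rw [card_backPath]; exact (Fin.coe_min i i').symm
    rw [e, meet]
    refine Finset.card_le_card fun e he => ?_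
    rw [mem_backPath, le_min_iff] at he
    exact Finset.mem_inter.2 ⟨mem_path.2 (Or.inl ⟨he.1, he.2.1, he.2.2.1⟩),
      mem_path.2 (Or.inl ⟨he.1, he.2.1, he.2.2.2⟩)⟩
  omega

/-- The second moment of the number of intersections, in terms of the expected numbers of pairs
of vertices in one tree with given heights and branching height. -/
lemma lintegral_sq_le_tsum (hs : ∀ x, q (-x) = q x) (p : PMF ℕ)
    (hp : HasSum (fun k : ℕ => (k : ℝ) * (p k).toReal) 1) (x : Fin d → ℤ) {M : ℝ≥0∞}
    (hM : ∀ n, N ≤ n → ∀ z, nStep q n z ≤ M) :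
    ∫⁻ ω, count (intersections q x ω) ^ 2 ∂(pairLaw q p hp N)
      ≤ ∑' h, ∑' h', ∑' a, ∑' b, pairWeight p hp N h h' a * pairWeight p hp N h h' b *
          (M * nStep q (2 * (h + h' - a - b)) 0) := by
  set X : Vertex N → Vertex N → ℕ → ℕ → ℕ → ℝ≥0∞ := fun U U' h h' a =>
    if InWindow U ∧ InWindow U' ∧ height U = h ∧ height U' = h' ∧ meet U U' = a
      then pairProb p hp U U' else 0 with hX
  set G : ℕ → ℕ → ℕ → ℕ → ℝ≥0∞ := fun h h' a b => M * nStep q (2 * (h + h' - a - b)) 0 with hG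
  have h1 : ∀ U U' : Vertex N × Vertex N,
      pairLaw q p hp N {ω | U ∈ intersections q x ω ∧ U' ∈ intersections q x ω}
        ≤ ∑' h, ∑' h', ∑' a, ∑' b, X U.1 U'.1 h h' a * X U.2 U'.2 h h' b * G h h' a b := by
    intro U U'
    by_cases hU : (InWindow U.1 ∧ InWindow U'.1) ∧ (InWindow U.2 ∧ InWindow U'.2) ∧
        height U.1 = height U.2 ∧ height U'.1 = height U'.2
    · obtain ⟨⟨k1, k2⟩, ⟨k3, k4⟩, k5, k6⟩ := hU
      have hsub : {ω | U ∈ intersections q x ω ∧ U' ∈ intersections q x ω} ⊆ meetEvent x U U' := by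
        rintro ω ⟨⟨⟨Z₁, Z₁', g1⟩, ⟨Z₂, Z₂', g2⟩, g3⟩, ⟨⟨Z₃, Z₃', g4⟩, ⟨Z₄, Z₄', g5⟩, g6⟩⟩
        exact ⟨⟨g1.mem, g4.mem⟩, ⟨g2.mem, g5.mem⟩, congrArg Prod.fst g3, congrArg Prod.fst g6⟩
      have m1 := inWindow_le_meet k1 k2
      have m2 := inWindow_le_meet k3 k4
      refine (measure_mono hsub).trans ((pairLaw_meetEvent_le hs p hp x U U' k5 k6
        (hM _ (by omega))).trans ?_)
      refine le_trans (le_of_eq ?_) ((ENNReal.le_tsum (height U.1)).trans' <|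
        (ENNReal.le_tsum (height U'.1)).trans' <| (ENNReal.le_tsum (meet U.1 U'.1)).trans' <|
        ENNReal.le_tsum (meet U.2 U'.2))
      simp only [hX, hG]
      rw [if_pos ⟨k1, k2, trivial, trivial, trivial⟩, if_pos ⟨k3, k4, k5.symm, k6.symm, trivial⟩]
    · refine le_trans (le_of_eq ?_) zero_le
      convert measure_empty (μ := pairLaw q p hp N)
      refine Set.eq_empty_of_forall_notMem ?_
      rintro ω ⟨⟨⟨Z₁, Z₁', g1⟩, ⟨Z₂, Z₂', g2⟩, g3⟩, ⟨⟨Z₃, Z₃', g4⟩, ⟨Z₄, Z₄', g5⟩, g6⟩⟩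
      exact hU ⟨⟨g1.inWindow, g4.inWindow⟩, ⟨g2.inWindow, g5.inWindow⟩, congrArg Prod.snd g3,
        congrArg Prod.snd g6⟩
  refine (lintegral_count_sq_le _ _).trans ((ENNReal.tsum_le_tsum fun U =>
    ENNReal.tsum_le_tsum fun U' => h1 U U').trans (le_of_eq ?_))
  have hc4 : ∀ (F : (Vertex N × Vertex N) → (Vertex N × Vertex N) → ℕ → ℕ → ℕ → ℕ → ℝ≥0∞),
      ∑' U, ∑' U', ∑' h, ∑' h', ∑' a, ∑' b, F U U' h h' a b
        = ∑' h, ∑' h', ∑' a, ∑' b, ∑' U, ∑' U', F U U' h h' a b := by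
    intro F
    have e : ∀ K : (Vertex N × Vertex N) → (Vertex N × Vertex N) → ℕ → ℝ≥0∞,
        ∑' U, ∑' U', ∑' h, K U U' h = ∑' h, ∑' U, ∑' U', K U U' h := fun K =>
      (tsum_congr fun U => ENNReal.tsum_comm).trans ENNReal.tsum_comm
    rw [e]
    refine tsum_congr fun h => ?_
    rw [e]
    refine tsum_congr fun h' => ?_
    rw [e]
    refine tsum_congr fun a => ?_
    rw [e]
  rw [hc4]
  refine tsum_congr fun h => tsum_congr fun h' => tsum_congr fun a => tsum_congr fun b => ?_
  change _ = (∑' U, ∑' U', X U U' h h' a) * (∑' U, ∑' U', X U U' h h' b) * G h h' a b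
  rw [ENNReal.tsum_prod']
  simp only [ENNReal.tsum_prod', ENNReal.tsum_mul_left, ENNReal.tsum_mul_right]

end SecondMoment

/-! ### Summation over heights -/

section HeightSum

lemma tsum_reflect_le (f : ℕ → ℝ≥0∞) {m N : ℕ} (hm : m ≤ N) :
    ∑' a, (if a ≤ m then f (m - a) else 0) ≤ ∑ u ∈ Finset.range (N + 1), f u := by
  rw [tsum_eq_sum (s := Finset.range (m + 1))]
  · refine le_trans (le_of_eq ?_) (Finset.sum_le_sum_of_subset (Finset.range_subset_range.2
      (Nat.succ_le_succ hm)))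
    rw [← Finset.sum_range_reflect]
    refine Finset.sum_congr rfl fun a ha => ?_
    have := Finset.mem_range.1 ha
    rw [if_pos (by omega)]
    congr 1
    omega
  · intro a ha
    rw [if_neg]
    simpa using ha

/-- The sum of the two truncated differences is |h - h'|, so h' = h ± (r - u - v). -/
lemma card_filter_dist_le (N h u v r : ℕ) :
    ((Finset.range (N + 1)).filter fun h' => r = u + v + ((h - h') + (h' - h))).card ≤ 2 := by
  refine (Finset.card_le_card (t := {h - (r - u - v), h + (r - u - v)}) ?_).trans
    Finset.card_le_two
  intro h' hh
  have := (Finset.mem_filter.1 hh).2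
  simp only [Finset.mem_insert, Finset.mem_singleton]
  omega

/-- Group the terms by r = u + v + |h - h'|: there are N + 1 values of h, at most two of h' once h,
u, v, r are fixed, and u, v ≤ r. -/
lemma sum_dist_le (F g : ℕ → ℝ≥0∞) (N : ℕ) :
    ∑ h ∈ Finset.range (N + 1), ∑ h' ∈ Finset.range (N + 1), ∑ u ∈ Finset.range (N + 1),
      ∑ v ∈ Finset.range (N + 1), F u * F v * g (u + v + ((h - h') + (h' - h)))
      ≤ 2 * (N + 1 : ℕ) *
          ∑ r ∈ Finset.range (3 * N + 1), (∑ u ∈ Finset.range (r + 1), F u) ^ 2 * g r := by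
  have h1 : ∀ h ∈ Finset.range (N + 1), ∀ h' ∈ Finset.range (N + 1), ∀ u ∈ Finset.range (N + 1),
      ∀ v ∈ Finset.range (N + 1), F u * F v * g (u + v + ((h - h') + (h' - h)))
        = ∑ r ∈ Finset.range (3 * N + 1),
          if r = u + v + ((h - h') + (h' - h)) then F u * F v * g r else 0 := by
    intro h hh h' hh' u hu v hv
    simp only [Finset.mem_range] at hh hh' hu hv
    rw [Finset.sum_ite_eq', if_pos (Finset.mem_range.2 (by omega))]
  calc _ = ∑ h ∈ Finset.range (N + 1), ∑ h' ∈ Finset.range (N + 1), ∑ u ∈ Finset.range (N + 1),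
        ∑ v ∈ Finset.range (N + 1), ∑ r ∈ Finset.range (3 * N + 1),
          (if r = u + v + ((h - h') + (h' - h)) then F u * F v * g r else 0) :=
        Finset.sum_congr rfl fun h hh => Finset.sum_congr rfl fun h' hh' =>
          Finset.sum_congr rfl fun u hu => Finset.sum_congr rfl fun v hv => h1 h hh h' hh' u hu v hv
    _ = ∑ r ∈ Finset.range (3 * N + 1), ∑ h ∈ Finset.range (N + 1), ∑ u ∈ Finset.range (N + 1),
        ∑ v ∈ Finset.range (N + 1), ∑ h' ∈ Finset.range (N + 1),
          (if r = u + v + ((h - h') + (h' - h)) then F u * F v * g r else 0) := by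
        refine Eq.trans (Finset.sum_congr rfl fun h _ => ?_) Finset.sum_comm
        refine Finset.sum_comm.trans (Eq.trans (Finset.sum_congr rfl fun u _ => ?_)
          Finset.sum_comm)
        refine Finset.sum_comm.trans (Eq.trans (Finset.sum_congr rfl fun v _ => ?_)
          Finset.sum_comm)
        exact Finset.sum_comm
    _ ≤ ∑ r ∈ Finset.range (3 * N + 1), ∑ h ∈ Finset.range (N + 1), ∑ u ∈ Finset.range (N + 1),
        ∑ v ∈ Finset.range (N + 1),
          2 * ((if u ≤ r then F u else 0) * (if v ≤ r then F v else 0) * g r) := by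
        gcongr with r _ h _ u _ v _
        rw [← Finset.sum_filter, Finset.sum_const, nsmul_eq_mul]
        by_cases hr : u ≤ r ∧ v ≤ r
        · rw [if_pos hr.1, if_pos hr.2]
          gcongr
          exact_mod_cast card_filter_dist_le N h u v r
        · rw [Finset.filter_eq_empty_iff.2]
          · simp
          · intro h' _
            omega
    _ = 2 * (N + 1 : ℕ) * ∑ r ∈ Finset.range (3 * N + 1),
          (∑ u ∈ Finset.range (N + 1), if u ≤ r then F u else 0) ^ 2 * g r := by
        rw [Finset.mul_sum]
        refine Finset.sum_congr rfl fun r _ => ?_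
        rw [Finset.sum_const, Finset.card_range, nsmul_eq_mul, sq, Finset.sum_mul_sum]
        simp only [← Finset.mul_sum, ← Finset.sum_mul]
        ring
    _ ≤ _ := by
        gcongr with r hr
        rw [← Finset.sum_filter]
        refine Finset.sum_le_sum_of_subset fun u hu => ?_
        simp only [Finset.mem_filter, Finset.mem_range] at hu ⊢
        omega

/-- Measure the separation heights downwards, u = min(h,h') - a and v = min(h,h') - b; then h + h' -
a - b = u + v + |h - h'|. -/
lemma tsum_heights_le (F g : ℕ → ℝ≥0∞) (W : ℕ → ℕ → ℕ → ℝ≥0∞) (N : ℕ) (B : ℝ≥0∞)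
    (hW : ∀ h h' a, W h h' a ≤ if h ≤ N ∧ h' ≤ N ∧ a ≤ min h h' then B * F (min h h' - a) else 0) :
    ∑' h, ∑' h', ∑' a, ∑' b, W h h' a * W h h' b * g (h + h' - a - b)
      ≤ B ^ 2 * (2 * (N + 1 : ℕ) *
          ∑ r ∈ Finset.range (3 * N + 1), (∑ u ∈ Finset.range (r + 1), F u) ^ 2 * g r) := by
  have h0 : ∀ h h', ¬ (h ≤ N ∧ h' ≤ N) → ∀ a, W h h' a = 0 := fun h h' hh a =>
    le_antisymm ((hW h h' a).trans (le_of_eq (if_neg (by tauto)))) zero_le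
  have h1 : ∀ h h', h ≤ N → h' ≤ N → ∑' a, ∑' b, W h h' a * W h h' b * g (h + h' - a - b)
      ≤ B ^ 2 * ∑ u ∈ Finset.range (N + 1), ∑ v ∈ Finset.range (N + 1),
          F u * F v * g (u + v + ((h - h') + (h' - h))) := by
    intro h h' hh hh'
    set m := min h h' with hm
    have hmN : m ≤ N := by omega
    calc _ ≤ ∑' a, ∑' b, (if a ≤ m then (if b ≤ m then
          B ^ 2 * (F (m - a) * F (m - b) * g ((m - a) + (m - b) + ((h - h') + (h' - h)))) else 0)
            else 0) := by
          refine ENNReal.tsum_le_tsum fun a => ENNReal.tsum_le_tsum fun b => ?_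
          refine (mul_le_mul' (mul_le_mul' (hW h h' a) (hW h h' b)) le_rfl).trans ?_
          by_cases ha : a ≤ m
          · by_cases hb : b ≤ m
            · rw [if_pos ⟨hh, hh', ha⟩, if_pos ⟨hh, hh', hb⟩, if_pos ha, if_pos hb]
              have : h + h' - a - b = (m - a) + (m - b) + ((h - h') + (h' - h)) := by omega
              rw [this]
              exact le_of_eq (by ring)
            · simp [← hm, hb]
          · simp [← hm, ha]
      _ = ∑' a, (if a ≤ m then (∑' b, if b ≤ m then
          B ^ 2 * (F (m - a) * F (m - b) * g ((m - a) + (m - b) + ((h - h') + (h' - h)))) else 0)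
            else 0) := tsum_congr fun a => by split_ifs <;> simp
      _ ≤ ∑' a, (if a ≤ m then (∑ v ∈ Finset.range (N + 1),
          B ^ 2 * (F (m - a) * F v * g ((m - a) + v + ((h - h') + (h' - h))))) else 0) := by
          refine ENNReal.tsum_le_tsum fun a => ?_
          split_ifs with ha
          · exact tsum_reflect_le
              (fun v => B ^ 2 * (F (m - a) * F v * g ((m - a) + v + ((h - h') + (h' - h))))) hmN
          · exact le_rfl
      _ ≤ ∑ u ∈ Finset.range (N + 1), ∑ v ∈ Finset.range (N + 1),
          B ^ 2 * (F u * F v * g (u + v + ((h - h') + (h' - h)))) :=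
          tsum_reflect_le (fun u => ∑ v ∈ Finset.range (N + 1),
            B ^ 2 * (F u * F v * g (u + v + ((h - h') + (h' - h))))) hmN
      _ = _ := by simp only [Finset.mul_sum]
  calc _ = ∑ h ∈ Finset.range (N + 1), ∑ h' ∈ Finset.range (N + 1),
        ∑' a, ∑' b, W h h' a * W h h' b * g (h + h' - a - b) := by
        rw [tsum_eq_sum (s := Finset.range (N + 1))]
        · refine Finset.sum_congr rfl fun h _ => tsum_eq_sum fun h' hh' => ?_
          simp [h0 h h' (by simp at hh'; omega)]
        · intro h hh
          simp only [ENNReal.tsum_eq_zero]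
          intro h' a b
          simp [h0 h h' (by simp at hh; omega)]
    _ ≤ ∑ h ∈ Finset.range (N + 1), ∑ h' ∈ Finset.range (N + 1), B ^ 2 *
        ∑ u ∈ Finset.range (N + 1), ∑ v ∈ Finset.range (N + 1),
          F u * F v * g (u + v + ((h - h') + (h' - h))) :=
        Finset.sum_le_sum fun h hh => Finset.sum_le_sum fun h' hh' =>
          h1 h h' (by simp at hh; omega) (by simp at hh'; omega)
    _ = B ^ 2 * ∑ h ∈ Finset.range (N + 1), ∑ h' ∈ Finset.range (N + 1),
        ∑ u ∈ Finset.range (N + 1), ∑ v ∈ Finset.range (N + 1),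
          F u * F v * g (u + v + ((h - h') + (h' - h))) := by simp only [Finset.mul_sum]
    _ ≤ _ := by gcongr; exact sum_dist_le F g N

end HeightSum

/-! ### The logarithm -/

section Logarithm

variable {q : PMF (Fin 6 → ℤ)}

lemma sum_range_ite_zero (K : ℝ) (r : ℕ) :
    ∑ u ∈ Finset.range (r + 1), (22 + if u = 0 then K else 0) = 22 * (r + 1) + K := by
  rw [Finset.sum_add_distrib, Finset.sum_const, Finset.card_range, Finset.sum_ite_eq',
    if_pos (Finset.mem_range.2 (Nat.succ_pos r)), nsmul_eq_mul]
  push_cast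
  ring

/-- In dimension 6 the return probability at time 2r is O(r⁻³), so the summands are O(1/r); this is
where the logarithm arises. -/
lemma exists_sum_log_le (hq : IsStepLaw q) {K : ℝ} (hK : 0 ≤ K) :
    ∃ n₀ : ℕ, ∀ N ≥ n₀, ∑ r ∈ Finset.range (3 * N + 1),
      (22 * ((r : ℝ) + 1) + K) ^ 2 * (nStep q (2 * r) 0).toReal
        ≤ 100000 / √(covMatrix q).det * Real.log N := by
  obtain ⟨n₁, hn₁, hn⟩ := exists_nStep_le hq (by norm_num : 0 < 6)
  set δ := √(covMatrix q).det with hδ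
  have hδ0 : 0 < δ := sqrt_det_pos hq
  -- From R on the local bound holds and 22(r+1) + K ≤ 24r, which gives 18432 = 24² · 32. The
  -- earlier terms have a sum independent of N, absorbed by log N, so that the constant does not
  -- depend on K.
  obtain ⟨R, hR⟩ := exists_nat_ge (max (n₁ : ℝ) (K + 22))
  have hR1 : n₁ ≤ R := by exact_mod_cast (le_max_left _ _).trans hR
  have hR2 : K + 22 ≤ R := (le_max_right _ _).trans hR
  have hR0 : 0 < R := hn₁.trans_le hR1
  set A := ∑ r ∈ Finset.range R, (22 * ((r : ℝ) + 1) + K) ^ 2 with hA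
  have hlog := (Real.tendsto_log_atTop.comp tendsto_natCast_atTop_atTop).eventually_ge_atTop
    (max 1 (A * δ / 20000))
  obtain ⟨n₂, hn₂⟩ := Filter.eventually_atTop.1 hlog
  refine ⟨max n₂ (max R 1), fun N hN => ?_⟩
  have hNR : R ≤ N := ((le_max_left _ _).trans (le_max_right _ _)).trans hN
  have hL : max 1 (A * δ / 20000) ≤ Real.log N := hn₂ N ((le_max_left _ _).trans hN)
  have hL1 : 1 ≤ Real.log N := (le_max_left _ _).trans hL
  have hL2 : A * δ / 20000 ≤ Real.log N := (le_max_right _ _).trans hL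
  have hN0 : (0 : ℝ) < N := by exact_mod_cast hR0.trans_le hNR
  have hterm : ∀ r ∈ Finset.range (3 * N + 1), (22 * ((r : ℝ) + 1) + K) ^ 2 *
      (nStep q (2 * r) 0).toReal
      ≤ (if r < R then (22 * ((r : ℝ) + 1) + K) ^ 2 else 0) + 18432 / δ * (r : ℝ)⁻¹ := by
    intro r _
    split_ifs with hr
    · have h1 := nStep_toReal_le_one (q := q) (2 * r) 0
      have : 0 ≤ 18432 / δ * (r : ℝ)⁻¹ := by positivity
      have h2 : (22 * ((r : ℝ) + 1) + K) ^ 2 * (nStep q (2 * r) 0).toReal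
        ≤ (22 * ((r : ℝ) + 1) + K) ^ 2 * 1 := by gcongr
      linarith
    · push Not at hr
      have hr0 : (0 : ℝ) < r := by exact_mod_cast hR0.trans_le hr
      have hr2 : (R : ℝ) ≤ r := by exact_mod_cast hr
      have h1 := hn (2 * r) (by omega) 0
      have h2 : √((2 * r : ℕ) : ℝ) ^ 6 = 8 * (r : ℝ) ^ 3 := by
        have : √((2 * r : ℕ) : ℝ) ^ 6 = (√((2 * r : ℕ) : ℝ) ^ 2) ^ 3 := by ring
        rw [this, Real.sq_sqrt (Nat.cast_nonneg _)]
        push_cast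
        ring
      rw [h2] at h1
      have h3 : (nStep q (2 * r) 0).toReal ≤ 32 / ((r : ℝ) ^ 3 * δ) := by
        rw [le_div_iff₀ (by positivity)]
        have : (2 : ℝ) ^ (6 + 2) = 256 := by norm_num
        rw [this] at h1
        linarith
      calc _ ≤ (24 * (r : ℝ)) ^ 2 * (32 / ((r : ℝ) ^ 3 * δ)) := by
            gcongr
            linarith
        _ = 0 + 18432 / δ * (r : ℝ)⁻¹ := by
            field_simp
            ring
  have hharm : ∑ r ∈ Finset.range (3 * N + 1), (r : ℝ)⁻¹ ≤ 1 + Real.log (3 * N : ℕ) := by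
    refine le_trans (le_of_eq ?_) (harmonic_le_one_add_log (3 * N))
    rw [harmonic, Finset.sum_range_succ']
    simp
  have hlog3 : Real.log (3 * N : ℕ) ≤ 2 + Real.log N := by
    push_cast
    rw [Real.log_mul (by norm_num) hN0.ne']
    have := Real.log_le_sub_one_of_pos (show (0 : ℝ) < 3 by norm_num)
    linarith
  have hsumA : ∑ r ∈ Finset.range (3 * N + 1), (if r < R then (22 * ((r : ℝ) + 1) + K) ^ 2 else 0)
      ≤ A := by
    rw [← Finset.sum_filter]
    refine Finset.sum_le_sum_of_subset_of_nonneg (fun r hr => ?_) fun _ _ _ => by positivity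
    simp only [Finset.mem_filter, Finset.mem_range] at hr ⊢
    exact hr.2
  have hA2 : A ≤ 20000 / δ * Real.log N := by
    rw [div_mul_eq_mul_div, le_div_iff₀ hδ0]
    linarith
  calc _ ≤ ∑ r ∈ Finset.range (3 * N + 1), ((if r < R then (22 * ((r : ℝ) + 1) + K) ^ 2 else 0)
        + 18432 / δ * (r : ℝ)⁻¹) := Finset.sum_le_sum hterm
    _ ≤ 20000 / δ * Real.log N + 18432 / δ * (4 * Real.log N) := by
        rw [Finset.sum_add_distrib, ← Finset.mul_sum]
        gcongr
        · exact hsumA.trans hA2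
        · linarith
    _ ≤ _ := by
        have : 20000 / δ * Real.log N + 18432 / δ * (4 * Real.log N)
          = 93728 / δ * Real.log N := by ring
        rw [this]
        gcongr
        norm_num

lemma scaleD_pow_six (hq : IsStepLaw q) : scaleD q ^ 6 = √(covMatrix q).det := by
  have h := (covMatrix_posDef hq).det_pos
  rw [scaleD, ← Real.rpow_natCast, ← Real.rpow_mul h.le, Real.sqrt_eq_rpow]
  norm_num

/-- The upper bound for the second moment. -/
lemma exists_second_moment_le (hq : IsStepLaw q) {σ C₃ : ℝ} (hσ : 0 < σ) :
    ∃ n₀ : ℕ, ∀ (p : PMF ℕ) (hp : IsProgenyLaw p σ C₃) (N : ℕ), n₀ ≤ N →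
      ∀ x : Fin 6 → ℤ, ∫⁻ ω, count (intersections q x ω) ^ 2 ∂(pairLaw q p hp.mean N)
        ≤ ENNReal.ofReal (102400000 * σ ^ 8 / scaleD q ^ 12 * Real.log N) := by
  obtain ⟨n₁, hn₁, hn⟩ := exists_nStep_le hq (by norm_num : 0 < 6)
  have hK : 0 ≤ 8 / σ ^ 2 := by positivity
  obtain ⟨n₂, hn₂⟩ := exists_sum_log_le hq hK
  obtain ⟨t₀, ht₀⟩ := exists_diesOutBy_ge σ C₃ hσ
  obtain ⟨n₃, hn₃⟩ := exists_nat_ge (C₃ / σ ^ 4)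
  refine ⟨max (max n₁ n₂) (max t₀ (max n₃ 1)), fun p hp N hN x => ?_⟩
  simp only [max_le_iff] at hN
  obtain ⟨⟨h1, h2⟩, h3, h4, h5⟩ := hN
  set K := 8 / σ ^ 2
  set δ := √(covMatrix q).det with hδ
  have hδ0 : 0 < δ := sqrt_det_pos hq
  have hN0 : (0 : ℝ) < N := by exact_mod_cast h5
  have hN1 : (1 : ℝ) ≤ N := by exact_mod_cast h5
  have hLE : LikelyExtinct p hp.mean N := fun t ht => ht₀ p hp t (h3.trans ht)
  have hC : C₃ ≤ N * σ ^ 4 := by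
    rw [← div_le_iff₀ (by positivity)]
    exact hn₃.trans (by exact_mod_cast h4)
  set M : ℝ := 256 / ((N : ℝ) ^ 3 * δ) with hM
  have hM' : ∀ n, N ≤ n → ∀ z, nStep q n z ≤ ENNReal.ofReal M := by
    intro n hnN z
    rw [← ENNReal.ofReal_toReal ((nStep q n).apply_ne_top z)]
    refine ENNReal.ofReal_le_ofReal ?_
    rw [hM, le_div_iff₀ (by positivity)]
    have e : √(n : ℝ) ^ 6 = (n : ℝ) ^ 3 := by
      have : √(n : ℝ) ^ 6 = (√(n : ℝ) ^ 2) ^ 3 := by ring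
      rw [this, Real.sq_sqrt (Nat.cast_nonneg _)]
    have h6 := hn n (h1.trans hnN) z
    rw [e] at h6
    have h7 : (nStep q n z).toReal * ((N : ℝ) ^ 3 * δ) ≤ (nStep q n z).toReal * ((n : ℝ) ^ 3 * δ) := by
      gcongr
    norm_num at h6
    linarith
  set F : ℕ → ℝ≥0∞ := fun u => ENNReal.ofReal (22 + if u = 0 then K else 0) with hF
  set g : ℕ → ℝ≥0∞ := fun r => ENNReal.ofReal M * nStep q (2 * r) 0 with hg
  have hite : ∀ u : ℕ, 0 ≤ 22 + if u = 0 then K else 0 := fun u => by split_ifs <;> positivity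
  have hW : ∀ h h' a, pairWeight p hp.mean N h h' a ≤ if h ≤ N ∧ h' ≤ N ∧ a ≤ min h h' then
      ENNReal.ofReal (N * σ ^ 4) * F (min h h' - a) else 0 := by
    intro h h' a
    split_ifs with hh
    · refine (pairWeight_le hp hLE h5 hσ hC h h' a).trans (le_of_eq ?_)
      rw [ENNReal.ofReal_mul (by positivity), hF]
      have : (min h h' - a = 0) ↔ a = min h h' := by omega
      simp only [this]
      rfl
    · refine (ENNReal.tsum_eq_zero.2 fun U => ENNReal.tsum_eq_zero.2 fun U' => if_neg ?_).le
      rintro ⟨⟨-, k1, -⟩, ⟨-, k2, -⟩, rfl, rfl, rfl⟩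
      exact hh ⟨k1, k2, le_min (meet_le_left U U') (meet_le_right U U')⟩
  refine (lintegral_sq_le_tsum hq.symm p hp.mean x hM').trans
    ((tsum_heights_le F g _ N _ hW).trans ?_)
  have hsum : ∑ r ∈ Finset.range (3 * N + 1), (∑ u ∈ Finset.range (r + 1), F u) ^ 2 * g r
      = ENNReal.ofReal (M * ∑ r ∈ Finset.range (3 * N + 1),
          (22 * ((r : ℝ) + 1) + K) ^ 2 * (nStep q (2 * r) 0).toReal) := by
    rw [Finset.mul_sum, ENNReal.ofReal_sum_of_nonneg fun r _ => by positivity]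
    refine Finset.sum_congr rfl fun r _ => ?_
    rw [hF, hg, ← ENNReal.ofReal_sum_of_nonneg fun u _ => hite u, sum_range_ite_zero,
      ENNReal.ofReal_mul (by positivity), ENNReal.ofReal_mul (by positivity),
      ENNReal.ofReal_toReal ((nStep q _).apply_ne_top _), ENNReal.ofReal_pow (by positivity)]
    ring
  have e : (2 * (N + 1 : ℕ) : ℝ≥0∞) = ENNReal.ofReal (2 * ((N : ℝ) + 1)) := by
    rw [ENNReal.ofReal_mul zero_le_two, ← Nat.cast_add_one, ENNReal.ofReal_natCast]
    simp
  rw [hsum, e, ← ENNReal.ofReal_pow (by positivity), ← ENNReal.ofReal_mul (by positivity),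
    ← ENNReal.ofReal_mul (by positivity)]
  refine ENNReal.ofReal_le_ofReal ?_
  have hlog : 0 ≤ Real.log N := Real.log_nonneg hN1
  -- The powers N² · N · N⁻³ cancel, and 4 · 256 · 100000 = 102400000.
  calc _ ≤ ((N : ℝ) * σ ^ 4) ^ 2 * (2 * ((N : ℝ) + N) * (M * (100000 / δ * Real.log N))) := by
        gcongr
        exact hn₂ N h2
    _ = _ := by
        have : scaleD q ^ 12 = δ ^ 2 := by
          rw [hδ, ← scaleD_pow_six hq]; ring
        rw [this, hM]
        field_simp
        ring

end Logarithm

/-! ### Counting from below -/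

section CountLower

/-- Events that occur simultaneously exhibit distinct elements, so no element is counted twice. Only
the events need be measurable, not the random set. -/
lemma tsum_le_lintegral_count {Ω ι α : Type*} [MeasurableSpace Ω] [Countable ι] (μ : Measure Ω)
    (S : Ω → Set α) (E : ι → Set Ω) (hE : ∀ i, MeasurableSet (E i)) (f : ι → α)
    (hf : ∀ ω i, ω ∈ E i → f i ∈ S ω)
    (hinj : ∀ ω i j, ω ∈ E i → ω ∈ E j → f i = f j → i = j) :
    ∑' i, μ (E i) ≤ ∫⁻ ω, count (S ω) ∂μ := by
  have h1 : ∑' i, μ (E i) = ∫⁻ ω, ∑' i, (E i).indicator 1 ω ∂μ := by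
    rw [lintegral_tsum fun i => (measurable_one.indicator (hE i)).aemeasurable]
    exact tsum_congr fun i => (lintegral_indicator_one (hE i)).symm
  rw [h1]
  refine lintegral_mono fun ω => ?_
  have h2 : ∑' i, (E i).indicator (1 : Ω → ℝ≥0∞) ω = count {i | ω ∈ E i} := by
    rw [count_eq_tsum]
    refine tsum_congr fun i => ?_
    by_cases h : ω ∈ E i
    · rw [Set.indicator_of_mem h, Set.indicator_of_mem (show i ∈ {i | ω ∈ E i} from h)]
      rfl
    · rw [Set.indicator_of_notMem h, Set.indicator_of_notMem (show i ∉ {i | ω ∈ E i} from h)]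
  change ∑' i, (E i).indicator (1 : Ω → ℝ≥0∞) ω ≤ count (S ω)
  rw [h2, count, count]
  exact_mod_cast Set.encard_le_encard_of_injOn (f := f) (fun i hi => hf ω i hi)
    fun i hi j hj h => hinj ω i j hi hj h

end CountLower

/-! ### Vertices with prescribed displacements -/

section BranchEvent

variable {d N : ℕ} {q : PMF (Fin d → ℤ)}

/-- The vertex in the first generation of the tree attached to `V_i` below which `(i, w)` lies. -/
def firstVertex (i : Fin (N + 1)) (w : List ℕ) : Vertex N := (i, w.drop (w.length - 1))

lemma exists_firstVertex_eq (i : Fin (N + 1)) {w : List ℕ} (hw : 0 < w.length) :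
    ∃ c, firstVertex i w = (i, [c]) ∧ [c] <:+ w := by
  obtain ⟨c, hc⟩ := List.length_eq_one_iff.1
    (show (w.drop (w.length - 1)).length = 1 by rw [List.length_drop]; omega)
  exact ⟨c, by rw [firstVertex, hc], hc ▸ List.drop_suffix _ _⟩

lemma firstVertex_mem (i : Fin (N + 1)) {w : List ℕ} (hw : 0 < w.length) :
    firstVertex i w ∈ hangPath i w := by
  obtain ⟨c, h1, h2⟩ := exists_firstVertex_eq i hw
  rw [h1, mem_hangPath]
  exact ⟨rfl, h2, by simp⟩

/-- The vertex `(i, w)` belongs to the tree, and the displacements along the backbone, along the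
next edge, and along the remaining part of the path to this vertex are `A`, `X`, `B`. -/
def branchEvent (i : Fin (N + 1)) (w : List ℕ) (A X B : Fin d → ℤ) : Set (Sample d N) :=
  {ξ | ξ i ∈ {η | InTree η w}} ×ˢ {ω | ∑ e ∈ backPath i, ω e = A ∧
    ∑ e ∈ {firstVertex i w}, ω e = X ∧ ∑ e ∈ (hangPath i w).erase (firstVertex i w), ω e = B}

lemma measurableSet_branchEvent (i : Fin (N + 1)) (w : List ℕ) (A X B : Fin d → ℤ) :
    MeasurableSet (branchEvent i w A X B) := by
  refine MeasurableSet.prod (measurable_pi_apply i (measurableSet_inTree' w)) ?_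
  exact (coordSigma_le _ _ (measurableSet_sum_eq _ A)).inter
    ((coordSigma_le _ _ (measurableSet_sum_eq _ X)).inter
      (coordSigma_le _ _ (measurableSet_sum_eq _ B)))

lemma brwLaw_branchEvent (p : PMF ℕ) (hp : HasSum (fun k : ℕ => (k : ℝ) * (p k).toReal) 1)
    (i : Fin (N + 1)) {w : List ℕ} (hw : 0 < w.length) (A X B : Fin d → ℤ) :
    brwLaw q p hp N (2 * N) (branchEvent i w A X B) = treesLaw p hp N {ξ | ξ i ∈ {η | InTree η w}} *
      (nStep q i A * (q X * nStep q (w.length - 1) B)) := by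
  have hmem := firstVertex_mem i hw
  rw [brwLaw_eq, branchEvent, Measure.prod_prod, stepsLaw, infinitePi_sum_eq_three, card_backPath,
    Finset.card_singleton, nStep_one_apply, Finset.card_erase_of_mem hmem, card_hangPath]
  · exact Finset.disjoint_of_subset_right (Finset.singleton_subset_iff.2 hmem)
      (disjoint_backPath_hangPath i i w)
  · exact Finset.disjoint_of_subset_right (Finset.erase_subset _ _)
      (disjoint_backPath_hangPath i i w)
  · simp

lemma location_of_mem_branchEvent {x : Fin d → ℤ} {ω : Sample d N} {i : Fin (N + 1)} {w : List ℕ}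
    (hw : 0 < w.length) {A X B : Fin d → ℤ} (h : ω ∈ branchEvent i w A X B) :
    location x ω (i, []) = x + A ∧ location x ω (firstVertex i w) = x + (A + X) ∧
      location x ω (i, w) = x + (A + (X + B)) := by
  obtain ⟨-, h1, h2, h3⟩ := h
  have h0 : ∑ e ∈ hangPath i w, ω.2 e = X + B := by
    rw [← h2, ← h3, Finset.sum_singleton, Finset.add_sum_erase _ _ (firstVertex_mem i hw)]
  obtain ⟨c, hc, -⟩ := exists_firstVertex_eq i hw
  refine ⟨?_, ?_, ?_⟩
  · rw [location_eq, path]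
    simp only [hangPath, Finset.union_empty]
    rw [h1]
  · rw [location_eq, hc, path, Finset.sum_union (disjoint_backPath_hangPath _ _ _), h1, ← h2, hc]
    simp [hangPath]
  · rw [location_eq, path, Finset.sum_union (disjoint_backPath_hangPath _ _ _), h1, h0]

lemma branchesWell_of_mem {x : Fin d → ℤ} {ω : Sample d N} {i : Fin (N + 1)} {w : List ℕ}
    (hw : 0 < w.length) {A X B : Fin d → ℤ} (h : ω ∈ branchEvent i w A X B)
    (h1 : 5 * N ≤ 6 * (i + w.length)) (h2 : (i : ℕ) + w.length ≤ N) (h3 : N ≤ 2 * (i : ℕ))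
    (h4 : 3 * (i : ℕ) ≤ 2 * N) (hA : walkNorm q A ≤ √(i : ℕ))
    (hB : walkNorm q B ≤ √((w.length - 1 : ℕ) : ℝ)) :
    BranchesWell q x ω (i, w) (i, []) (firstVertex i w) := by
  obtain ⟨l1, l2, l3⟩ := location_of_mem_branchEvent (x := x) hw h
  obtain ⟨c, hc, hcw⟩ := exists_firstVertex_eq i hw
  have hroot : location x ω (root N) = x := by
    rw [location_eq, root, path]
    simp [hangPath, backPath]
  have g1 : 5 * (N : ℝ) ≤ 6 * ((i : ℕ) + (w.length : ℝ)) := by exact_mod_cast h1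
  have g3 : (N : ℝ) ≤ 2 * ((i : ℕ) : ℝ) := by exact_mod_cast h3
  have g4 : 3 * ((i : ℕ) : ℝ) ≤ 2 * N := by exact_mod_cast h4
  constructor
  · exact h.1
  · refine ⟨Or.inl ⟨rfl, Fin.zero_le _⟩, fun hh => ?_⟩
    have := (Prod.mk.injEq .. ▸ hh : (0 : Fin (N + 1)) = i ∧ [] = w).2
    rw [← this] at hw
    simp at hw
  · exact isHighestCommonAncestor_iff.2 rfl
  · exact isChildToward_iff.2 ⟨c, hc, hcw⟩
  · simp only [height, Nat.cast_add]; linarith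
  · exact h2
  · simp only [height, List.length_nil, add_zero]; linarith
  · simp only [height, List.length_nil, add_zero]; linarith
  · rw [TypicallySpaced, l1, hroot, add_sub_cancel_left]
    simpa [height, root] using hA
  · rw [TypicallySpaced, l2, l3, hc]
    have e1 : x + (A + (X + B)) - (x + (A + X)) = B := by abel
    rw [e1]
    convert hB using 2
    simp only [height, List.length_cons, List.length_nil]
    push_cast [Nat.cast_sub (Nat.succ_le_of_lt hw)]
    ring

lemma restrictedBranch_of_mem (hq : IsStepLaw q) (hd : 0 < d) {x : Fin d → ℤ} {ω : Sample d N}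
    {i : Fin (N + 1)} {w : List ℕ} (hw : 0 < w.length) {A X B : Fin d → ℤ}
    (h : ω ∈ branchEvent i w A X B) (h1 : 12 * (i + w.length) ≤ 11 * N)
    (hB : walkNorm q B ≤ 1 / 2 * √((w.length - 1 : ℕ) : ℝ)) :
    RestrictedBranch q x ω (i, w) := by
  obtain ⟨l1, l2, l3⟩ := location_of_mem_branchEvent (x := x) hw h
  obtain ⟨c, hc, hcw⟩ := exists_firstVertex_eq i hw
  constructor
  · have g1 : 12 * ((i : ℕ) + (w.length : ℝ)) ≤ 11 * N := by exact_mod_cast h1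
    simp only [height, Nat.cast_add]
    linarith
  · intro Z Z' hZ hZ'
    rw [isHighestCommonAncestor_iff.1 hZ] at hZ'
    obtain ⟨c', rfl, hc'⟩ := isChildToward_iff.1 hZ'
    have hcc : [c'] = [c] :=
      (List.suffix_of_suffix_length_le hc' hcw (by simp)).eq_of_length (by simp)
    rw [hcc, ← hc, l2, l3]
    have e1 : x + (A + X) - (x + (A + (X + B))) = -B := by abel
    rw [e1, walkNorm_neg hq hd]
    convert hB using 3
    simp only [hc, height, List.length_cons, List.length_nil]
    push_cast [Nat.cast_sub (Nat.succ_le_of_lt hw)]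
    ring

end BranchEvent

/-! ### The displacements of an intersecting pair -/

section Displacements

variable {d : ℕ} {q : PMF (Fin d → ℤ)}

/-- The restriction of the weights `f` to the ball of radius `r` around `z`. -/
def ballWeight (q : PMF (Fin d → ℤ)) (f : (Fin d → ℤ) → ℝ≥0∞) (z : Fin d → ℝ) (r : ℝ)
    (y : Fin d → ℤ) : ℝ≥0∞ := if realNorm q ((fun i => (y i : ℝ)) - z) ≤ r then f y else 0

lemma exists_half_le_tsum_ballWeight (q : PMF (Fin d → ℤ)) {ε : ℝ} (hε : 0 < ε) :
    ∃ n₀ : ℕ, ∀ n ≥ n₀, 1 / 2 ≤ ∑' y, ballWeight q q 0 (ε * √(n : ℝ)) y := by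
  have h1 : (1 / 2 : ℝ≥0∞) < ∑' y, q y := by
    rw [q.tsum_coe, one_div]
    exact ENNReal.one_half_lt_one
  rw [ENNReal.tsum_eq_iSup_sum, lt_iSup_iff] at h1
  obtain ⟨s, hs⟩ := h1
  have ht : Filter.Tendsto (fun n : ℕ => ε * √(n : ℝ)) Filter.atTop Filter.atTop :=
    (Real.tendsto_sqrt_atTop.comp tendsto_natCast_atTop_atTop).const_mul_atTop hε
  obtain ⟨n₀, hn₀⟩ := Filter.eventually_atTop.1 (ht.eventually_ge_atTop (∑ y ∈ s, walkNorm q y))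
  refine ⟨n₀, fun n hn => hs.le.trans (le_trans (le_of_eq ?_) (ENNReal.sum_le_tsum s))⟩
  refine Finset.sum_congr rfl fun y hy => ?_
  rw [ballWeight, if_pos]
  rw [sub_zero, ← walkNorm_eq]
  exact (Finset.single_le_sum (f := fun y => walkNorm q y) (fun _ _ => Real.sqrt_nonneg _) hy).trans
    (hn₀ n hn)

/-- The displacements of two paths: along the edge leaving the backbone and along the rest of the
first path, and along the three parts of the second path. -/
abbrev Displacements (d : ℕ) :=
  (Fin d → ℤ) × (Fin d → ℤ) × (Fin d → ℤ) × (Fin d → ℤ) × (Fin d → ℤ)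

/-- The displacement along the backbone of the first path that makes the paths meet. -/
def meetingDisplacement (x : Fin d → ℤ) (τ : Displacements d) : Fin d → ℤ :=
  x + (τ.2.2.1 + (τ.2.2.2.1 + τ.2.2.2.2)) - (τ.1 + τ.2.1)

/-- All the displacements are typical. -/
def IsTypical (q : PMF (Fin d → ℤ)) (x : Fin d → ℤ) (i₁ m₁ i₂ m₂ : ℕ) (τ : Displacements d) :
    Prop :=
  walkNorm q (meetingDisplacement x τ) ≤ √i₁ ∧ walkNorm q τ.2.1 ≤ 1 / 2 * √m₁ ∧
    walkNorm q τ.2.2.1 ≤ √i₂ ∧ walkNorm q τ.2.2.2.2 ≤ 1 / 2 * √m₂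

/-- The probability of given displacements. -/
def displacementProb (q : PMF (Fin d → ℤ)) (x : Fin d → ℤ) (i₁ m₁ i₂ m₂ : ℕ) (τ : Displacements d) :
    ℝ≥0∞ :=
  (nStep q i₁ (meetingDisplacement x τ) * (q τ.1 * nStep q m₁ τ.2.1)) *
    (nStep q i₂ τ.2.2.1 * (q τ.2.2.2.1 * nStep q m₂ τ.2.2.2.2))

lemma tsum_displacements_mul (f g h k l : (Fin d → ℤ) → ℝ≥0∞) (c : ℝ≥0∞) :
    ∑' τ : Displacements d, c * (f τ.1 * (g τ.2.1 * (h τ.2.2.1 * (k τ.2.2.2.1 * l τ.2.2.2.2))))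
      = c * ((∑' y, f y) * ((∑' y, g y) * ((∑' y, h y) * ((∑' y, k y) * ∑' y, l y)))) := by
  simp only [ENNReal.tsum_prod', ENNReal.tsum_mul_left, ENNReal.tsum_mul_right]

/-- Go to x, along the second path, and back along the upper part of the first. Since the two paths
have equal length, the total number of steps has the parity of i₁. -/
lemma meetingDisplacement_pos (hs : ∀ x, q (-x) = q x) {x : Fin d → ℤ} {i₁ m₁ i₂ m₂ k : ℕ}
    (hk : 0 < nStep q (2 * k) x) (him : i₁ + m₁ = i₂ + m₂) {τ : Displacements d}
    (h1 : 0 < q τ.1) (h2 : 0 < nStep q m₁ τ.2.1) (h3 : 0 < nStep q i₂ τ.2.2.1)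
    (h4 : 0 < q τ.2.2.2.1) (h5 : 0 < nStep q m₂ τ.2.2.2.2) :
    ∃ m, m % 2 = i₁ % 2 ∧ 0 < nStep q m (meetingDisplacement x τ) := by
  rw [← nStep_one_apply] at h1 h4
  rw [← nStep_neg hs] at h1 h2
  have := nStep_pos_add (nStep_pos_add hk (nStep_pos_add h3 (nStep_pos_add h4 h5)))
    (nStep_pos_add h1 h2)
  refine ⟨2 * k + (i₂ + (1 + m₂)) + (1 + m₁), by omega, ?_⟩
  rw [meetingDisplacement, sub_eq_add_neg, neg_add]
  exact this

lemma walkNorm_le_of_ball (hq : IsStepLaw q) (hd : 0 < d) {y : Fin d → ℤ} {z : Fin d → ℝ} {r s : ℝ}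
    (h : realNorm q ((fun i => (y i : ℝ)) - z) ≤ r) (hz : realNorm q z ≤ s) :
    walkNorm q y ≤ s + r := by
  have := realNorm_add_le hq hd z ((fun i => (y i : ℝ)) - z)
  rw [add_sub_cancel] at this
  rw [walkNorm_eq]
  linarith

lemma exists_le_tsum_displacementProb {q : PMF (Fin 6 → ℤ)} (hq : IsStepLaw q) :
    ∃ n₀ : ℕ, ∀ N ≥ n₀, ∀ i₁ m₁ i₂ m₂ : ℕ, i₁ ≤ N → 16 * N ≤ 25 * i₁ → i₂ ≤ N → 16 * N ≤ 25 * i₂ →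
      m₁ ≤ N → N ≤ 10 * m₁ → m₂ ≤ N → N ≤ 10 * m₂ → i₁ + m₁ = i₂ + m₂ →
      ∀ x : Fin 6 → ℤ, walkNorm q x ≤ √(N : ℝ) → (∃ k, 0 < nStep q (2 * k) x) →
      ENNReal.ofReal (lowerConst 6 / ((N : ℝ) ^ 3 * √(covMatrix q).det)
          * ((lowerConst 6 * (1 / 25 / 2) ^ 6) ^ 3 / 4))
        ≤ ∑' τ, {τ | IsTypical q x i₁ m₁ i₂ m₂ τ}.indicator (displacementProb q x i₁ m₁ i₂ m₂) τ := by
  have hd : 0 < 6 := by norm_num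
  obtain ⟨n₁, hn₁0, hn₁⟩ := exists_le_nStep hq hd
  obtain ⟨n₂, hn₂0, hn₂⟩ := exists_le_sum_nStep_ball hq hd (ε := 1 / 25) (by norm_num) (by norm_num)
  obtain ⟨n₃, hn₃⟩ := exists_half_le_tsum_ballWeight q (ε := 1 / 25) (by norm_num)
  -- The backbone parts have length at least 16N/25 > N/2, the upper parts at least N/10.
  refine ⟨max (2 * n₁) (max (10 * n₂) (max n₃ 1)), fun N hN i₁ m₁ i₂ m₂ hi₁ hi₁' hi₂ hi₂' hm₁ hm₁' hm₂
    hm₂' him x hx ⟨k, hk⟩ => ?_⟩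
  simp only [ge_iff_le, max_le_iff] at hN
  obtain ⟨hN1, hN2, hN3, hN4⟩ := hN
  set δ := √(covMatrix q).det with hδ
  have hδ0 : 0 < δ := sqrt_det_pos hq
  have hc := lowerConst_pos 6
  have hN0 : (0 : ℝ) < N := by exact_mod_cast hN4
  have hi₁0 : (0 : ℝ) < i₁ := by exact_mod_cast (show 0 < i₁ by omega)
  have hsq : ∀ n : ℕ, n ≤ N → √(n : ℝ) ≤ √(N : ℝ) := fun n hn =>
    Real.sqrt_le_sqrt (by exact_mod_cast hn)
  have hsq' : ∀ n : ℕ, 16 * N ≤ 25 * n → 4 / 5 * √(N : ℝ) ≤ √(n : ℝ) := by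
    intro n hn
    refine Real.le_sqrt_of_sq_le ?_
    rw [mul_pow, Real.sq_sqrt hN0.le]
    have : (16 : ℝ) * N ≤ 25 * n := by exact_mod_cast hn
    linarith
  have hsN := Real.sqrt_nonneg (N : ℝ)
  -- Each backbone covers half of the distance: A₂ is near -x/2, so that x + A₂ is near x/2. Neither
  -- backbone could be typically spaced if it had to cover all of a distance √N.
  set z : Fin 6 → ℝ := (-(1 / 2) : ℝ) • fun i => (x i : ℝ) with hz
  have hzn : realNorm q z ≤ 1 / 2 * √(N : ℝ) := by
    rw [hz, realNorm_smul hq hd, ← walkNorm_eq, abs_neg, abs_of_pos (by norm_num)]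
    gcongr
  set κ := lowerConst 6 / ((N : ℝ) ^ 3 * δ) with hκ
  set f := ballWeight q q 0 (1 / 25 * √(N : ℝ)) with hf
  set g₁ := ballWeight q (nStep q m₁) 0 (1 / 25 * √(m₁ : ℝ)) with hg₁
  set g₂ := ballWeight q (nStep q m₂) 0 (1 / 25 * √(m₂ : ℝ)) with hg₂
  set a := ballWeight q (nStep q i₂) z (1 / 25 * √(i₂ : ℝ)) with ha
  have hterm : ∀ τ : Displacements 6, ENNReal.ofReal κ *
      (f τ.1 * (g₁ τ.2.1 * (a τ.2.2.1 * (f τ.2.2.2.1 * g₂ τ.2.2.2.2))))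
      ≤ {τ | IsTypical q x i₁ m₁ i₂ m₂ τ}.indicator (displacementProb q x i₁ m₁ i₂ m₂) τ := by
    rintro ⟨X₁, B₁, A₂, X₂, B₂⟩
    by_cases hpos : f X₁ * (g₁ B₁ * (a A₂ * (f X₂ * g₂ B₂))) = 0
    · simp only
      rw [hpos, mul_zero]
      exact zero_le
    simp only [mul_eq_zero, not_or] at hpos
    obtain ⟨p1, p2, p3, p4, p5⟩ := hpos
    have hball : ∀ {w : (Fin 6 → ℤ) → ℝ≥0∞} {z : Fin 6 → ℝ} {r : ℝ} {y : Fin 6 → ℤ},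
        ballWeight q w z r y ≠ 0 →
          realNorm q ((fun i => (y i : ℝ)) - z) ≤ r ∧ 0 < w y ∧ ballWeight q w z r y = w y := by
      intro w z r y h
      by_cases h' : realNorm q ((fun i => (y i : ℝ)) - z) ≤ r
      · rw [ballWeight, if_pos h'] at h ⊢
        exact ⟨h', pos_iff_ne_zero.2 h, rfl⟩
      · exact absurd (if_neg h') h
    obtain ⟨b1, w1, e1⟩ := hball p1
    obtain ⟨b2, w2, e2⟩ := hball p2
    obtain ⟨b3, w3, e3⟩ := hball p3
    obtain ⟨b4, w4, e4⟩ := hball p4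
    obtain ⟨b5, w5, e5⟩ := hball p5
    have hb0 : ∀ {y : Fin 6 → ℤ} {r : ℝ}, realNorm q ((fun i => (y i : ℝ)) - 0) ≤ r →
      walkNorm q y ≤ r := fun h => by rwa [sub_zero] at h
    have c1 := hb0 b1
    have c2 := hb0 b2
    have c4 := hb0 b4
    have c5 := hb0 b5
    have c3 := walkNorm_le_of_ball hq hd b3 hzn
    have s1 := hsq m₁ hm₁
    have s2 := hsq m₂ hm₂
    have s3 := hsq i₂ hi₂
    have s4 := hsq' i₁ hi₁'
    have s5 := hsq' i₂ hi₂'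
    have c6 : walkNorm q (x + A₂) ≤ 1 / 2 * √(N : ℝ) + 1 / 25 * √(i₂ : ℝ) := by
      refine walkNorm_le_of_ball hq hd (z := -z) ?_ (by rwa [realNorm_neg hq hd])
      convert b3 using 2
      ext j
      simp [hz]
      ring
    -- The norm is at most (1/2 + 5/25)√N = 7√N/10, below 4√N/5 ≤ √i₁.
    have hy : walkNorm q (meetingDisplacement x (X₁, B₁, A₂, X₂, B₂)) ≤ √(i₁ : ℝ) := by
      have e : meetingDisplacement x (X₁, B₁, A₂, X₂, B₂) = (x + A₂) + (X₂ + B₂) + -(X₁ + B₁) := by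
        simp only [meetingDisplacement]; abel
      rw [e]
      have t1 := walkNorm_add_le hq hd ((x + A₂) + (X₂ + B₂)) (-(X₁ + B₁))
      have t2 := walkNorm_add_le hq hd (x + A₂) (X₂ + B₂)
      have t3 := walkNorm_add_le hq hd X₂ B₂
      have t4 := walkNorm_add_le hq hd X₁ B₁
      rw [walkNorm_neg hq hd] at t1
      linarith
    have htyp : IsTypical q x i₁ m₁ i₂ m₂ (X₁, B₁, A₂, X₂, B₂) := by
      refine ⟨hy, c2.trans ?_, ?_, c5.trans ?_⟩
      · have := Real.sqrt_nonneg (m₁ : ℝ)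
        linarith
      · simp only
        linarith
      · have := Real.sqrt_nonneg (m₂ : ℝ)
        linarith
    rw [Set.indicator_of_mem (show _ ∈ {τ | IsTypical q x i₁ m₁ i₂ m₂ τ} from htyp)]
    have hlow := hn₁ i₁ (by omega) _ hy
      (meetingDisplacement_pos hq.symm hk him (τ := (X₁, B₁, A₂, X₂, B₂)) w1 w2 w3 w4 w5)
    have hκle : ENNReal.ofReal κ ≤ nStep q i₁ (meetingDisplacement x (X₁, B₁, A₂, X₂, B₂)) := by
      rw [← ENNReal.ofReal_toReal ((nStep q i₁).apply_ne_top (meetingDisplacement x _))]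
      refine ENNReal.ofReal_le_ofReal ?_
      rw [hκ, div_le_iff₀ (by positivity)]
      refine hlow.trans ?_
      have e6 : √(i₁ : ℝ) ^ 6 = (i₁ : ℝ) ^ 3 := by
        have : √(i₁ : ℝ) ^ 6 = (√(i₁ : ℝ) ^ 2) ^ 3 := by ring
        rw [this, Real.sq_sqrt hi₁0.le]
      rw [e6]
      gcongr
    simp only [displacementProb]
    rw [hf, hg₁, hg₂, ha, e1, e2, e3, e4, e5]
    calc _ ≤ nStep q i₁ (meetingDisplacement x (X₁, B₁, A₂, X₂, B₂)) *
        (q X₁ * (nStep q m₁ B₁ * (nStep q i₂ A₂ * (q X₂ * nStep q m₂ B₂)))) := by gcongr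
      _ = _ := by ring
  refine le_trans ?_ (ENNReal.tsum_le_tsum hterm)
  rw [tsum_displacements_mul]
  have hff : 1 / 2 ≤ ∑' y, f y := hn₃ N hN3
  have hgg : ∀ m : ℕ, N ≤ 10 * m → ENNReal.ofReal (lowerConst 6 * (1 / 25 / 2) ^ 6)
      ≤ ∑' y, ballWeight q (nStep q m) 0 (1 / 25 * √(m : ℝ)) y := fun m hm =>
    hn₂ m (by omega) 0 (by
      have : realNorm q (0 : Fin 6 → ℝ) = 0 := by
        have := realNorm_smul hq hd 0 (0 : Fin 6 → ℝ)
        simpa using this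
      rw [this]
      positivity)
  have haa : ENNReal.ofReal (lowerConst 6 * (1 / 25 / 2) ^ 6) ≤ ∑' y, a y :=
    hn₂ i₂ (by omega) z (by
      have := hsq' i₂ hi₂'
      linarith)
  have hhalf : (1 / 2 : ℝ≥0∞) = ENNReal.ofReal (1 / 2) := by
    rw [ENNReal.ofReal_div_of_pos two_pos]; simp
  calc _ = ENNReal.ofReal κ * (1 / 2 * (ENNReal.ofReal (lowerConst 6 * (1 / 25 / 2) ^ 6) *
        (ENNReal.ofReal (lowerConst 6 * (1 / 25 / 2) ^ 6) * (1 / 2 *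
          ENNReal.ofReal (lowerConst 6 * (1 / 25 / 2) ^ 6))))) := by
        rw [hhalf, ← ENNReal.ofReal_mul (by positivity), ← ENNReal.ofReal_mul (by positivity),
          ← ENNReal.ofReal_mul (by positivity), ← ENNReal.ofReal_mul (by positivity),
          ← ENNReal.ofReal_mul (by positivity)]
        congr 1
        ring
    _ ≤ _ := by
        gcongr
        · exact hgg m₁ hm₁'
        · exact hgg m₂ hm₂'

end Displacements

/-! ### The first moment -/

section FirstMoment

variable {N : ℕ}

/-- A range of backbone indices just below `2N/3`. -/
def branchIndex (N : ℕ) (j : Fin (N / 100)) : Fin (N + 1) := ⟨2 * N / 3 - j, by omega⟩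

/-- A range of heights just below `7N/8`. -/
def meetingHeight (N : ℕ) (j : Fin (N / 100)) : ℕ := 7 * N / 8 - j

lemma branchIndex_injective : Function.Injective (branchIndex N) := by
  intro j j' h
  have h1 : 2 * N / 3 - (j : ℕ) = 2 * N / 3 - j' := congrArg Fin.val h
  ext
  omega

lemma meetingHeight_injective : Function.Injective (meetingHeight N) := by
  intro j j' h
  have h1 : 7 * N / 8 - (j : ℕ) = 7 * N / 8 - j' := h
  ext
  omega

/-- The window for the branch heights is narrow and close to 2N/3, so that √i ≥ 4√N/5 leaves room
for the displacements. -/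
lemma branchIndex_bounds (hN : 200 ≤ N) (j : Fin (N / 100)) :
    16 * N ≤ 25 * (branchIndex N j : ℕ) ∧ 3 * (branchIndex N j : ℕ) ≤ 2 * N := by
  simp only [branchIndex]
  omega

lemma meetingHeight_bounds (hN : 200 ≤ N) (j : Fin (N / 100)) :
    5 * N ≤ 6 * meetingHeight N j ∧ 8 * meetingHeight N j ≤ 7 * N := by
  simp only [meetingHeight]
  omega

/-- The indices `(j₁, j₂, j₃)`, the words and the displacements that determine a pair of
vertices branching off the backbones at heights `branchIndex N j₁`, `branchIndex N j₂` and meeting at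
height `meetingHeight N j₃`. -/
abbrev MeetingIndex (N : ℕ) :=
  (Fin (N / 100) × Fin (N / 100) × Fin (N / 100)) × (List ℕ × List ℕ) × Displacements 6

/-- The pair of vertices determined by a meeting index. -/
def MeetingIndex.vertices (κ : MeetingIndex N) : Vertex N × Vertex N :=
  ((branchIndex N κ.1.1, κ.2.1.1), (branchIndex N κ.1.2.1, κ.2.1.2))

/-- The words have the lengths given by the heights, and the displacements are typical. -/
def MeetingIndex.IsGood (q : PMF (Fin 6 → ℤ)) (x : Fin 6 → ℤ) (κ : MeetingIndex N) : Prop :=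
  (κ.2.1.1.length = meetingHeight N κ.1.2.2 - branchIndex N κ.1.1 ∧
    κ.2.1.2.length = meetingHeight N κ.1.2.2 - branchIndex N κ.1.2.1) ∧
  IsTypical q x (branchIndex N κ.1.1) (κ.2.1.1.length - 1) (branchIndex N κ.1.2.1)
    (κ.2.1.2.length - 1) κ.2.2

/-- The event that the vertices of a good meeting index belong to the trees, with the given
displacements. -/
def MeetingIndex.event (q : PMF (Fin 6 → ℤ)) (x : Fin 6 → ℤ) (κ : MeetingIndex N) :
    Set (Sample 6 N × Sample 6 N) :=
  {_ω | κ.IsGood q x} ∩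
    branchEvent (branchIndex N κ.1.1) κ.2.1.1 (meetingDisplacement x κ.2.2) κ.2.2.1 κ.2.2.2.1 ×ˢ
    branchEvent (branchIndex N κ.1.2.1) κ.2.1.2 κ.2.2.2.2.1 κ.2.2.2.2.2.1 κ.2.2.2.2.2.2

variable {q : PMF (Fin 6 → ℤ)} {x : Fin 6 → ℤ}

lemma MeetingIndex.measurableSet_event (κ : MeetingIndex N) : MeasurableSet (κ.event q x) :=
  (MeasurableSet.const _).inter
    ((measurableSet_branchEvent _ _ _ _ _).prod (measurableSet_branchEvent _ _ _ _ _))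

lemma MeetingIndex.mem_restrictedIntersections (hq : IsStepLaw q) (hN : 200 ≤ N) (κ : MeetingIndex N)
    {ω : Sample 6 N × Sample 6 N} (h : ω ∈ κ.event q x) :
    κ.vertices ∈ restrictedIntersections q x ω := by
  obtain ⟨⟨j₁, j₂, j₃⟩, ⟨w₁, w₂⟩, X₁, B₁, A₂, X₂, B₂⟩ := κ
  obtain ⟨⟨⟨hw₁, hw₂⟩, hA₁, hB₁, hA₂, hB₂⟩, hω₁, hω₂⟩ := h
  obtain ⟨a1, a2⟩ := branchIndex_bounds hN j₁
  obtain ⟨a3, a4⟩ := branchIndex_bounds hN j₂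
  obtain ⟨a5, a6⟩ := meetingHeight_bounds hN j₃
  simp only at hw₁ hw₂ hA₁ hB₁ hA₂ hB₂ hω₁ hω₂
  have hl₁ : 0 < w₁.length := by omega
  have hl₂ : 0 < w₂.length := by omega
  have hhalf : ∀ m : ℕ, 1 / 2 * √(m : ℝ) ≤ √(m : ℝ) := fun m => by
    have := Real.sqrt_nonneg (m : ℝ)
    linarith
  have hd : 0 < 6 := by norm_num
  have k1 : (branchIndex N j₁ : ℕ) + w₁.length = meetingHeight N j₃ := by omega
  have k2 : (branchIndex N j₂ : ℕ) + w₂.length = meetingHeight N j₃ := by omega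
  have k3 : 5 * N ≤ 6 * ((branchIndex N j₁ : ℕ) + w₁.length) := by omega
  have k4 : 5 * N ≤ 6 * ((branchIndex N j₂ : ℕ) + w₂.length) := by omega
  have k5 : 12 * ((branchIndex N j₁ : ℕ) + w₁.length) ≤ 11 * N := by omega
  have k6 : 12 * ((branchIndex N j₂ : ℕ) + w₂.length) ≤ 11 * N := by omega
  have k7 : N ≤ 2 * (branchIndex N j₁ : ℕ) := by omega
  have k8 : N ≤ 2 * (branchIndex N j₂ : ℕ) := by omega
  refine ⟨⟨⟨_, _, branchesWell_of_mem hl₁ hω₁ k3 (k1.trans_le (by omega)) k7 a2 hA₁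
      (hB₁.trans (hhalf _))⟩,
    ⟨_, _, branchesWell_of_mem hl₂ hω₂ k4 (k2.trans_le (by omega)) k8 a4 hA₂
      (hB₂.trans (hhalf _))⟩, Prod.ext ?_ ?_⟩,
    restrictedBranch_of_mem hq hd hl₁ hω₁ k5 hB₁,
    restrictedBranch_of_mem hq hd hl₂ hω₂ k6 hB₂⟩
  · change location 0 ω.1 (branchIndex N j₁, w₁) = location x ω.2 (branchIndex N j₂, w₂)
    rw [(location_of_mem_branchEvent hl₁ hω₁).2.2, (location_of_mem_branchEvent hl₂ hω₂).2.2,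
      meetingDisplacement]
    simp only
    abel
  · change (branchIndex N j₁ : ℕ) + w₁.length = branchIndex N j₂ + w₂.length
    omega

/-- The vertices fix the branch indices and the words, the length of a word fixes the meeting
height, and the sample fixes the displacements along given paths. -/
lemma MeetingIndex.eq_of_mem_event (hN : 200 ≤ N) {κ κ' : MeetingIndex N}
    {ω : Sample 6 N × Sample 6 N} (h : ω ∈ κ.event q x) (h' : ω ∈ κ'.event q x)
    (hv : κ.vertices = κ'.vertices) : κ = κ' := by
  obtain ⟨⟨j₁, j₂, j₃⟩, ⟨w₁, w₂⟩, X₁, B₁, A₂, X₂, B₂⟩ := κ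
  obtain ⟨⟨k₁, k₂, k₃⟩, ⟨v₁, v₂⟩, Y₁, E₁, D₂, Y₂, E₂⟩ := κ'
  simp only [MeetingIndex.vertices, Prod.mk.injEq, branchIndex_injective.eq_iff] at hv
  obtain ⟨⟨rfl, rfl⟩, rfl, rfl⟩ := hv
  obtain ⟨⟨⟨hw, -⟩, -⟩, ⟨-, -, g1, g2⟩, ⟨-, g3, g4, g5⟩⟩ := h
  obtain ⟨⟨⟨hv, -⟩, -⟩, ⟨-, -, g1', g2'⟩, ⟨-, g3', g4', g5'⟩⟩ := h'
  have b1 := branchIndex_bounds hN j₁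
  have b2 := meetingHeight_bounds hN j₃
  have b3 := meetingHeight_bounds hN k₃
  simp only at hw hv g1 g2 g3 g4 g5 g1' g2' g3' g4' g5'
  have hj : j₃ = k₃ := meetingHeight_injective (by omega)
  subst hj g1' g2' g3' g4' g5'
  simp only [Prod.mk.injEq, true_and]
  exact ⟨g1.symm, g2.symm, g3.symm, g4.symm, g5.symm⟩

/-- Trees and displacements are independent, and the displacement factor depends on the words only
through their lengths; hence the sums over words and over displacements separate. -/
lemma pairLaw_event (p : PMF ℕ) (hp : HasSum (fun k : ℕ => (k : ℝ) * (p k).toReal) 1)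
    (j₁ j₂ j₃ : Fin (N / 100)) {w₁ w₂ : List ℕ} (τ : Displacements 6) (hl₁ : 0 < w₁.length)
    (hl₂ : 0 < w₂.length) (hw₁ : w₁.length = meetingHeight N j₃ - branchIndex N j₁)
    (hw₂ : w₂.length = meetingHeight N j₃ - branchIndex N j₂) :
    pairLaw q p hp N (MeetingIndex.event q x ((j₁, j₂, j₃), (w₁, w₂), τ))
      = treesLaw p hp N {ξ | ξ (branchIndex N j₁) ∈ {η | InTree η w₁}} *
        treesLaw p hp N {ξ | ξ (branchIndex N j₂) ∈ {η | InTree η w₂}} *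
        {τ | IsTypical q x (branchIndex N j₁) (w₁.length - 1) (branchIndex N j₂)
          (w₂.length - 1) τ}.indicator (displacementProb q x (branchIndex N j₁) (w₁.length - 1)
            (branchIndex N j₂) (w₂.length - 1)) τ := by
  by_cases h : IsTypical q x (branchIndex N j₁) (w₁.length - 1) (branchIndex N j₂) (w₂.length - 1) τ
  · have e : {_ω : Sample 6 N × Sample 6 N |
        MeetingIndex.IsGood q x (((j₁, j₂, j₃), (w₁, w₂), τ) : MeetingIndex N)} = Set.univ :=
      Set.eq_univ_of_forall fun _ => ⟨⟨hw₁, hw₂⟩, h⟩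
    rw [MeetingIndex.event, e, Set.univ_inter, pairLaw, Measure.prod_prod,
      brwLaw_branchEvent p hp _ hl₁, brwLaw_branchEvent p hp _ hl₂,
      Set.indicator_of_mem (show τ ∈ {τ | IsTypical q x _ _ _ _ τ} from h), displacementProb]
    ring
  · have e : {_ω : Sample 6 N × Sample 6 N |
        MeetingIndex.IsGood q x (((j₁, j₂, j₃), (w₁, w₂), τ) : MeetingIndex N)} = ∅ :=
      Set.eq_empty_of_forall_notMem fun _ hh => h hh.2
    rw [MeetingIndex.event, e, Set.empty_inter, measure_empty,
      Set.indicator_of_notMem (show τ ∉ {τ | IsTypical q x _ _ _ _ τ} from h), mul_zero]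

/-- The lower bound for the first moment. -/
lemma exists_le_first_moment (hq : IsStepLaw q) {σ C₃ : ℝ} (hσ : 0 < σ) :
    ∃ n₀ : ℕ, ∀ (p : PMF ℕ) (hp : IsProgenyLaw p σ C₃) (N : ℕ), n₀ ≤ N →
      ∀ x : Fin 6 → ℤ, walkNorm q x ≤ √(N : ℝ) → (∃ k, 0 < nStep q (2 * k) x) →
        ENNReal.ofReal (lowerConst 6 * (lowerConst 6 * (1 / 25 / 2) ^ 6) ^ 3 / 512000000 * σ ^ 4
            / scaleD q ^ 6)
          ≤ ∫⁻ ω, count (restrictedIntersections q x ω) ∂(pairLaw q p hp.mean N) := by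
  obtain ⟨n₁, hn₁⟩ := exists_le_tsum_displacementProb hq
  obtain ⟨s₀, hs₀⟩ := exists_genSum_diesOutBy_ge σ C₃ hσ
  obtain ⟨t₀, ht₀⟩ := exists_diesOutBy_ge σ C₃ hσ
  refine ⟨max n₁ (max s₀ (max t₀ 200)), fun p hp N hN x hx hk => ?_⟩
  simp only [max_le_iff] at hN
  obtain ⟨hN1, hN2, hN3, hN4⟩ := hN
  have hN0 : (0 : ℝ) < N := by exact_mod_cast (show 0 < N by omega)
  have hLE : LikelyExtinct p hp.mean N := fun t ht => ht₀ p hp t (hN3.trans ht)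
  set δ := √(covMatrix q).det with hδ
  have hδ0 : 0 < δ := sqrt_det_pos hq
  have hc := lowerConst_pos 6
  set K := lowerConst 6 / ((N : ℝ) ^ 3 * δ) * ((lowerConst 6 * (1 / 25 / 2) ^ 6) ^ 3 / 4) with hK
  have hK0 : 0 < K := by positivity
  have htree : ∀ j₁ j₃ : Fin (N / 100), ENNReal.ofReal (σ ^ 2 / 4) ≤
      genSum (meetingHeight N j₃ - branchIndex N j₁) fun w =>
        treesLaw p hp.mean N {ξ | ξ (branchIndex N j₁) ∈ {η | InTree η w}} := by
    intro j₁ j₃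
    have b1 := branchIndex_bounds hN4 j₁
    have b2 := meetingHeight_bounds hN4 j₃
    obtain ⟨k, hk⟩ : ∃ k, meetingHeight N j₃ - branchIndex N j₁ = k + 1 :=
      ⟨meetingHeight N j₃ - branchIndex N j₁ - 1, by omega⟩
    have e : k + 1 + (2 * N - meetingHeight N j₃) = 2 * N - branchIndex N j₁ := by omega
    -- The height is at most 7N/8, so s ≥ 9N/8 generations remain before the deadline, while k <
    -- 7N/8 - 16N/25 < N/4 ≤ 2s/9.
    have h1 := hs₀ p hp k (2 * N - meetingHeight N j₃) (by omega) (by omega)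
    rw [e] at h1
    rw [hk]
    refine h1.trans (genSum_mono fun w _ => ?_)
    exact le_treesLaw_eval hLE _ (measurableSet_inTree' w)
  have hfix : ∀ j₁ j₂ j₃ : Fin (N / 100),
      ENNReal.ofReal (σ ^ 2 / 4) * (ENNReal.ofReal (σ ^ 2 / 4) * ENNReal.ofReal K)
      ≤ ∑' w₁, ∑' w₂, ∑' τ,
        pairLaw q p hp.mean N (MeetingIndex.event q x ((j₁, j₂, j₃), (w₁, w₂), τ)) := by
    intro j₁ j₂ j₃
    have b1 := branchIndex_bounds hN4 j₁
    have b2 := meetingHeight_bounds hN4 j₃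
    have b3 := branchIndex_bounds hN4 j₂
    refine (mul_le_mul' (htree j₁ j₃) (mul_le_mul' (htree j₂ j₃) le_rfl)).trans ?_
    rw [genSum, ← ENNReal.tsum_mul_right]
    refine ENNReal.tsum_le_tsum fun w₁ => ?_
    split_ifs with hw₁
    swap
    · rw [zero_mul]; exact zero_le
    rw [genSum, ← ENNReal.tsum_mul_right, ← ENNReal.tsum_mul_left]
    refine ENNReal.tsum_le_tsum fun w₂ => ?_
    split_ifs with hw₂
    swap
    · rw [zero_mul, mul_zero]; exact zero_le
    rw [tsum_congr fun τ => pairLaw_event p hp.mean j₁ j₂ j₃ τ (by omega) (by omega) hw₁ hw₂,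
      ENNReal.tsum_mul_left, mul_assoc]
    gcongr
    exact hn₁ N hN1 _ _ _ _ (by omega) (by omega) (by omega) (by omega) (by omega) (by omega)
      (by omega) (by omega) (by omega) x hx hk
  refine le_trans ?_ (tsum_le_lintegral_count (pairLaw q p hp.mean N)
    (fun ω => restrictedIntersections q x ω) (fun κ : MeetingIndex N => κ.event q x)
    (fun κ => κ.measurableSet_event) MeetingIndex.vertices
    (fun ω κ h => κ.mem_restrictedIntersections hq hN4 h)
    (fun ω κ κ' h h' hv => MeetingIndex.eq_of_mem_event hN4 h h' hv))
  rw [ENNReal.tsum_prod']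
  refine le_trans ?_ (ENNReal.tsum_le_tsum fun j => (hfix j.1 j.2.1 j.2.2).trans (le_of_eq ?_))
  · rw [tsum_fintype, Finset.sum_const, nsmul_eq_mul, Finset.card_univ, Fintype.card_prod,
      Fintype.card_prod, Fintype.card_fin, ← ENNReal.ofReal_natCast, ← ENNReal.ofReal_mul (by positivity),
      ← ENNReal.ofReal_mul (by positivity), ← ENNReal.ofReal_mul (by positivity)]
    refine ENNReal.ofReal_le_ofReal ?_
    -- Rounding down loses at most a factor 2 for N ≥ 200. The final constant is 512000000 = 200³ ·
    -- 4² · 4, from the three height windows, the two trees and the displacements.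
    have hn : (N : ℝ) / 200 ≤ ((N / 100 : ℕ) : ℝ) := by
      rw [div_le_iff₀ (by norm_num)]
      exact_mod_cast (show N ≤ N / 100 * 200 by omega)
    push_cast
    calc _ = (N : ℝ) / 200 * (N / 200 * (N / 200)) * (σ ^ 2 / 4 * (σ ^ 2 / 4 * K)) := by
          rw [scaleD_pow_six hq, ← hδ, hK]
          field_simp
          norm_num
      _ ≤ _ := by gcongr
  · simp only [ENNReal.tsum_prod']

end FirstMoment

end BRW

end

/-! ### The moment bounds combined -/

theorem theorem3p1 :
    ∃ c' C' : ℝ, 0 < c' ∧ 0 < C' ∧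
      ∀ (σ C₃ : ℝ) (q : PMF (Fin 6 → ℤ)), 0 < σ → BRW.IsStepLaw q →
        ∃ n₉ : ℕ, ∀ (p : PMF ℕ) (hp : BRW.IsProgenyLaw p σ C₃) (N : ℕ), 1 ≤ N → n₉ ≤ N →
          ∀ x : Fin 6 → ℤ, BRW.walkNorm q x ≤ Real.sqrt (N : ℝ) →
            (∫⁻ ω, BRW.count (BRW.restrictedIntersections q x ω) ∂(BRW.pairLaw q p hp.mean N)
              ≤ ∫⁻ ω, BRW.count (BRW.intersections q x ω) ∂(BRW.pairLaw q p hp.mean N)) ∧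
            ((∃ k : ℕ, 0 < BRW.nStep q (2 * k) x) →
              ENNReal.ofReal (c' * σ ^ 4 / BRW.scaleD q ^ 6)
                ≤ ∫⁻ ω, BRW.count (BRW.restrictedIntersections q x ω)
                    ∂(BRW.pairLaw q p hp.mean N)) ∧
            (∫⁻ ω, BRW.count (BRW.intersections q x ω) ^ 2 ∂(BRW.pairLaw q p hp.mean N)
              ≤ ENNReal.ofReal (C' * σ ^ 8 / BRW.scaleD q ^ 12 * Real.log (N : ℝ))) := by
  have hc := BRW.lowerConst_pos 6
  refine ⟨BRW.lowerConst 6 * (BRW.lowerConst 6 * (1 / 25 / 2) ^ 6) ^ 3 / 512000000, 102400000,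
    by positivity, by norm_num, fun σ C₃ q hσ hq => ?_⟩
  obtain ⟨n₁, h₁⟩ := BRW.exists_le_first_moment (C₃ := C₃) hq hσ
  obtain ⟨n₂, h₂⟩ := BRW.exists_second_moment_le (C₃ := C₃) hq hσ
  refine ⟨max n₁ n₂, fun p hp N _ hN x hx => ⟨lintegral_mono fun ω => ?_,
    h₁ p hp N ((le_max_left _ _).trans hN) x hx, h₂ p hp N ((le_max_right _ _).trans hN) x⟩⟩
  exact ENat.toENNReal_mono (Set.encard_le_encard fun U hU => hU.1)
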